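/- **Setting.** Let $d\in\mathbb N$ and let $\mathcal S(\mathbb R^{m})$ be the complex Schwartz space, $\mathcal S'(\mathbb R^m)$ its strong dual, with bilinear pairing $\langle\cdot,\cdot\rangle$; $\mathcal L(E,F)$ denotes continuous linear maps. A map $f$ between real topological vector spaces is smooth ($C^\infty$) if all iterated directional (Gâteaux) derivatives $f^{(r)}(x;v_1,\dots,v_r)$ exist and are jointly continuous in $(x;v_1,\dots,v_r)$; $df[x](v)=\lim_{t\to0}t^{-1}(f(x+tv)-f(x))$. **NLS phase space.** On $\mathcal S(\mathbb R^d)$ put $\omega_{L^2}(f,g)=2\,\mathrm{Im}\int\overline{f}\,g\,dx$. The symplectic gradient $\nabla_sF(\phi)\in\mathcal S(\mathbb R^d)$ of a functional $F$ is, if it exists, the unique element with $dF[\phi](\delta)=\omega_{L^2}(\nabla_sF(\phi),\delta)$ for all $\delta\in\mathcal S(\mathbb R^d)$. Let $\mathcal A_{\mathcal S}$ be the set of $H\in C^\infty(\mathcal S(\mathbb R^d);\mathbb R)$ such that $\nabla_sH$ exists everywhere and is a smooth map $\mathcal S(\mathbb R^d)\to\mathcal S(\mathbb R^d)$, and let $\{F,G\}_{L^2}=\omega_{L^2}(\nabla_sF,\nabla_sG)$.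 **Observable hierarchies.** An operator $A\in\mathcal L(\mathcal S(\mathbb R^{dk}),\mathcal S'(\mathbb R^{dk}))$ has the *good mapping property* if for every $\alpha\le k$ there is a continuous bilinear map $\Phi_\alpha:\mathcal S(\mathbb R^{dk})^2\to\mathcal S(\mathbb R^{d}\times\mathbb R^d)$ with $$\big\langle Af,\ \underline y\mapsto\varphi(y_\alpha)\,g(y_1,\dots,y_{\alpha-1},x',y_{\alpha+1},\dots,y_k)\big\rangle=\int_{\mathbb R^d}\Phi_\alpha(f,g)(x,x')\,\varphi(x)\,dx$$ for all $f,g\in\mathcal S(\mathbb R^{dk})$, $\varphi\in\mathcal S(\mathbb R^d)$, $x'\in\mathbb R^d$. A bosonic operator, i.e. an operator from the symmetric functions $\mathcal S_s(\mathbb R^{dk})$ to the symmetric distributions $\mathcal S_s'(\mathbb R^{dk})$, is identified with its extension obtained by precomposition with the symmetrization of functions. Let $\mathfrak g_{k,gmp}$ be the set of bosonic operators with the good mapping property that are skew-adjoint, $\langle Ag,\overline f\rangle=-\overline{\langle Af,\overline g\rangle}$, and $\mathfrak G_\infty=\bigoplus_{k\ge1}\mathfrak g_{k,gmp}$. For $A\in\mathcal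 L(\mathcal S(\mathbb R^{dk}),\mathcal S'(\mathbb R^{dk}))$ let $K_A\in\mathcal S'(\mathbb R^{dk}\times\mathbb R^{dk})$ be its Schwartz kernel, $\langle K_A,g\otimes f\rangle=\langle Af,g\rangle$, and for $T\in\mathcal S(\mathbb R^{dk}\times\mathbb R^{dk})$ let $T^t(x;x')=T(x';x)$. Let $A$ be an $i$-particle and $B$ a $j$-particle operator, both with the good mapping property, and let $k=i+j-1$, $\alpha\le i$, $\beta\le j$. The contraction $A\circ_\alpha^\beta B=A_{(1,\dots,i)}B_{(i+1,\dots,i+\beta-1,\alpha,i+\beta,\dots,k)}$ is the operator in $\mathcal L(\mathcal S(\mathbb R^{dk}),\mathcal S'(\mathbb R^{dk}))$ given by $\langle(A\circ_\alpha^\beta B)f,g\rangle=\langle K_A,\Phi(f,g)^t\rangle$. Here $\Phi(f,g)\in\mathcal S(\mathbb R^{di}\times\mathbb R^{di})$ is the function of $(\underline x_i;\underline x_i')$ obtained by applying $B$ to $f$ in the coordinates $(i+1,\dots,i+\beta-1,\alpha,i+\beta,\dots,k)$, evaluating the first $i$ variables of the result at $\underline x_i$, and pairing the remaining $j-1$ with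 $g(\underline x_i',\cdot)$; by the good mapping property this is a Schwartz function. Put $$[A,B]_1=\sum_{\alpha=1}^i\sum_{\beta=1}^j\big(A\circ_\alpha^\beta B-B\circ_\beta^\alpha A\big),\qquad [A,B]_{\mathfrak G_\infty}^{(k)}=\mathrm{Sym}_k\Big(\sum_{\ell+j-1=k}[A^{(\ell)},B^{(j)}]_1\Big)$$ for $A,B\in\mathfrak G_\infty$, where $\mathrm{Sym}_k(C)=\frac1{k!}\sum_{\pi\in\mathbb S_k}\pi C\pi^{-1}$, regarded as a bosonic operator. **GP phase space.** Let $\mathfrak G_\infty^*$ be the real topological vector space (product topology) of sequences $\Gamma=(\gamma^{(k)})_{k\ge1}$ of self-adjoint operators in $\mathcal L(\mathcal S_s'(\mathbb R^{dk}),\mathcal S_s(\mathbb R^{dk}))$, i.e. integral operators with kernels $\gamma^{(k)}(\underline x_k;\underline x_k')\in\mathcal S(\mathbb R^{dk}\times\mathbb R^{dk})$ that are separately permutation invariant in $\underline x_k$ and in $\underline x_k'$ and satisfy $\gamma^{(k)}(\underline x_k';\underline x_k)=\overline{\gamma^{(k)}(\underline x_k;\underline x_k')}$. With the generalized trace $\mathrm{Tr}_{1,\dots,k}(A^{(k)}\gamma^{(k)})=\langle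 K_{A^{(k)}},(\gamma^{(k)})^t\rangle$ put $\mathrm{Tr}(A\cdot\Gamma)=\sum_k\mathrm{Tr}_{1,\dots,k}(A^{(k)}\gamma^{(k)})$ for $A\in\mathfrak G_\infty$. Let $\mathcal A_\infty$ be the real algebra, under pointwise product, generated by the smooth functionals $\Gamma\mapsto i\,\mathrm{Tr}(A\cdot\Gamma)$, $A\in\mathfrak G_\infty$, and the constants. For $F\in\mathcal A_\infty$ identify the Gâteaux derivative of $F$ at $\Gamma$ with the element $dF[\Gamma]\in\mathfrak G_\infty$ such that the derivative in direction $v$ is $i\,\mathrm{Tr}(dF[\Gamma]\cdot v)$ for all $v\in\mathfrak G_\infty^*$, and put $$\{F,G\}_{\mathfrak G_\infty^*}(\Gamma)=i\,\mathrm{Tr}\big([dF[\Gamma],dG[\Gamma]]_{\mathfrak G_\infty}\cdot\Gamma\big).$$ **Theorem 2.3.** The map $\iota:\mathcal S(\mathbb R^d)\to\mathfrak G_\infty^*$, $\iota(\phi)=(|\phi^{\otimes k}\rangle\langle\phi^{\otimes k}|)_{k\ge1}$ (with kernels $\prod_{m=1}^k\phi(x_m)\overline{\phi(x_m')}$), is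 a Poisson morphism of $(\mathcal S(\mathbb R^d),\mathcal A_{\mathcal S},\{\cdot,\cdot\}_{L^2})$ into $(\mathfrak G_\infty^*,\mathcal A_\infty,\{\cdot,\cdot\}_{\mathfrak G_\infty^*})$. That is: $\iota$ is smooth; $F\circ\iota\in\mathcal A_{\mathcal S}$ for every $F\in\mathcal A_\infty$; and $$\{F\circ\iota,G\circ\iota\}_{L^2}(\phi)=\{F,G\}_{\mathfrak G_\infty^*}(\iota(\phi))\qquad\text{for all }\phi\in\mathcal S(\mathbb R^d),\ F,G\in\mathcal A_\infty .$$ -/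

import Mathlib

open SchwartzMap Filter Topology MeasureTheory

noncomputable section

namespace GPPoisson

/-! ### Calculus on topological vector spaces (Gâteaux derivatives) -/

section Calculus

variable {X Y : Type*} [AddCommGroup X] [Module ℝ X] [TopologicalSpace X]
  [AddCommGroup Y] [Module ℝ Y] [TopologicalSpace Y]

/-- The Gâteaux derivative `df[x](v)` exists and equals `y`. -/
def HasGateauxDeriv (f : X → Y) (x v : X) (y : Y) : Prop :=
  Tendsto (fun t : ℝ => t⁻¹ • (f (x + t • v) - f x)) (𝓝[≠] 0) (𝓝 y)

/-- `C^∞` maps in the Gâteaux sense: all iterated directional derivatives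
`f^{(r)}(x; v₁, …, v_r)` exist and are jointly continuous in `(x; v₁, …, v_r)`.
Here `D r x v` is `f^{(r)}(x; v 0, …, v (r-1))`. -/
def IsSmooth (f : X → Y) : Prop :=
  ∃ D : (r : ℕ) → X → (Fin r → X) → Y,
    (∀ x v, D 0 x v = f x) ∧
    (∀ r, Continuous fun p : X × (Fin r → X) => D r p.1 p.2) ∧
    ∀ r x (v : Fin r → X) (w : X),
      HasGateauxDeriv (fun z => D r z v) x w (D (r + 1) x (Fin.snoc v w))

end Calculus

/-! ### Schwartz functions: tensor products, conjugation, permutations -/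

section Schwartz

variable {E F : Type*} [NormedAddCommGroup E] [NormedSpace ℝ E]
  [NormedAddCommGroup F] [NormedSpace ℝ F]

theorem norm_iteratedFDeriv_comp_fst_le (f : 𝓢(E, ℂ)) (n : ℕ) (p : E × F) :
    ‖iteratedFDeriv ℝ n (fun q : E × F => f q.1) p‖ ≤ ‖iteratedFDeriv ℝ n f p.1‖ := by
  have h := (ContinuousLinearMap.fst ℝ E F).iteratedFDeriv_comp_right (f := f) (f.smooth ⊤) p
    (i := n) (by exact_mod_cast le_top)
  have h' : (fun q : E × F => f q.1) = f ∘ (ContinuousLinearMap.fst ℝ E F) := rfl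
  rw [h', h]
  refine (ContinuousMultilinearMap.norm_compContinuousLinearMap_le _ _).trans ?_
  refine mul_le_of_le_one_right (norm_nonneg _) ?_
  exact Finset.prod_le_one (fun _ _ => norm_nonneg _)
    (fun _ _ => ContinuousLinearMap.norm_fst_le ℝ E F)

theorem norm_iteratedFDeriv_comp_snd_le (g : 𝓢(F, ℂ)) (n : ℕ) (p : E × F) :
    ‖iteratedFDeriv ℝ n (fun q : E × F => g q.2) p‖ ≤ ‖iteratedFDeriv ℝ n g p.2‖ := by
  have h := (ContinuousLinearMap.snd ℝ E F).iteratedFDeriv_comp_right (f := g) (g.smooth ⊤) p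
    (i := n) (by exact_mod_cast le_top)
  have h' : (fun q : E × F => g q.2) = g ∘ (ContinuousLinearMap.snd ℝ E F) := rfl
  rw [h', h]
  refine (ContinuousMultilinearMap.norm_compContinuousLinearMap_le _ _).trans ?_
  refine mul_le_of_le_one_right (norm_nonneg _) ?_
  exact Finset.prod_le_one (fun _ _ => norm_nonneg _)
    (fun _ _ => ContinuousLinearMap.norm_snd_le ℝ E F)

/-- The tensor product `(f ⊗ g)(x, y) = f(x) g(y)` of two Schwartz functions. -/
def tensor (f : 𝓢(E, ℂ)) (g : 𝓢(F, ℂ)) : 𝓢(E × F, ℂ) where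
  toFun p := f p.1 * g p.2
  smooth' := ((f.smooth ⊤).comp contDiff_fst).mul ((g.smooth ⊤).comp contDiff_snd)
  decay' := by
    intro k n
    choose Cf hCf using fun a b => f.decay a b
    choose Cg hCg using fun a b => g.decay a b
    refine ⟨∑ i ∈ Finset.range (n + 1), (n.choose i : ℝ) *
      (Cf k i * Cg 0 (n - i) + Cf 0 i * Cg k (n - i)), fun p => ?_⟩
    have hmul := norm_iteratedFDeriv_mul_le (𝕜 := ℝ) (f := fun q : E × F => f q.1)
      (g := fun q : E × F => g q.2) ((f.smooth ⊤).comp contDiff_fst)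
      ((g.smooth ⊤).comp contDiff_snd) p (n := n) (by exact_mod_cast le_top)
    have hk : ‖p‖ ^ k ≤ ‖p.1‖ ^ k + ‖p.2‖ ^ k := by
      rcases max_choice ‖p.1‖ ‖p.2‖ with h | h
      · rw [Prod.norm_def, h]
        exact le_add_of_nonneg_right (by positivity)
      · rw [Prod.norm_def, h]
        exact le_add_of_nonneg_left (by positivity)
    refine (mul_le_mul_of_nonneg_left hmul (by positivity)).trans ?_
    rw [Finset.mul_sum]
    refine Finset.sum_le_sum fun i _ => ?_
    set a := ‖iteratedFDeriv ℝ i f p.1‖ with ha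
    set b := ‖iteratedFDeriv ℝ (n - i) g p.2‖ with hb
    have h1 : ‖p.1‖ ^ k * a ≤ Cf k i := (hCf k i).2 p.1
    have h2 : a ≤ Cf 0 i := by simpa using (hCf 0 i).2 p.1
    have h3 : ‖p.2‖ ^ k * b ≤ Cg k (n - i) := (hCg k (n - i)).2 p.2
    have h4 : b ≤ Cg 0 (n - i) := by simpa using (hCg 0 (n - i)).2 p.2
    have ha0 : 0 ≤ a := norm_nonneg _
    have hb0 : 0 ≤ b := norm_nonneg _
    have hfst := norm_iteratedFDeriv_comp_fst_le f i p
    have hsnd := norm_iteratedFDeriv_comp_snd_le g (n - i) p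
    have e1 : ‖p.1‖ ^ k * a * b ≤ Cf k i * Cg 0 (n - i) :=
      mul_le_mul h1 h4 hb0 ((by positivity : (0 : ℝ) ≤ ‖p.1‖ ^ k * a).trans h1)
    have e2 : a * (‖p.2‖ ^ k * b) ≤ Cf 0 i * Cg k (n - i) :=
      mul_le_mul h2 h3 (by positivity) (ha0.trans h2)
    calc ‖p‖ ^ k * ((n.choose i : ℝ) * ‖iteratedFDeriv ℝ i (fun q : E × F => f q.1) p‖ *
          ‖iteratedFDeriv ℝ (n - i) (fun q : E × F => g q.2) p‖)
        ≤ (‖p.1‖ ^ k + ‖p.2‖ ^ k) * ((n.choose i : ℝ) * a * b) := by gcongr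
      _ = (n.choose i : ℝ) * (‖p.1‖ ^ k * a * b + a * (‖p.2‖ ^ k * b)) := by ring
      _ ≤ _ := by gcongr

@[simp] theorem tensor_apply (f : 𝓢(E, ℂ)) (g : 𝓢(F, ℂ)) (p : E × F) :
    tensor f g p = f p.1 * g p.2 := rfl

/-- The complex conjugate of a Schwartz function. -/
def conjS (f : 𝓢(E, ℂ)) : 𝓢(E, ℂ) :=
  SchwartzMap.postcompCLM (𝕜 := ℝ) (Complex.conjCLE : ℂ →L[ℝ] ℂ) f

@[simp] theorem conjS_apply (f : 𝓢(E, ℂ)) (x : E) : conjS f x = (starRingEnd ℂ) (f x) := rfl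

/-- The transpose `K^t(x; x') = K(x'; x)` of a Schwartz kernel. -/
def transposeS (K : 𝓢(E × E, ℂ)) : 𝓢(E × E, ℂ) :=
  SchwartzMap.compCLMOfContinuousLinearEquiv ℂ (ContinuousLinearEquiv.prodComm ℝ E E) K

@[simp] theorem transposeS_apply (K : 𝓢(E × E, ℂ)) (x y : E) :
    transposeS K (x, y) = K (y, x) := rfl

end Schwartz

/-- One-particle space `ℝ^d`. -/
abbrev Pt (d : ℕ) : Type := EuclideanSpace ℝ (Fin d)

/-- `k`-particle configuration space `(ℝ^d)^k = ℝ^{dk}`. -/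
abbrev Conf (d k : ℕ) : Type := Fin k → Pt d

/-- `𝓢(ℝ^{dk})`. -/
abbrev Sch (d k : ℕ) : Type := 𝓢(Conf d k, ℂ)

/-- `𝓢(ℝ^{dk} × ℝ^{dk})`, the Schwartz-class integral kernels `K(x_k; x_k')`. -/
abbrev Ker (d k : ℕ) : Type := 𝓢(Conf d k × Conf d k, ℂ)

variable {d : ℕ}

/-- `(π f)(x₁, …, x_k) = f(x_{π(1)}, …, x_{π(k)})`. -/
def permS {k : ℕ} (π : Equiv.Perm (Fin k)) : Sch d k →L[ℂ] Sch d k :=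
  SchwartzMap.compCLMOfContinuousLinearEquiv ℂ
    (LinearEquiv.funCongrLeft ℝ (Pt d) π).toContinuousLinearEquiv

@[simp] theorem permS_apply {k : ℕ} (π : Equiv.Perm (Fin k)) (f : Sch d k) (x : Conf d k) :
    permS π f x = f (fun i => x (π i)) := rfl

/-- The symmetrization `Sym_k(f) = (1/k!) ∑_π π f` of a function. -/
def symS (k : ℕ) : Sch d k →L[ℂ] Sch d k :=
  ((k.factorial : ℂ)⁻¹) • ∑ π : Equiv.Perm (Fin k), permS π

/-- The function `1` on the one-point space `(ℝ^d)^0`. -/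
def oneS : Sch d 0 :=
  HasCompactSupport.toSchwartzMap (f := fun _ : Conf d 0 => (1 : ℂ))
    (HasCompactSupport.of_compactSpace _) contDiff_const

/-- `φ^{⊗k}(x₁, …, x_k) = φ(x₁) ⋯ φ(x_k)`. -/
def tensorPow (φ : 𝓢(Pt d, ℂ)) : (k : ℕ) → Sch d k
  | 0 => oneS
  | k + 1 => SchwartzMap.compCLMOfContinuousLinearEquiv ℂ
      (Fin.consEquivL ℝ (fun _ : Fin (k + 1) => Pt d)).symm (tensor φ (tensorPow φ k))

theorem tensorPow_apply (φ : 𝓢(Pt d, ℂ)) (k : ℕ) (x : Conf d k) :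
    tensorPow φ k x = ∏ i, φ (x i) := by
  induction k with
  | zero => simp [tensorPow, oneS]
  | succ k ih =>
    rw [Fin.prod_univ_succ, ← ih (fun i => x i.succ)]
    rfl

/-! ### Distribution-valued operators -/

/-- Distribution-valued operators `𝓛(𝓢(ℝ^{dk}), 𝓢'(ℝ^{dk}))`: continuous linear maps into the
strong dual. `A f g` is the (bilinear) distributional pairing `⟨A f, g⟩`. -/
abbrev DVO (d k : ℕ) : Type := Sch d k →L[ℂ] (Sch d k →L[ℂ] ℂ)

open scoped Classical in
/-- The Schwartz kernel `K_A ∈ 𝓢'(ℝ^{dk} × ℝ^{dk})` of `A`, i.e. the unique tempered distribution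
with `⟨K_A, g ⊗ f⟩ = ⟨A f, g⟩` (it exists by the Schwartz kernel theorem). -/
def schwartzKernel {k : ℕ} (A : DVO d k) : Ker d k →L[ℂ] ℂ :=
  if h : ∃ K : Ker d k →L[ℂ] ℂ, ∀ f g : Sch d k, K (tensor g f) = A f g then h.choose else 0

/-- Generalized trace `Tr(A γ) = ⟨K_A, γ^t⟩`; for `γ = |f⟩⟨h|` this is `⟨A f, conj h⟩`. -/
def genTrace {k : ℕ} (A : DVO d k) (γ : Ker d k) : ℂ := schwartzKernel A (transposeS γ)

theorem contDiff_and_growth_of_affine {V W : Type*} [NormedAddCommGroup V] [NormedSpace ℝ V]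
    [NormedAddCommGroup W] [NormedSpace ℝ W] (L : V →L[ℝ] W) (c : W) :
    (fun v => L v + c).HasTemperateGrowth :=
  L.hasTemperateGrowth.add (Function.HasTemperateGrowth.const c)

/-- Pull-back of a Schwartz function along an affine map `v ↦ L v + c` bounded below. -/
def pullAffine {V W : Type*} [NormedAddCommGroup V] [NormedSpace ℝ V]
    [NormedAddCommGroup W] [NormedSpace ℝ W] (L : V →L[ℝ] W) (c : W)
    (h : ∀ v, ‖v‖ ≤ ‖L v + c‖) (f : 𝓢(W, ℂ)) : 𝓢(V, ℂ) :=
  SchwartzMap.compCLM ℂ (g := fun v => L v + c) (contDiff_and_growth_of_affine L c)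
    ⟨1, 1, fun v => by
      have := h v
      have h0 := norm_nonneg (L v + c)
      simp only [pow_one, one_mul]
      linarith⟩ f

@[simp] theorem pullAffine_apply {V W : Type*} [NormedAddCommGroup V] [NormedSpace ℝ V]
    [NormedAddCommGroup W] [NormedSpace ℝ W] (L : V →L[ℝ] W) (c : W)
    (h : ∀ v, ‖v‖ ≤ ‖L v + c‖) (f : 𝓢(W, ℂ)) (v : V) :
    pullAffine L c h f v = f (L v + c) := rfl

/-- The linear map that sets the coordinate `α` to zero. -/
def zeroAt {k : ℕ} (α : Fin k) : Conf d k →L[ℝ] Conf d k :=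
  ContinuousLinearMap.pi fun i => if i = α then 0 else ContinuousLinearMap.proj i

/-- `φ ⊗_α g(·, x', ·)`, the Schwartz function
`y ↦ φ(y_α) g(y₁, …, y_{α-1}, x', y_{α+1}, …, y_k)` on `ℝ^{dk}`. -/
def slot {k : ℕ} (α : Fin k) (φ : 𝓢(Pt d, ℂ)) (g : Sch d k) (x' : Pt d) : Sch d k :=
  pullAffine ((ContinuousLinearMap.proj α).prod (zeroAt α)) (0, Pi.single α x')
    (by
      intro v
      refine (pi_norm_le_iff_of_nonneg (norm_nonneg _)).2 fun i => ?_
      by_cases hi : i = α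
      · subst hi
        refine le_trans ?_ (norm_fst_le _)
        simp
      · refine le_trans ?_ (norm_snd_le _)
        refine le_trans ?_ (norm_le_pi_norm _ i)
        simp [zeroAt, hi])
    (tensor φ g)

theorem slot_apply {k : ℕ} (α : Fin k) (φ : 𝓢(Pt d, ℂ)) (g : Sch d k) (x' : Pt d)
    (y : Conf d k) : slot α φ g x' y = φ (y α) * g (Function.update y α x') := by
  simp only [slot, pullAffine_apply, tensor_apply]
  congr 2
  · simp
  · funext i
    by_cases hi : i = α
    · subst hi; simp [zeroAt]
    · simp [zeroAt, hi]

/-- The good mapping property: for each coordinate `α` the bilinear map sending `(f, g)` to the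
partial pairing
`∫ dx₁ … dx_{α-1} dx_{α+1} … dx_k (A f)(x₁, …, x_k) g(x₁, …, x_α', …, x_k)`,
a priori a distribution in `x_α` depending on `x_α'`, is a continuous bilinear map into
`𝓢(ℝ^d × ℝ^d)`. -/
def HasGMP {k : ℕ} (A : DVO d k) : Prop :=
  ∀ α : Fin k, ∃ Φ : Sch d k →ₗ[ℂ] Sch d k →ₗ[ℂ] 𝓢(Pt d × Pt d, ℂ),
    (Continuous fun p : Sch d k × Sch d k => Φ p.1 p.2) ∧
    ∀ (f g : Sch d k) (φ : 𝓢(Pt d, ℂ)) (x' : Pt d),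
      A f (slot α φ g x') = ∫ x, Φ f g (x, x') * φ x

open scoped Classical in
/-- For `B` with the good mapping property, the Schwartz function of `(x_β, x_β')` obtained by
pairing `B f` with `g` in all coordinates but the `β`-th. -/
def partialKernel {k : ℕ} (B : DVO d k) (β : Fin k) (f g : Sch d k) : 𝓢(Pt d × Pt d, ℂ) :=
  if h : ∃ Ψ : 𝓢(Pt d × Pt d, ℂ), ∀ (φ : 𝓢(Pt d, ℂ)) (x' : Pt d),
      B f (slot β φ g x') = ∫ x, Ψ (x, x') * φ x then h.choose else 0

/-! ### The contraction `A ∘_α^β B`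

Hierarchies are indexed by `n : ℕ`, the component `n` living on `n + 1` particles. Thus for an
`(a+1)`-particle and a `(b+1)`-particle operator, `(a+1) + (b+1) - 1 = n + 1` is `a + b = n`. -/

/-- For a `(b+1)`-particle operator acting on the coordinates
`(a+2, …, a+β, α, a+β+1, …)` of `n + 1 = a + b + 1` particles (the entry `α` standing at the
`β`-th place), with `x ∈ (ℝ^d)^{a+1}` in the first `a+1` coordinates: the linear part, in
`y ∈ (ℝ^d)^{b+1}`, of the joint configuration. -/
def glueL {a b n : ℕ} (h : a + b = n) (α : Fin (a + 1)) (β : Fin (b + 1)) :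
    Conf d (b + 1) →L[ℝ] Conf d (n + 1) :=
  ContinuousLinearMap.pi fun i =>
    if hi : (i : ℕ) < a + 1 then
      if (⟨i, hi⟩ : Fin (a + 1)) = α then ContinuousLinearMap.proj β else 0
    else ContinuousLinearMap.proj (β.succAbove ⟨(i : ℕ) - (a + 1), by omega⟩)

/-- The part of the joint configuration that depends on `x`. -/
def glueC {a b n : ℕ} (_h : a + b = n) (α : Fin (a + 1)) (x : Conf d (a + 1)) :
    Conf d (n + 1) := fun i =>
  if hi : (i : ℕ) < a + 1 then
    if (⟨i, hi⟩ : Fin (a + 1)) = α then 0 else x ⟨i, hi⟩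
  else 0

/-- The joint configuration of `n + 1` particles: its first `a + 1` coordinates are those of `x`
with the `α`-th one replaced by `y_β`, the last `b` are the `y_j`, `j ≠ β`, in order. -/
def glue {a b n : ℕ} (h : a + b = n) (α : Fin (a + 1)) (β : Fin (b + 1))
    (x : Conf d (a + 1)) (y : Conf d (b + 1)) : Conf d (n + 1) := fun i =>
  if hi : (i : ℕ) < a + 1 then
    if (⟨i, hi⟩ : Fin (a + 1)) = α then y β else x ⟨i, hi⟩
  else y (β.succAbove ⟨(i : ℕ) - (a + 1), by omega⟩)

theorem glue_eq {a b n : ℕ} (h : a + b = n) (α : Fin (a + 1)) (β : Fin (b + 1))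
    (x : Conf d (a + 1)) (y : Conf d (b + 1)) :
    glueL h α β y + glueC h α x = glue h α β x y := by
  funext i
  simp only [glueL, glueC, glue, Pi.add_apply, ContinuousLinearMap.coe_pi']
  split_ifs <;> simp

/-- `f` as a function of the coordinates `(a+2, …, a+β, α, a+β+1, …)` for fixed values `x` of
the other ones: `y ↦ f (glue x y)`. It does not depend on `x_α`. -/
def freeze {a b n : ℕ} (h : a + b = n) (α : Fin (a + 1)) (β : Fin (b + 1))
    (x : Conf d (a + 1)) (f : Sch d (n + 1)) : Sch d (b + 1) :=
  pullAffine (glueL h α β) (glueC h α x)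
    (by
      intro y
      rw [glue_eq]
      refine (pi_norm_le_iff_of_nonneg (norm_nonneg _)).2 fun j => ?_
      rcases eq_or_ne j β with hj | hj
      · subst hj
        have hα : (α : ℕ) < n + 1 := by omega
        refine le_trans (le_of_eq ?_) (norm_le_pi_norm _ (⟨α, hα⟩ : Fin (n + 1)))
        simp [glue, Nat.lt_succ_iff.1 α.2]
      · obtain ⟨m, rfl⟩ := Fin.exists_succAbove_eq hj
        have hm : a + 1 + (m : ℕ) < n + 1 := by omega
        refine le_trans (le_of_eq ?_) (norm_le_pi_norm _ (⟨a + 1 + m, hm⟩ : Fin (n + 1)))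
        have hm' : ¬ a + 1 + (m : ℕ) ≤ a := by omega
        simp [glue, hm'])
    f

theorem freeze_apply {a b n : ℕ} (h : a + b = n) (α : Fin (a + 1)) (β : Fin (b + 1))
    (x : Conf d (a + 1)) (f : Sch d (n + 1)) (y : Conf d (b + 1)) :
    freeze h α β x f y = f (glue h α β x y) := by
  simp only [freeze, pullAffine_apply, glue_eq]

open scoped Classical in
/-- The function `Φ_{B,α,β}(f, g) ∈ 𝓢(ℝ^{d(a+1)} × ℝ^{d(a+1)})` of `(x; x')` obtained by applying
`B` to `f` in the coordinates `(a+2, …, a+β, α, a+β+1, …)`, evaluating the first `a + 1` output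
variables at `x`, and pairing the remaining `b` of them with `g(x', ·)`. -/
def contrKernel {a b n : ℕ} (h : a + b = n) (B : DVO d (b + 1)) (α : Fin (a + 1))
    (β : Fin (b + 1)) (f g : Sch d (n + 1)) : Ker d (a + 1) :=
  if H : ∃ T : Ker d (a + 1), ∀ x x' : Conf d (a + 1), T (x, x') =
      partialKernel B β (freeze h α β x f) (freeze h α β x' g) (x α, x' α)
  then H.choose else 0

open scoped Classical in
/-- The contraction
`A ∘_α^β B = A_{(1, …, i)} B_{(i+1, …, i+β-1, α, i+β, …, k)}`, `i = a + 1`, `k = n + 1`, given by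
`⟨(A ∘_α^β B) f, g⟩ = ⟨K_A, Φ_{B,α,β}(f, g)^t⟩`. -/
def contraction {a b n : ℕ} (h : a + b = n) (A : DVO d (a + 1)) (B : DVO d (b + 1))
    (α : Fin (a + 1)) (β : Fin (b + 1)) : DVO d (n + 1) :=
  if H : ∃ C : DVO d (n + 1), ∀ f g : Sch d (n + 1),
      C f g = schwartzKernel A (transposeS (contrKernel h B α β f g))
  then H.choose else 0

/-- `[A, B]₁ = ∑_{α,β} (A ∘_α^β B - B ∘_β^α A)`. -/
def comm1 {a b n : ℕ} (h : a + b = n) (A : DVO d (a + 1)) (B : DVO d (b + 1)) :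
    DVO d (n + 1) :=
  ∑ α : Fin (a + 1), ∑ β : Fin (b + 1),
    (contraction h A B α β - contraction ((Nat.add_comm b a).trans h) B A β α)

/-- `π A π⁻¹`, i.e. `⟨π A π⁻¹ f, g⟩ = ⟨A (π⁻¹ f), π⁻¹ g⟩`. -/
def permOp {k : ℕ} (π : Equiv.Perm (Fin k)) (A : DVO d k) : DVO d k :=
  ((ContinuousLinearMap.precomp ℂ (permS π⁻¹ : Sch d k →L[ℂ] Sch d k)).comp A).comp (permS π⁻¹)

@[simp] theorem permOp_apply {k : ℕ} (π : Equiv.Perm (Fin k)) (A : DVO d k) (f g : Sch d k) :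
    permOp π A f g = A (permS π⁻¹ f) (permS π⁻¹ g) := rfl

/-- The bosonic symmetrization `Sym_k(A) = (1/k!) ∑_π π A π⁻¹`, restricted to symmetric
functions. As everywhere below, an operator on symmetric functions is represented by its
canonical extension to all functions, its composition with `symS k`. -/
def symOp {k : ℕ} (A : DVO d k) : DVO d k :=
  (((k.factorial : ℂ)⁻¹) • ∑ π : Equiv.Perm (Fin k), permOp π A).comp (symS k)

/-- The bracket `[A, B]^{(k)} = Sym_k (∑_{ℓ + j - 1 = k} [A^{(ℓ)}, B^{(j)}]₁)`. -/
def hierBracket (A B : ∀ n, DVO d (n + 1)) (n : ℕ) : DVO d (n + 1) :=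
  symOp (∑ p ∈ (Finset.HasAntidiagonal.antidiagonal n).attach,
    comm1 (Finset.HasAntidiagonal.mem_antidiagonal.1 p.2) (A p.1.1) (B p.1.2))

/-! ### Observable hierarchies and density matrix hierarchies -/

/-- `A ∈ 𝔤_{k,gmp}`: a skew-adjoint operator in `𝓛_gmp(𝓢_s(ℝ^{dk}), 𝓢_s'(ℝ^{dk}))`. The bosonic
operator (an operator on symmetric functions with symmetric distributions as values) is
represented by its canonical extension `A ∘ Sym_k`, i.e. by an operator on all functions such
that `A f` depends only on the symmetrization of `f` and is a symmetric distribution. -/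
structure IsObservable {k : ℕ} (A : DVO d k) : Prop where
  gmp : HasGMP A
  symm_right : ∀ (π : Equiv.Perm (Fin k)) (f g : Sch d k), A (permS π f) g = A f g
  symm_left : ∀ (π : Equiv.Perm (Fin k)) (f g : Sch d k), A f (permS π g) = A f g
  /-- With `⟨f | A g⟩ = A g (conj f)`, this is `⟨f | A g⟩ = - conj ⟨g | A f⟩`. -/
  skew : ∀ f g : Sch d k, A g (conjS f) = -(starRingEnd ℂ) (A f (conjS g))

variable (d) in
/-- Observable `∞`-hierarchies `𝔊_∞ = ⨁_k 𝔤_{k,gmp}`. -/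
def GInf : Set (∀ n, DVO d (n + 1)) :=
  {A | (∀ n, IsObservable (A n)) ∧ {n | A n ≠ 0}.Finite}

variable (d) in
/-- Density matrix `∞`-hierarchies `𝔊_∞^*`: sequences of self-adjoint operators with kernels in
`𝓢_{s,s}(ℝ^{dk} × ℝ^{dk})`, with the product topology. -/
def GInfStar : Submodule ℝ (∀ n, Ker d (n + 1)) where
  carrier := {Γ | ∀ (n : ℕ) (x x' : Conf d (n + 1)),
    (∀ π : Equiv.Perm (Fin (n + 1)),
      Γ n (fun i => x (π i), x') = Γ n (x, x') ∧ Γ n (x, fun i => x' (π i)) = Γ n (x, x')) ∧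
    Γ n (x', x) = (starRingEnd ℂ) (Γ n (x, x'))}
  add_mem' := by
    intro a b ha hb n x x'
    refine ⟨fun π => ⟨?_, ?_⟩, ?_⟩
    · simp [((ha n x x').1 π).1, ((hb n x x').1 π).1]
    · simp [((ha n x x').1 π).2, ((hb n x x').1 π).2]
    · simp [(ha n x x').2, (hb n x x').2]
  zero_mem' := by
    intro n x x'
    simp
  smul_mem' := by
    intro c a ha n x x'
    refine ⟨fun π => ⟨?_, ?_⟩, ?_⟩
    · simp [((ha n x x').1 π).1]
    · simp [((ha n x x').1 π).2]
    · simp [(ha n x x').2]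

/-- `Tr(A · Γ) = ∑_k Tr_{1,…,k}(A^{(k)} γ^{(k)})` (a finite sum when `A` has finitely many nonzero
components). -/
def traceHier (A : ∀ n, DVO d (n + 1)) (Γ : GInfStar d) : ℂ :=
  ∑ᶠ n, genTrace (A n) (Γ.1 n)

variable (d) in
/-- `𝒜_∞`: the algebra generated by the trace functionals `i Tr(A ·)`, `A ∈ 𝔊_∞`, and the
constants. -/
def AInf : Subalgebra ℝ (GInfStar d → ℝ) :=
  Algebra.adjoin ℝ
    ({F | IsSmooth F ∧ ∃ A ∈ GInf d, ∀ Γ, (F Γ : ℂ) = Complex.I * traceHier A Γ} ∪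
      {F | IsSmooth F ∧ ∃ c : ℝ, ∀ Γ, F Γ = c})

open scoped Classical in
/-- The Gâteaux derivative `dF[Γ]` as an observable `∞`-hierarchy, through the trace pairing:
`dF[Γ](v) = i Tr(dF[Γ] · v)`. -/
def diffRep (F : GInfStar d → ℝ) (Γ : GInfStar d) : ∀ n, DVO d (n + 1) :=
  if h : ∃ D ∈ GInf d, ∀ v : GInfStar d,
      HasGateauxDeriv (fun Γ => (F Γ : ℂ)) Γ v (Complex.I * traceHier D v)
  then h.choose else 0

/-- The Lie–Poisson bracket `{F, G}(Γ) = i Tr([dF[Γ], dG[Γ]] · Γ)` on `𝔊_∞^*`. -/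
def poissonInf (F G : GInfStar d → ℝ) (Γ : GInfStar d) : ℂ :=
  Complex.I * traceHier (hierBracket (diffRep F Γ) (diffRep G Γ)) Γ

/-! ### The phase space of the nonlinear Schrödinger equation -/

/-- The symplectic form `ω(f, g) = 2 Im ∫ conj(f) g`. -/
def omegaL2 (f g : 𝓢(Pt d, ℂ)) : ℝ := 2 * (∫ x, (starRingEnd ℂ) (f x) * g x).im

variable (d) in
/-- `𝒜_𝒮`: the smooth real functionals `H` on `𝓢(ℝ^d)` with a smooth symplectic gradient
`X : 𝓢(ℝ^d) → 𝓢(ℝ^d)`, `dH[φ](δ) = ω(X(φ), δ)`. -/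
def AS : Set (𝓢(Pt d, ℂ) → ℝ) :=
  {H | IsSmooth H ∧ ∃ X : 𝓢(Pt d, ℂ) → 𝓢(Pt d, ℂ), IsSmooth X ∧
    ∀ φ δ, HasGateauxDeriv H φ δ (omegaL2 (X φ) δ)}

open scoped Classical in
/-- The symplectic `L²` gradient `∇_s F(φ)`, determined by `dF[φ](δ) = ω(∇_s F(φ), δ)`. -/
def symGrad (F : 𝓢(Pt d, ℂ) → ℝ) (φ : 𝓢(Pt d, ℂ)) : 𝓢(Pt d, ℂ) :=
  if h : ∃ g : 𝓢(Pt d, ℂ), ∀ δ, HasGateauxDeriv F φ δ (omegaL2 g δ) then h.choose else 0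

/-- The bracket `{F, G}_{L²}(φ) = ω(∇_s F(φ), ∇_s G(φ))`. -/
def poissonL2 (F G : 𝓢(Pt d, ℂ) → ℝ) (φ : 𝓢(Pt d, ℂ)) : ℝ :=
  omegaL2 (symGrad F φ) (symGrad G φ)

/-- The embedding `ι(φ) = (|φ^{⊗k}⟩⟨φ^{⊗k}|)_k`, where `|f⟩⟨g|` has kernel `f(x) conj(g(x'))`. -/
def iota (φ : 𝓢(Pt d, ℂ)) : GInfStar d :=
  ⟨fun n => tensor (tensorPow φ (n + 1)) (conjS (tensorPow φ (n + 1))), by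
    intro n x x'
    refine ⟨fun π => ⟨?_, ?_⟩, ?_⟩
    · simp only [tensor_apply, conjS_apply, tensorPow_apply,
        Equiv.prod_comp π fun i => φ (x i)]
    · simp only [tensor_apply, conjS_apply, tensorPow_apply,
        Equiv.prod_comp π fun i => φ (x' i)]
    · simp only [tensor_apply, conjS_apply, map_mul, Complex.conj_conj]
      ring⟩

end GPPoisson

end

/-!
The smooth Gabor expansion of a Schwartz function converges absolutely in every seminorm, so it
yields the kernel theorem and reduces identities between Schwartz kernels, generalized traces and
contractions to tensor products. The good mapping property attaches to an observable `A` on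
`n + 1` particles and to each `φ` a one-body Schwartz function `u`; by symmetry and
skew-adjointness, `(n + 1) u` is the symplectic gradient at `φ` of
`i ⟨A φ^{⊗(n+1)}, conj φ^{⊗(n+1)}⟩`. On a product state each contraction `A ∘ B` is minus the
pairing of the conjugated one-body function of `A` with that of `B`, so the trace of the bracket
is `ω` evaluated at the gradients. The Leibniz rule carries this to the generated algebra, and
nondegeneracy of `ω` makes the choice of `dF` irrelevant.
-/

open SchwartzMap Filter Topology MeasureTheory

noncomputable section

namespace GPPoisson

/-! ### Continuous seminorms, bilinear maps and absolutely summable families -/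

section Polynormable

variable {𝕜 X Y Z : Type*} [RCLike 𝕜] [AddCommGroup X] [Module 𝕜 X] [AddCommGroup Y] [Module 𝕜 Y]
  [AddCommGroup Z] [Module 𝕜 Z]

theorem seminorm_le_div_mul_of_le_on_ball {p q : Seminorm 𝕜 X} {δ M : ℝ} (hδ : 0 < δ)
    (h : ∀ x, p x < δ → q x ≤ M) (x : X) : q x ≤ M / δ * p x := by
  have : 0 ≤ M := (apply_nonneg q 0).trans (h 0 (by rwa [map_zero]))
  suffices ∀ c > p x, q x ≤ M / δ * c from
    ge_of_tendsto ((continuous_const_mul (M / δ)).continuousWithinAt (s := Set.Ioi (p x)))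
      (eventually_nhdsWithin_of_forall this)
  intro c hc
  have hc0 : 0 < c := (apply_nonneg p x).trans_lt hc
  have hnorm : ‖((δ / c : ℝ) : 𝕜)‖ = δ / c := RCLike.norm_of_nonneg (by positivity)
  have hball : p (((δ / c : ℝ) : 𝕜) • x) < δ := by
    rw [map_smul_eq_mul, hnorm]
    calc δ / c * p x < δ / c * c := by gcongr
      _ = δ := div_mul_cancel₀ _ hc0.ne'
  have hscaled := h _ hball
  rw [map_smul_eq_mul, hnorm, div_mul_eq_mul_div, div_le_iff₀ hc0] at hscaled
  rwa [div_mul_eq_mul_div, le_div_iff₀ hδ, mul_comm]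

variable [TopologicalSpace X] [TopologicalSpace Y] [TopologicalSpace Z]

theorem exists_continuous_seminorm_ball_subset [PolynormableSpace 𝕜 X] {U : Set X}
    (hU : U ∈ 𝓝 (0 : X)) :
    ∃ (p : Seminorm 𝕜 X) (δ : ℝ), Continuous p ∧ 0 < δ ∧ ∀ x, p x < δ → x ∈ U := by
  have := (PolynormableSpace.withSeminorms 𝕜 X).topologicalAddGroup
  obtain ⟨s, δ, hδ, h⟩ := ((PolynormableSpace.withSeminorms 𝕜 X).mem_nhds_iff _ _).1 hU
  refine ⟨s.sup fun p => p.1, δ, Seminorm.continuous_finsetSup fun p _ => p.2, hδ,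
    fun x hx => h ?_⟩
  rwa [Seminorm.mem_ball_zero]

theorem exists_seminorm_bilinear_le [PolynormableSpace 𝕜 X] [PolynormableSpace 𝕜 Y]
    {B : X →ₗ[𝕜] Y →ₗ[𝕜] Z} (hB : Continuous fun x : X × Y => B x.1 x.2) {q : Seminorm 𝕜 Z}
    (hq : Continuous q) :
    ∃ (a : Seminorm 𝕜 X) (b : Seminorm 𝕜 Y), Continuous a ∧ Continuous b ∧
      ∀ x y, q (B x y) ≤ a x * b y := by
  have hlim : Tendsto (fun x : X × Y => q (B x.1 x.2)) (𝓝 0 ×ˢ 𝓝 0) (𝓝 0) := by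
    simpa [Function.comp_def, nhds_prod_eq] using (hq.comp hB).tendsto (0, 0)
  obtain ⟨U, hU, V, hV, hUV⟩ := eventually_prod_iff.1 (hlim.eventually_lt_const zero_lt_one)
  obtain ⟨a, δ, ha, hδ, haU⟩ := exists_continuous_seminorm_ball_subset (𝕜 := 𝕜) hU
  obtain ⟨b, ε, hb, hε, hbV⟩ := exists_continuous_seminorm_ball_subset (𝕜 := 𝕜) hV
  have hleft : ∀ y, b y < ε → ∀ x, q (B x y) ≤ 1 / δ * a x := fun y hy =>
    seminorm_le_div_mul_of_le_on_ball (q := q.comp (B.flip y)) hδ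
      fun x hx => (hUV (haU x hx) (hbV y hy)).le
  have hboth : ∀ x y, q (B x y) ≤ 1 / δ * a x / ε * b y := fun x =>
    seminorm_le_div_mul_of_le_on_ball (q := q.comp (B x)) hε fun y hy => hleft y hy x
  refine ⟨(1 / δ / ε).toNNReal • a, b, ha.const_smul (1 / δ / ε).toNNReal, hb, fun x y =>
    (hboth x y).trans_eq ?_⟩
  rw [smul_apply, NNReal.smul_def, Real.coe_toNNReal _ (by positivity), smul_eq_mul]
  ring

theorem continuous_of_seminorm_le [PolynormableSpace 𝕜 X] [PolynormableSpace 𝕜 Y]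
    (L : X →ₗ[𝕜] Y) (h : ∀ q : Seminorm 𝕜 Y, Continuous q →
      ∃ p : Seminorm 𝕜 X, Continuous p ∧ ∀ x, q (L x) ≤ p x) : Continuous L := by
  refine WithSeminorms.continuous_of_isBounded (PolynormableSpace.withSeminorms 𝕜 X)
    (PolynormableSpace.withSeminorms 𝕜 Y) L fun q => ?_
  obtain ⟨p, hp, hpq⟩ := h q q.2
  exact ⟨{⟨p, hp⟩}, 1, fun x => by simpa using hpq x⟩

theorem continuous_of_seminorm_bilinear_le [IsTopologicalAddGroup X] [IsTopologicalAddGroup Y]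
    {ι : Type*} [IsTopologicalAddGroup Z] {q : SeminormFamily 𝕜 Z ι} (hq : WithSeminorms q)
    (B : X →ₗ[𝕜] Y →ₗ[𝕜] Z) (h : ∀ i, ∃ (a : Seminorm 𝕜 X) (b : Seminorm 𝕜 Y),
      Continuous a ∧ Continuous b ∧ ∀ x y, q i (B x y) ≤ a x * b y) :
    Continuous fun x : X × Y => B x.1 x.2 := by
  refine continuous_iff_continuousAt.2 fun z => (hq.tendsto_nhds _ _).2 fun i ε hε => ?_
  obtain ⟨a, b, ha, hb, hab⟩ := h i
  have hle : ∀ x : X × Y, q i (B x.1 x.2 - B z.1 z.2) ≤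
      a (x.1 - z.1) * b x.2 + a z.1 * b (x.2 - z.2) := fun x => by
    rw [show B x.1 x.2 - B z.1 z.2 = B (x.1 - z.1) x.2 + B z.1 (x.2 - z.2) by simp]
    exact (map_add_le_add _ _ _).trans (add_le_add (hab _ _) (hab _ _))
  have hcont : Continuous fun x : X × Y => a (x.1 - z.1) * b x.2 + a z.1 * b (x.2 - z.2) := by
    fun_prop
  have hlim := hcont.tendsto z
  simp only [sub_self, map_zero, zero_mul, mul_zero, add_zero] at hlim
  filter_upwards [hlim.eventually_lt_const hε] with x hx using (hle x).trans_lt hx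

variable (𝕜) in
/-- Absolute summability of a family in a locally convex space: it is summable for every
continuous seminorm. -/
def AbsSummable {ι : Type*} (f : ι → X) : Prop :=
  ∀ p : Seminorm 𝕜 X, Continuous p → Summable fun i => p (f i)

theorem seminorm_le_tsum_of_hasSum {ι : Type*} {f : ι → X} {x : X} (h : HasSum f x)
    {p : Seminorm 𝕜 X} (hp : Continuous p) (hf : Summable fun i => p (f i)) :
    p x ≤ ∑' i, p (f i) := by
  refine le_of_tendsto ((hp.tendsto x).comp h) (Eventually.of_forall fun s => ?_)
  calc p (∑ i ∈ s, f i) ≤ ∑ i ∈ s, p (f i) :=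
        Finset.le_sum_of_subadditive p (map_zero p).le (map_add_le_add p) s f
    _ ≤ ∑' i, p (f i) := hf.sum_le_tsum s fun i _ => apply_nonneg p _

theorem AbsSummable.summable_of_completeSpace {ι W : Type*} [NormedAddCommGroup W]
    [NormedSpace 𝕜 W] [CompleteSpace W] {f : ι → W} (hf : AbsSummable 𝕜 f) : Summable f :=
  Summable.of_norm (hf (normSeminorm 𝕜 W) continuous_norm)

end Polynormable

/-! ### Schwartz seminorms -/

section Schwartz

variable {E F H V : Type*} [NormedAddCommGroup E] [NormedSpace ℝ E]
  [NormedAddCommGroup F] [NormedSpace ℝ F] [NormedAddCommGroup H] [NormedSpace ℝ H]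

instance : PolynormableSpace ℂ 𝓢(E, ℂ) :=
  (schwartz_withSeminorms ℂ E ℂ).toPolynormableSpace

variable (E) in
/-- The supremum of the Schwartz seminorms with both indices at most `N`. These seminorms increase
with `N` and generate the topology. -/
def supSeminorm (N : ℕ) : Seminorm ℂ 𝓢(E, ℂ) :=
  (Finset.Iic (N, N)).sup (schwartzSeminormFamily ℂ E ℂ)

theorem seminorm_le_supSeminorm {k n N : ℕ} (hk : k ≤ N) (hn : n ≤ N) (f : 𝓢(E, ℂ)) :
    SchwartzMap.seminorm ℂ k n f ≤ supSeminorm E N f :=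
  Finset.le_sup (f := schwartzSeminormFamily ℂ E ℂ) (b := (k, n)) (by simp [hk, hn]) f

theorem supSeminorm_le_of_forall_bound {N : ℕ} {f : 𝓢(E, ℂ)} {M : ℝ} (hM : 0 ≤ M)
    (h : ∀ k ≤ N, ∀ n ≤ N, ∀ x, ‖x‖ ^ k * ‖iteratedFDeriv ℝ n f x‖ ≤ M) :
    supSeminorm E N f ≤ M := by
  refine Seminorm.finset_sup_apply_le hM fun i hi => ?_
  rw [Finset.mem_Iic, Prod.le_def] at hi
  exact SchwartzMap.seminorm_le_bound ℂ _ _ _ hM (h _ hi.1 _ hi.2)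

theorem one_add_pow_mul_le_supSeminorm {k n N : ℕ} (hk : k ≤ N) (hn : n ≤ N) (f : 𝓢(E, ℂ))
    (x : E) : (1 + ‖x‖) ^ k * ‖iteratedFDeriv ℝ n f x‖ ≤ 2 ^ N * supSeminorm E N f :=
  SchwartzMap.one_add_le_sup_seminorm_apply (𝕜 := ℂ) (m := (N, N)) hk hn f x

theorem continuous_supSeminorm (N : ℕ) : Continuous (supSeminorm E N) :=
  Seminorm.continuous_finsetSup fun i _ => (schwartz_withSeminorms ℂ E ℂ).continuous_seminorm i

theorem exists_le_supSeminorm_of_continuous {p : Seminorm ℂ 𝓢(E, ℂ)} (hp : Continuous p) :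
    ∃ (N : ℕ) (C : ℝ), 0 ≤ C ∧ ∀ f, p f ≤ C * supSeminorm E N f := by
  obtain ⟨s, C, -, h⟩ := Seminorm.bound_of_continuous (schwartz_withSeminorms ℂ E ℂ) p hp
  set N := s.sup fun i => max i.1 i.2
  refine ⟨N, C, C.2, fun f => (h f).trans (mul_le_mul_of_nonneg_left ?_ C.2)⟩
  refine Seminorm.finset_sup_apply_le (apply_nonneg _ _) fun i hi => ?_
  have hN : max i.1 i.2 ≤ N := Finset.le_sup (f := fun i : ℕ × ℕ => max i.1 i.2) hi
  exact seminorm_le_supSeminorm ((le_max_left _ _).trans hN) ((le_max_right _ _).trans hN) f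

theorem exists_supSeminorm_map_le (L : 𝓢(E, ℂ) →L[ℂ] 𝓢(F, ℂ)) (N : ℕ) :
    ∃ (M : ℕ) (C : ℝ), 0 ≤ C ∧ ∀ f, supSeminorm F N (L f) ≤ C * supSeminorm E M f :=
  exists_le_supSeminorm_of_continuous
    (p := (supSeminorm F N).comp (L : 𝓢(E, ℂ) →ₗ[ℂ] 𝓢(F, ℂ)))
    ((continuous_supSeminorm N).comp L.continuous)

theorem supSeminorm_compSubConst_le (N : ℕ) (z : E) (f : 𝓢(E, ℂ)) :
    supSeminorm E N (SchwartzMap.compSubConstCLM ℂ z f) ≤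
      (1 + ‖z‖) ^ N * (2 ^ N * supSeminorm E N f) := by
  have := apply_nonneg (supSeminorm E N) f
  refine supSeminorm_le_of_forall_bound (by positivity) fun k hk n hn x => ?_
  have hcomp : ⇑(SchwartzMap.compSubConstCLM ℂ z f) = fun x => f (x - z) := by ext; simp
  rw [hcomp, iteratedFDeriv_comp_sub]
  have hx : ‖x‖ ≤ (1 + ‖z‖) * (1 + ‖x - z‖) := by
    nlinarith [norm_sub_norm_le x z, norm_nonneg z, norm_nonneg (x - z)]
  calc ‖x‖ ^ k * ‖iteratedFDeriv ℝ n f (x - z)‖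
      ≤ ((1 + ‖z‖) * (1 + ‖x - z‖)) ^ k * ‖iteratedFDeriv ℝ n f (x - z)‖ := by gcongr
    _ = (1 + ‖z‖) ^ k * ((1 + ‖x - z‖) ^ k * ‖iteratedFDeriv ℝ n f (x - z)‖) := by
        rw [mul_pow, mul_assoc]
    _ ≤ _ := mul_le_mul (pow_le_pow_right₀ (by simp) hk)
        (one_add_pow_mul_le_supSeminorm hk hn f _) (by positivity) (by positivity)

/-- Evaluation at a point. -/
def evalAt (x : E) : 𝓢(E, ℂ) →L[ℂ] ℂ :=
  (BoundedContinuousFunction.evalCLM ℂ x).comp (toBoundedContinuousFunctionCLM ℂ E ℂ)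

@[simp] theorem evalAt_apply (x : E) (f : 𝓢(E, ℂ)) : evalAt x f = f x := rfl

/-- The slice `f(·, z)` of a Schwartz function on a product. -/
def slice (z : F) : 𝓢(E × F, ℂ) →L[ℂ] 𝓢(E, ℂ) :=
  SchwartzMap.compCLM ℂ (g := fun x => (x, z))
    (by simpa using contDiff_and_growth_of_affine (ContinuousLinearMap.inl ℝ E F) (0, z))
    ⟨1, 1, fun x => by linarith [norm_fst_le (x, z)]⟩

@[simp] theorem slice_apply (z : F) (f : 𝓢(E × F, ℂ)) (x : E) : slice z f x = f (x, z) := rfl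

theorem norm_iteratedFDeriv_slice_le (n : ℕ) (z : F) (f : 𝓢(E × F, ℂ)) (x : E) :
    ‖iteratedFDeriv ℝ n (slice z f) x‖ ≤ ‖iteratedFDeriv ℝ n f (x, z)‖ := by
  have hslice : ⇑(slice z f) = (fun v => f (v + (0, z))) ∘ ContinuousLinearMap.inl ℝ E F := by
    ext v; simp
  have hsmooth : ContDiff ℝ (⊤ : ℕ∞) fun v : E × F => f (v + (0, z)) :=
    (f.smooth ⊤).comp (contDiff_id.add contDiff_const)
  rw [hslice, (ContinuousLinearMap.inl ℝ E F).iteratedFDeriv_comp_right hsmooth x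
    (i := n) (by exact_mod_cast le_top), iteratedFDeriv_comp_add_right]
  refine (ContinuousMultilinearMap.norm_compContinuousLinearMap_le _ _).trans ?_
  simp only [ContinuousLinearMap.inl_apply, Prod.mk_add_mk, add_zero, zero_add]
  exact mul_le_of_le_one_right (norm_nonneg _) (Finset.prod_le_one (fun _ _ => norm_nonneg _)
    fun _ _ => ContinuousLinearMap.norm_inl_le_one ℝ E F)

theorem pow_mul_supSeminorm_slice_le (a N : ℕ) (z : F) (f : 𝓢(E × F, ℂ)) :
    (1 + ‖z‖) ^ a * supSeminorm E N (slice z f) ≤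
      2 ^ (a + N) * supSeminorm (E × F) (a + N) f := by
  have := apply_nonneg (supSeminorm (E × F) (a + N)) f
  rw [← le_div_iff₀' (by positivity)]
  refine supSeminorm_le_of_forall_bound (by positivity) fun k hk n hn x => ?_
  rw [le_div_iff₀' (by positivity)]
  have hx : ‖x‖ ≤ 1 + ‖(x, z)‖ := (norm_fst_le (x, z)).trans (by simp)
  have hz : ‖z‖ ≤ ‖(x, z)‖ := norm_snd_le (x, z)
  calc (1 + ‖z‖) ^ a * (‖x‖ ^ k * ‖iteratedFDeriv ℝ n (slice z f) x‖)
      ≤ (1 + ‖(x, z)‖) ^ a * ((1 + ‖(x, z)‖) ^ k * ‖iteratedFDeriv ℝ n f (x, z)‖) := by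
        gcongr
        exact norm_iteratedFDeriv_slice_le n z f x
    _ = (1 + ‖(x, z)‖) ^ (a + k) * ‖iteratedFDeriv ℝ n f (x, z)‖ := by ring
    _ ≤ _ := one_add_pow_mul_le_supSeminorm (by omega) (by omega) f _

theorem pow_mul_norm_iteratedFDeriv_tensor_le (k n : ℕ) (f : 𝓢(E, ℂ)) (g : 𝓢(F, ℂ)) (p : E × F) :
    ‖p‖ ^ k * ‖iteratedFDeriv ℝ n (tensor f g) p‖ ≤ ∑ i ∈ Finset.range (n + 1), (n.choose i : ℝ) *
      (((1 + ‖p.1‖) ^ k * ‖iteratedFDeriv ℝ i f p.1‖) *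
        ((1 + ‖p.2‖) ^ k * ‖iteratedFDeriv ℝ (n - i) g p.2‖)) := by
  have hLeibniz := norm_iteratedFDeriv_mul_le (𝕜 := ℝ) (f := fun q : E × F => f q.1)
    (g := fun q : E × F => g q.2) ((f.smooth ⊤).comp contDiff_fst)
    ((g.smooth ⊤).comp contDiff_snd) p (n := n) (by exact_mod_cast le_top)
  have hp : ‖p‖ ≤ (1 + ‖p.1‖) * (1 + ‖p.2‖) := by
    have h1 := norm_nonneg p.1
    have h2 := norm_nonneg p.2
    exact max_le (by nlinarith) (by nlinarith)
  calc ‖p‖ ^ k * ‖iteratedFDeriv ℝ n (tensor f g) p‖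
      ≤ ((1 + ‖p.1‖) * (1 + ‖p.2‖)) ^ k * ∑ i ∈ Finset.range (n + 1), (n.choose i : ℝ) *
          ‖iteratedFDeriv ℝ i (fun q : E × F => f q.1) p‖ *
          ‖iteratedFDeriv ℝ (n - i) (fun q : E × F => g q.2) p‖ := by
        gcongr
        exact hLeibniz
    _ ≤ ((1 + ‖p.1‖) * (1 + ‖p.2‖)) ^ k * ∑ i ∈ Finset.range (n + 1), (n.choose i : ℝ) *
          ‖iteratedFDeriv ℝ i f p.1‖ * ‖iteratedFDeriv ℝ (n - i) g p.2‖ := by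
        gcongr with i
        · exact norm_iteratedFDeriv_comp_fst_le f i p
        · exact norm_iteratedFDeriv_comp_snd_le g (n - i) p
    _ = _ := by
        rw [Finset.mul_sum]
        exact Finset.sum_congr rfl fun i _ => by rw [mul_pow]; ring

theorem supSeminorm_tensor_le (N : ℕ) (f : 𝓢(E, ℂ)) (g : 𝓢(F, ℂ)) :
    supSeminorm (E × F) N (tensor f g) ≤
      2 ^ N * ((2 ^ N * supSeminorm E N f) * (2 ^ N * supSeminorm F N g)) := by
  have := apply_nonneg (supSeminorm E N) f
  have := apply_nonneg (supSeminorm F N) g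
  refine supSeminorm_le_of_forall_bound (by positivity) fun k hk n hn p => ?_
  calc ‖p‖ ^ k * ‖iteratedFDeriv ℝ n (tensor f g) p‖
      ≤ ∑ i ∈ Finset.range (n + 1), (n.choose i : ℝ) *
          ((2 ^ N * supSeminorm E N f) * (2 ^ N * supSeminorm F N g)) := by
        refine (pow_mul_norm_iteratedFDeriv_tensor_le k n f g p).trans ?_
        refine Finset.sum_le_sum fun i hi => mul_le_mul_of_nonneg_left (mul_le_mul ?_ ?_
          (by positivity) (by positivity)) (Nat.cast_nonneg _)
        · exact one_add_pow_mul_le_supSeminorm hk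
            ((Finset.mem_range_succ_iff.1 hi).trans hn) f p.1
        · exact one_add_pow_mul_le_supSeminorm hk ((Nat.sub_le n i).trans hn) g p.2
    _ = 2 ^ n * ((2 ^ N * supSeminorm E N f) * (2 ^ N * supSeminorm F N g)) := by
        rw [← Finset.sum_mul]
        congr 1
        exact_mod_cast Nat.sum_range_choose n
    _ ≤ _ := by
        gcongr
        norm_num

variable (E F) in
/-- The tensor product of Schwartz functions as a bilinear map. -/
def tensorLM : 𝓢(E, ℂ) →ₗ[ℂ] 𝓢(F, ℂ) →ₗ[ℂ] 𝓢(E × F, ℂ) :=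
  LinearMap.mk₂ ℂ tensor
    (fun f f' g => by ext p; simp [add_mul])
    (fun c f g => by ext p; simp [mul_assoc])
    (fun f g g' => by ext p; simp [mul_add])
    (fun c f g => by ext p; simp [mul_left_comm])

variable (E F) in
theorem continuous_tensor : Continuous fun p : 𝓢(E, ℂ) × 𝓢(F, ℂ) => tensor p.1 p.2 := by
  refine continuous_of_seminorm_bilinear_le (schwartz_withSeminorms ℂ (E × F) ℂ) (tensorLM E F)
    fun i => ?_
  set N := max i.1 i.2
  refine ⟨((2 : NNReal) ^ (3 * N)) • supSeminorm E N, supSeminorm F N,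
    (continuous_supSeminorm N).const_smul ((2 : NNReal) ^ (3 * N)), continuous_supSeminorm N,
    fun f g => ?_⟩
  calc SchwartzMap.seminorm ℂ i.1 i.2 (tensor f g)
      ≤ supSeminorm (E × F) N (tensor f g) :=
        seminorm_le_supSeminorm (le_max_left _ _) (le_max_right _ _) _
    _ ≤ 2 ^ N * ((2 ^ N * supSeminorm E N f) * (2 ^ N * supSeminorm F N g)) :=
        supSeminorm_tensor_le N f g
    _ = (2 ^ (3 * N) * supSeminorm E N f) * supSeminorm F N g := by ring

variable (F) in
/-- The tensor product with a fixed left factor. -/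
def tensorCLM (f : 𝓢(E, ℂ)) : 𝓢(F, ℂ) →L[ℂ] 𝓢(E × F, ℂ) :=
  ⟨tensorLM E F f, (continuous_tensor E F).comp (continuous_const.prodMk continuous_id)⟩

@[simp] theorem tensorCLM_apply (f : 𝓢(E, ℂ)) (g : 𝓢(F, ℂ)) : tensorCLM F f g = tensor f g := rfl

/-! ### Absolutely summable families of Schwartz functions -/

variable {𝕜 ι : Type*} [NormedField 𝕜] [NormedAddCommGroup V] [NormedSpace ℝ V] [NormedSpace 𝕜 V]
  [SMulCommClass ℝ 𝕜 V] [CompleteSpace V] {f : ι → 𝓢(H, V)}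

theorem pow_mul_norm_iteratedFDeriv_tsum_le
    (hf : ∀ k n, Summable fun i => SchwartzMap.seminorm 𝕜 k n (f i)) (k n : ℕ) (x : H) :
    ‖x‖ ^ k * ‖iteratedFDeriv ℝ n (fun y => ∑' i, f i y) x‖ ≤
      ∑' i, SchwartzMap.seminorm 𝕜 k n (f i) := by
  have hbound : ∀ m i x, ‖iteratedFDeriv ℝ m (f i) x‖ ≤ SchwartzMap.seminorm 𝕜 0 m (f i) :=
    fun m i x => SchwartzMap.norm_iteratedFDeriv_le_seminorm 𝕜 (f i) m x
  have hsum : Summable fun i => ‖iteratedFDeriv ℝ n (f i) x‖ :=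
    (hf 0 n).of_nonneg_of_le (fun _ => norm_nonneg _) fun i => hbound n i x
  rw [iteratedFDeriv_tsum_apply (N := ⊤) (fun i => (f i).smooth ⊤) (fun m _ => hf 0 m)
    (fun m i x _ => hbound m i x) le_top]
  calc ‖x‖ ^ k * ‖∑' i, iteratedFDeriv ℝ n (f i) x‖
      ≤ ‖x‖ ^ k * ∑' i, ‖iteratedFDeriv ℝ n (f i) x‖ := by
        gcongr; exact norm_tsum_le_tsum_norm hsum
    _ = ∑' i, ‖x‖ ^ k * ‖iteratedFDeriv ℝ n (f i) x‖ := tsum_mul_left.symm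
    _ ≤ _ := (hsum.mul_left _).tsum_le_tsum
        (fun i => SchwartzMap.le_seminorm 𝕜 k n (f i) x) (hf k n)

theorem hasSum_of_hasSum_apply {G : 𝓢(H, V)}
    (hf : ∀ k n, Summable fun i => SchwartzMap.seminorm 𝕜 k n (f i))
    (hG : ∀ x, HasSum (fun i => f i x) (G x)) : HasSum f G := by
  refine ((schwartz_withSeminorms 𝕜 H V).tendsto_nhds _ _).2 fun ⟨k, n⟩ ε hε => ?_
  have htail := tendsto_tsum_compl_atTop_zero fun i => SchwartzMap.seminorm 𝕜 k n (f i)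
  filter_upwards [htail.eventually_lt_const hε] with s hs
  refine lt_of_le_of_lt ?_ hs
  rw [schwartzSeminormFamily_apply, ← neg_sub, map_neg_eq_map]
  refine SchwartzMap.seminorm_le_bound 𝕜 k n _ (tsum_nonneg fun i => apply_nonneg _ _) fun x => ?_
  have hcompl : ⇑(G - ∑ i ∈ s, f i) = fun y => ∑' i : {i // i ∉ s}, f i y := by
    ext y
    refine (((s.hasSum_compl_iff (f := fun i => f i y)
      (a := G y - ∑ i ∈ s, f i y)).2 ?_).tsum_eq.trans ?_).symm
    · simpa using hG y
    · simp [sum_apply]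
  rw [hcompl]
  exact pow_mul_norm_iteratedFDeriv_tsum_le (fun k n => (hf k n).subtype _) k n x

theorem summable_of_summable_seminorm
    (hf : ∀ k n, Summable fun i => SchwartzMap.seminorm 𝕜 k n (f i)) : Summable f := by
  let G : 𝓢(H, V) :=
    { toFun := fun x => ∑' i, f i x
      smooth' := contDiff_tsum (N := ⊤) (fun i => (f i).smooth ⊤) (fun m _ => hf 0 m)
        fun m i x _ => SchwartzMap.norm_iteratedFDeriv_le_seminorm 𝕜 (f i) m x
      decay' := fun k n => ⟨_, pow_mul_norm_iteratedFDeriv_tsum_le hf k n⟩ }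
  refine ⟨G, hasSum_of_hasSum_apply hf fun x => Summable.hasSum (Summable.of_norm ?_)⟩
  exact (hf 0 0).of_nonneg_of_le (fun _ => norm_nonneg _)
    fun i => SchwartzMap.norm_le_seminorm 𝕜 (f i) x

theorem AbsSummable.summable_schwartz {f : ι → 𝓢(H, ℂ)} (hf : AbsSummable ℂ f) : Summable f :=
  summable_of_summable_seminorm fun k n =>
    hf _ ((schwartz_withSeminorms ℂ H ℂ).continuous_seminorm (k, n))

end Schwartz

/-! ### Fourier series of Schwartz functions supported in a cube -/

section Torus

variable {ι : Type*}

/-- The point of the integer lattice with coordinates `m`. -/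
def latticePt (m : ι → ℤ) : EuclideanSpace ℝ ι := WithLp.toLp 2 fun i => (m i : ℝ)

@[simp] theorem latticePt_apply (m : ι → ℤ) (i : ι) : latticePt m i = m i := rfl

theorem latticePt_injective : Function.Injective (latticePt : (ι → ℤ) → EuclideanSpace ℝ ι) :=
  fun m m' h => funext fun i => by simpa using congrArg (fun z : EuclideanSpace ℝ ι => z i) h

/-- The section of the projection `ℝ^ι → (ℝ/ℤ)^ι` with values in `(-1/2, 1/2]^ι`. -/
def torusSection (t : UnitAddTorus ι) : EuclideanSpace ℝ ι :=
  WithLp.toLp 2 fun i => ((AddCircle.equivIoc 1 (-1 / 2 : ℝ) (t i) : Set.Ioc _ _) : ℝ)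

theorem torusSection_coe {y : ι → ℝ} (hy : ∀ i, y i ∈ Set.Ioc (-1 / 2 : ℝ) (-1 / 2 + 1)) :
    torusSection (fun i => (y i : UnitAddCircle)) = WithLp.toLp 2 y :=
  congrArg (WithLp.toLp 2) (funext fun i => by rw [AddCircle.equivIoc_coe_eq (hy i)])

theorem apply_torusSection_coe {α : Type*} [Zero α] {g : EuclideanSpace ℝ ι → α}
    (hg : ∀ x, (∃ i, 1 / 2 ≤ |x i|) → g x = 0) {y : ι → ℝ} (hy : ∀ i, |y i| ≤ 1 / 2) :
    g (torusSection fun i => (y i : UnitAddCircle)) = g (WithLp.toLp 2 y) := by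
  by_cases hface : ∃ i, y i = -1 / 2
  · obtain ⟨i, hi⟩ := hface
    have hperiod : ((-1 / 2 : ℝ) : UnitAddCircle) = ((1 / 2 : ℝ) : UnitAddCircle) := by
      rw [← AddCircle.coe_add_period 1 (-1 / 2)]
      norm_num
    have hsection : torusSection (fun i => (y i : UnitAddCircle)) i = 1 / 2 := by
      simp only [torusSection, hi, hperiod]
      rw [AddCircle.equivIoc_coe_eq ⟨by norm_num, by norm_num⟩]
    rw [hg _ ⟨i, by rw [hsection]; exact le_abs_self _⟩, hg _ ⟨i, by
      simp only [hi]; norm_num [abs_of_nonpos]⟩]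
  · push Not at hface
    rw [torusSection_coe fun i => ⟨?_, ?_⟩]
    · exact lt_of_le_of_ne (by linarith [(abs_le.1 (hy i)).1]) (hface i).symm
    · linarith [(abs_le.1 (hy i)).2]

/-- The torus is a quotient of the closed cube, and the two-sided ambiguity of the section on the
faces of the cube is harmless for functions vanishing there. -/
theorem continuous_comp_torusSection {α : Type*} [Zero α] [TopologicalSpace α]
    {g : EuclideanSpace ℝ ι → α} (hg : ∀ x, (∃ i, 1 / 2 ≤ |x i|) → g x = 0)
    (hcont : Continuous g) : Continuous fun t => g (torusSection t) := by
  let cube : Set (ι → ℝ) := Set.univ.pi fun _ => Set.Icc (-1 / 2) (1 / 2)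
  let proj : cube → UnitAddTorus ι := fun y i => (y.1 i : UnitAddCircle)
  have : CompactSpace cube :=
    isCompact_iff_compactSpace.1 (isCompact_univ_pi fun _ => isCompact_Icc)
  have hproj : Continuous proj := continuous_pi fun i =>
    (AddCircle.continuous_mk' 1).comp ((continuous_apply i).comp continuous_subtype_val)
  have hsurj : Function.Surjective proj := fun t => by
    refine ⟨⟨torusSection t, fun i _ => ?_⟩, funext fun i => AddCircle.coe_equivIoc⟩
    obtain ⟨h1, h2⟩ := (AddCircle.equivIoc 1 (-1 / 2 : ℝ) (t i)).2
    exact ⟨h1.le, h2.trans (by norm_num)⟩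
  refine (hproj.isClosedMap.isQuotientMap hproj hsurj).continuous_iff.2 ?_
  refine (hcont.comp ((PiLp.continuous_toLp 2 _).comp continuous_subtype_val)).congr fun y => ?_
  refine (apply_torusSection_coe hg fun i => abs_le.2 ?_).symm
  obtain ⟨h1, h2⟩ := y.2 i trivial
  exact ⟨by linarith, h2⟩

variable [Fintype ι]

theorem summable_one_add_norm_latticePt_pow_inv (ι : Type*) [Fintype ι] :
    ∃ K : ℕ, Summable fun m : ι → ℤ => ((1 + ‖latticePt m‖) ^ K)⁻¹ := by
  let b := (EuclideanSpace.basisFun ι ℝ).toBasis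
  let L : Submodule ℤ (EuclideanSpace ℝ ι) := Submodule.span ℤ (Set.range b)
  have hmem : ∀ m : ι → ℤ, latticePt m ∈ L := fun m => by
    have hsum : latticePt m = ∑ i, m i • b i := by
      ext i
      classical
      simp [b, Pi.single_apply]
    rw [hsum]
    exact Submodule.sum_mem _ fun i _ => L.smul_mem _ (Submodule.subset_span ⟨i, rfl⟩)
  have hinj : Function.Injective fun m : ι → ℤ => (⟨latticePt m, hmem m⟩ : L) :=
    fun m m' h => latticePt_injective (congrArg Subtype.val h)
  have hsummable := (ZLattice.summable_norm_pow_inv L _ (Nat.lt_succ_self _)).comp_injective hinj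
  refine ⟨Module.finrank ℤ L + 1, Summable.of_norm_bounded_eventually
    (g := fun m : ι → ℤ => ‖latticePt m‖⁻¹ ^ (Module.finrank ℤ L + 1)) hsummable ?_⟩
  rw [eventually_cofinite]
  refine (Set.finite_singleton (0 : ι → ℤ)).subset fun m hm => ?_
  by_contra h0
  have hpos : 0 < ‖latticePt m‖ :=
    norm_pos_iff.2 fun h => h0 (latticePt_injective (h.trans (by ext i; simp)))
  refine hm ?_
  rw [norm_inv, norm_pow, Real.norm_of_nonneg (by positivity), inv_pow]
  gcongr
  linarith

theorem prod_fourierChar (a : ι → ℝ) :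
    ∏ i, (Real.fourierChar (a i) : ℂ) = (Real.fourierChar (∑ i, a i) : ℂ) := by
  simp only [Real.fourierChar_apply, ← Complex.exp_sum]
  push_cast
  rw [Finset.mul_sum, Finset.sum_mul]

theorem fourier_latticePt (g : 𝓢(EuclideanSpace ℝ ι, ℂ)) (m : ι → ℤ) :
    FourierTransform.fourier g (latticePt m) =
      ∫ y : ι → ℝ, (∏ i, (Real.fourierChar (-(m i * y i)) : ℂ)) * g (WithLp.toLp 2 y) := by
  rw [SchwartzMap.fourier_coe, Real.fourier_eq, ← (PiLp.volume_preserving_toLp ι).integral_comp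
    (MeasurableEquiv.toLp 2 (ι → ℝ)).measurableEmbedding]
  refine integral_congr_ae (Eventually.of_forall fun y => ?_)
  simp only
  rw [prod_fourierChar, Circle.smul_def, smul_eq_mul]
  simp [PiLp.inner_apply, Finset.sum_neg_distrib]

theorem summable_fourier_latticePt (g : 𝓢(EuclideanSpace ℝ ι, ℂ)) :
    Summable fun m : ι → ℤ => FourierTransform.fourier g (latticePt m) := by
  obtain ⟨K, hK⟩ := summable_one_add_norm_latticePt_pow_inv ι
  refine Summable.of_norm_bounded (hK.mul_left
    (2 ^ K * supSeminorm _ K (FourierTransform.fourier g))) fun m => ?_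
  have hdecay := one_add_pow_mul_le_supSeminorm (le_refl K) (Nat.zero_le K)
    (FourierTransform.fourier g) (latticePt m)
  rw [norm_iteratedFDeriv_zero] at hdecay
  rwa [← div_eq_mul_inv, le_div_iff₀' (by positivity)]

theorem mFourier_coe (m : ι → ℤ) (y : ι → ℝ) :
    UnitAddTorus.mFourier m (fun i => (y i : UnitAddCircle)) =
      ∏ i, (Real.fourierChar (m i * y i) : ℂ) := by
  refine Finset.prod_congr rfl fun i _ => ?_
  rw [fourier_coe_apply, Real.fourierChar_apply]
  push_cast
  congr 1
  ring

theorem mFourierCoeff_torusSection {g : 𝓢(EuclideanSpace ℝ ι, ℂ)}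
    (hg : ∀ x, (∃ i, 1 / 2 ≤ |x i|) → g x = 0) (m : ι → ℤ) :
    UnitAddTorus.mFourierCoeff (fun t => g (torusSection t)) m =
      FourierTransform.fourier g (latticePt m) := by
  let cube : Set (ι → ℝ) := {y | ∀ i, y i ∈ Set.Ioc (-1 / 2 : ℝ) (-1 / 2 + 1)}
  have hcube : MeasurableSet cube := MeasurableSet.univ_pi' fun _ => measurableSet_Ioc
  have hout : ∀ y ∉ cube, g (WithLp.toLp 2 y) = 0 := fun y hy => by
    simp only [cube, Set.mem_ofPred_eq, not_forall, Set.mem_Ioc, not_and_or, not_lt, not_le] at hy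
    obtain ⟨i, hi⟩ := hy
    refine hg _ ⟨i, le_abs.2 (hi.symm.imp ?_ ?_)⟩ <;> intro h <;> simp only <;> linarith
  rw [UnitAddTorus.mFourierCoeff_eq_integral _ _ fun _ => (-1 / 2 : ℝ), fourier_latticePt,
    ← setIntegral_eq_integral_of_forall_compl_eq_zero (s := cube)
      (f := fun y : ι → ℝ => (∏ i, (Real.fourierChar (-(m i * y i)) : ℂ)) * g (WithLp.toLp 2 y))
      fun y hy => by rw [hout y hy, mul_zero]]
  refine setIntegral_congr_fun hcube fun y hy => ?_
  simp only [torusSection_coe hy, mFourier_coe, smul_eq_mul, Pi.neg_apply, Int.cast_neg, neg_mul]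

theorem hasSum_fourier_latticePt {g : 𝓢(EuclideanSpace ℝ ι, ℂ)}
    (hg : ∀ x, (∃ i, 1 / 2 ≤ |x i|) → g x = 0) {x : EuclideanSpace ℝ ι}
    (hx : ∀ i, |x i| ≤ 1 / 2) :
    HasSum (fun m : ι → ℤ => FourierTransform.fourier g (latticePt m) *
      ∏ i, (Real.fourierChar (m i * x i) : ℂ)) (g x) := by
  let G : C(UnitAddTorus ι, ℂ) :=
    ⟨fun t => g (torusSection t), continuous_comp_torusSection hg g.continuous⟩
  have hcoeff : UnitAddTorus.mFourierCoeff G = fun m => FourierTransform.fourier g (latticePt m) :=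
    funext (mFourierCoeff_torusSection hg)
  have hseries := UnitAddTorus.hasSum_mFourier_series_apply_of_summable
    (hcoeff ▸ summable_fourier_latticePt g) fun i => (x i : UnitAddCircle)
  have hvalue : G (fun i => (x i : UnitAddCircle)) = g x := apply_torusSection_coe hg hx
  simpa only [hcoeff, mFourier_coe, smul_eq_mul, hvalue] using hseries

end Torus

/-! ### The smooth Gabor expansion of a Schwartz function -/

section Bumps

/-- A smooth function supported in `[-1/4, 1/4]` whose translates by `ℤ/4` sum to one. -/
def partitionBump (s : ℝ) : ℝ := Real.smoothTransition (4 * s + 1) - Real.smoothTransition (4 * s)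

/-- A smooth function supported in `[-1/2, 1/2]`, equal to one on `[-1/4, 1/4]`. -/
def plateauBump (s : ℝ) : ℝ := Real.smoothTransition (2 - 4 * s) * Real.smoothTransition (2 + 4 * s)

theorem contDiff_partitionBump : ContDiff ℝ (⊤ : ℕ∞) partitionBump :=
  (Real.smoothTransition.contDiff.comp (by fun_prop)).sub
    (Real.smoothTransition.contDiff.comp (by fun_prop))

theorem contDiff_plateauBump : ContDiff ℝ (⊤ : ℕ∞) plateauBump :=
  (Real.smoothTransition.contDiff.comp (by fun_prop)).mul
    (Real.smoothTransition.contDiff.comp (by fun_prop))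

theorem partitionBump_eq_zero {s : ℝ} (hs : 1 / 4 ≤ |s|) : partitionBump s = 0 := by
  unfold partitionBump
  rcases le_abs.1 hs with h | h
  · rw [Real.smoothTransition.one_of_one_le (by linarith),
      Real.smoothTransition.one_of_one_le (by linarith), sub_self]
  · rw [Real.smoothTransition.zero_of_nonpos (by linarith),
      Real.smoothTransition.zero_of_nonpos (by linarith), sub_self]

theorem plateauBump_eq_zero {s : ℝ} (hs : 1 / 2 ≤ |s|) : plateauBump s = 0 := by
  unfold plateauBump
  rcases le_abs.1 hs with h | h
  · rw [Real.smoothTransition.zero_of_nonpos (by linarith), zero_mul]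
  · rw [Real.smoothTransition.zero_of_nonpos (x := 2 + 4 * s) (by linarith), mul_zero]

theorem hasCompactSupport_partitionBump : HasCompactSupport partitionBump :=
  HasCompactSupport.intro (isCompact_closedBall (0 : ℝ) (1 / 4)) fun s hs =>
    partitionBump_eq_zero (by simpa using (not_le.1 (mt mem_closedBall_zero_iff.2 hs)).le)

theorem hasCompactSupport_plateauBump : HasCompactSupport plateauBump :=
  HasCompactSupport.intro (isCompact_closedBall (0 : ℝ) (1 / 2)) fun s hs =>
    plateauBump_eq_zero (by simpa using (not_le.1 (mt mem_closedBall_zero_iff.2 hs)).le)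

theorem plateauBump_eq_one {s : ℝ} (hs : |s| ≤ 1 / 4) : plateauBump s = 1 := by
  unfold plateauBump
  obtain ⟨h1, h2⟩ := abs_le.1 hs
  rw [Real.smoothTransition.one_of_one_le (by linarith),
    Real.smoothTransition.one_of_one_le (by linarith), mul_one]

theorem exists_finset_partitionBump (s : ℝ) : ∃ t : Finset ℤ,
    (∀ j ∉ t, partitionBump (s - (j : ℝ) / 4) = 0) ∧
    ∑ j ∈ t, partitionBump (s - (j : ℝ) / 4) = 1 := by
  have h1 := Int.floor_le (4 * s)
  have h2 := Int.lt_floor_add_one (4 * s)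
  refine ⟨{⌊4 * s⌋, ⌊4 * s⌋ + 1}, fun j hj => partitionBump_eq_zero ?_, ?_⟩
  · simp only [Finset.mem_insert, Finset.mem_singleton, not_or] at hj
    rcases lt_or_gt_of_ne hj.1 with h | h
    · have : (j : ℝ) + 1 ≤ ⌊4 * s⌋ := by exact_mod_cast h
      exact le_abs.2 (Or.inl (by linarith))
    · have h' : ⌊4 * s⌋ + 2 ≤ j := by omega
      have : ((⌊4 * s⌋ : ℤ) : ℝ) + 2 ≤ j := by exact_mod_cast h'
      exact le_abs.2 (Or.inr (by linarith))
  · rw [Finset.sum_pair (by omega)]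
    unfold partitionBump
    push_cast
    rw [Real.smoothTransition.one_of_one_le (x := 4 * (s - (⌊4 * s⌋ : ℝ) / 4) + 1) (by linarith),
      Real.smoothTransition.zero_of_nonpos (x := 4 * (s - ((⌊4 * s⌋ : ℝ) + 1) / 4)) (by linarith)]
    ring_nf

end Bumps

section Modulation

variable {V W : Type*} [NormedAddCommGroup V] [InnerProductSpace ℝ V] [FiniteDimensional ℝ V]
  [MeasurableSpace V] [BorelSpace V] [NormedAddCommGroup W] [NormedSpace ℝ W]

/-- Modulation `f ↦ e^{2πi⟨ξ, ·⟩} f`, realised as a translation on the Fourier side. -/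
def modulate (ξ : V) : 𝓢(V, ℂ) →L[ℂ] 𝓢(V, ℂ) :=
  FourierTransform.fourierInvCLM ℂ 𝓢(V, ℂ) ∘L SchwartzMap.compSubConstCLM ℂ ξ ∘L
    FourierTransform.fourierCLM ℂ 𝓢(V, ℂ)

theorem modulate_apply (ξ : V) (f : 𝓢(V, ℂ)) (x : V) :
    modulate ξ f x = (Real.fourierChar (inner ℝ ξ x) : ℂ) * f x := by
  have hinv : f x = ∫ v, Real.fourierChar (inner ℝ v x) • FourierTransform.fourier f v := by
    conv_lhs => rw [← FourierTransform.fourierInv_fourier_eq (E := 𝓢(V, ℂ)) (F := 𝓢(V, ℂ)) f]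
    rw [SchwartzMap.fourierInv_coe, Real.fourierInv_eq]
  simp only [modulate, ContinuousLinearMap.comp_apply, FourierTransform.fourierInvCLM_apply,
    FourierTransform.fourierCLM_apply]
  rw [SchwartzMap.fourierInv_coe, Real.fourierInv_eq, hinv, ← integral_const_mul,
    ← integral_add_right_eq_self _ ξ]
  refine integral_congr_ae (Eventually.of_forall fun v => ?_)
  simp only [SchwartzMap.compSubConstCLM_apply, add_sub_cancel_right, inner_add_left,
    AddChar.map_add_eq_mul, Circle.smul_def, smul_eq_mul, Circle.coe_mul]
  ring

theorem exists_supSeminorm_modulate_le (f : 𝓢(V, ℂ)) (N : ℕ) : ∃ (M : ℕ) (C : ℝ), 0 ≤ C ∧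
    ∀ ξ : V, supSeminorm V N (modulate ξ f) ≤ C * (1 + ‖ξ‖) ^ M := by
  obtain ⟨M, C, hC, h⟩ := exists_supSeminorm_map_le
    (FourierTransform.fourierInvCLM ℂ 𝓢(V, ℂ) (F := 𝓢(V, ℂ))) N
  set g := FourierTransform.fourierCLM ℂ 𝓢(V, ℂ) (F := 𝓢(V, ℂ)) f
  have := apply_nonneg (supSeminorm V M) g
  refine ⟨M, C * (2 ^ M * supSeminorm V M g), by positivity, fun ξ => ?_⟩
  calc supSeminorm V N (modulate ξ f)
      ≤ C * supSeminorm V M (SchwartzMap.compSubConstCLM ℂ ξ g) := h _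
    _ ≤ C * ((1 + ‖ξ‖) ^ M * (2 ^ M * supSeminorm V M g)) := by
        gcongr; exact supSeminorm_compSubConst_le M ξ g
    _ = _ := by ring

theorem exists_pow_mul_norm_fourier_slice_le (N : ℕ) : ∃ (M : ℕ) (C : ℝ), 0 ≤ C ∧
    ∀ (f : 𝓢(V × W, ℂ)) (z : W) (ξ : V),
      (1 + ‖z‖) ^ N * ((1 + ‖ξ‖) ^ N * ‖FourierTransform.fourier (slice z f) ξ‖) ≤
        C * supSeminorm (V × W) M f := by
  obtain ⟨M, C, hC, h⟩ := exists_supSeminorm_map_le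
    (FourierTransform.fourierCLM ℂ 𝓢(V, ℂ) (F := 𝓢(V, ℂ))) N
  refine ⟨N + M, 2 ^ N * C * 2 ^ (N + M), by positivity, fun f z ξ => ?_⟩
  have hdecay := one_add_pow_mul_le_supSeminorm (le_refl N) (Nat.zero_le N)
    (FourierTransform.fourier (slice z f)) ξ
  rw [norm_iteratedFDeriv_zero] at hdecay
  calc (1 + ‖z‖) ^ N * ((1 + ‖ξ‖) ^ N * ‖FourierTransform.fourier (slice z f) ξ‖)
      ≤ (1 + ‖z‖) ^ N * (2 ^ N * (C * supSeminorm V M (slice z f))) := by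
        gcongr (1 + ‖z‖) ^ N * ?_
        exact hdecay.trans (mul_le_mul_of_nonneg_left (h _) (by positivity))
    _ = 2 ^ N * C * ((1 + ‖z‖) ^ N * supSeminorm V M (slice z f)) := by ring
    _ ≤ 2 ^ N * C * (2 ^ (N + M) * supSeminorm (V × W) (N + M) f) := by
        gcongr 2 ^ N * C * ?_; exact pow_mul_supSeminorm_slice_le N M z f
    _ = _ := by ring

end Modulation

section Localization

variable {V : Type*} [NormedAddCommGroup V] [NormedSpace ℝ V]

variable (V) in
/-- The shear `(x, z) ↦ (x, x + z)`. -/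
def shear : (V × V) ≃L[ℝ] V × V :=
  ContinuousLinearEquiv.equivOfInverse
    ((ContinuousLinearMap.fst ℝ V V).prod
      (ContinuousLinearMap.fst ℝ V V + ContinuousLinearMap.snd ℝ V V))
    ((ContinuousLinearMap.fst ℝ V V).prod
      (ContinuousLinearMap.snd ℝ V V - ContinuousLinearMap.fst ℝ V V))
    (fun p => by ext <;> simp) (fun p => by ext <;> simp)

/-- The localizations of `f` near all translates of a window, assembled into the Schwartz function
`(x, z) ↦ χ(x) f(x + z)`. -/
def localize (χ : 𝓢(V, ℂ)) : 𝓢(V, ℂ) →L[ℂ] 𝓢(V × V, ℂ) :=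
  SchwartzMap.compCLMOfContinuousLinearEquiv ℂ (shear V) ∘L tensorCLM V χ

theorem slice_localize_apply (χ f : 𝓢(V, ℂ)) (z x : V) :
    slice z (localize χ f) x = χ x * f (x + z) := rfl

end Localization

section Gabor

variable {ι : Type*} [Fintype ι]

theorem hasCompactSupport_prod {u : ℝ → ℝ} (hu : HasCompactSupport u) :
    HasCompactSupport fun x : EuclideanSpace ℝ ι => ((∏ i, u (x i) : ℝ) : ℂ) := by
  have hK : IsCompact (Set.univ.pi fun _ : ι => tsupport u) := isCompact_univ_pi fun _ => hu
  refine HasCompactSupport.intro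
    ((EuclideanSpace.equiv ι ℝ).toHomeomorph.isCompact_preimage.2 hK) fun x hx => ?_
  obtain ⟨i, hi⟩ : ∃ i, x i ∉ tsupport u := by simpa using hx
  have hui : u (x i) = 0 := image_eq_zero_of_notMem_tsupport hi
  rw [Finset.prod_eq_zero (Finset.mem_univ i) hui, Complex.ofReal_zero]

theorem contDiff_prod_coord {n : WithTop ℕ∞} {u : ℝ → ℝ} (hu : ContDiff ℝ n u) :
    ContDiff ℝ n fun x : EuclideanSpace ℝ ι => ((∏ i, u (x i) : ℝ) : ℂ) :=
  Complex.ofRealCLM.contDiff.comp <|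
    contDiff_prod fun i _ => hu.comp (EuclideanSpace.proj (𝕜 := ℝ) i).contDiff

variable (ι) in
/-- The product function `∏ᵢ u(xᵢ)` for a smooth compactly supported `u`. -/
def prodBump (u : ℝ → ℝ) (h : ContDiff ℝ (⊤ : ℕ∞) u) (hu : HasCompactSupport u) :
    𝓢(EuclideanSpace ℝ ι, ℂ) :=
  (hasCompactSupport_prod hu).toSchwartzMap (contDiff_prod_coord h)

variable (ι) in
/-- The analysis window, whose translates by `(ℤ/4)^ι` sum to one. -/
def window : 𝓢(EuclideanSpace ℝ ι, ℂ) :=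
  prodBump ι partitionBump contDiff_partitionBump hasCompactSupport_partitionBump

variable (ι) in
/-- The synthesis window, equal to one on the support of the analysis window. -/
def dualWindow : 𝓢(EuclideanSpace ℝ ι, ℂ) :=
  prodBump ι plateauBump contDiff_plateauBump hasCompactSupport_plateauBump

theorem window_apply (x : EuclideanSpace ℝ ι) :
    window ι x = ∏ i, (partitionBump (x i) : ℂ) := Complex.ofReal_prod _ _

theorem dualWindow_apply (x : EuclideanSpace ℝ ι) :
    dualWindow ι x = ∏ i, (plateauBump (x i) : ℂ) := Complex.ofReal_prod _ _

theorem window_eq_zero {x : EuclideanSpace ℝ ι} (hx : ∃ i, 1 / 4 ≤ |x i|) : window ι x = 0 := by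
  obtain ⟨i, hi⟩ := hx
  rw [window_apply, Finset.prod_eq_zero (Finset.mem_univ i)]
  rw [partitionBump_eq_zero hi, Complex.ofReal_zero]

theorem dualWindow_eq_zero {x : EuclideanSpace ℝ ι} (hx : ∃ i, 1 / 2 ≤ |x i|) :
    dualWindow ι x = 0 := by
  obtain ⟨i, hi⟩ := hx
  rw [dualWindow_apply, Finset.prod_eq_zero (Finset.mem_univ i)]
  rw [plateauBump_eq_zero hi, Complex.ofReal_zero]

theorem window_mul_dualWindow (x : EuclideanSpace ℝ ι) :
    window ι x * dualWindow ι x = window ι x := by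
  by_cases hx : ∃ i, 1 / 4 ≤ |x i|
  · rw [window_eq_zero hx, zero_mul]
  · push Not at hx
    rw [dualWindow_apply, Finset.prod_eq_one fun i _ => ?_, mul_one]
    rw [plateauBump_eq_one (hx i).le, Complex.ofReal_one]

theorem hasSum_window (x : EuclideanSpace ℝ ι) :
    HasSum (fun j : ι → ℤ => window ι (x - (1 / 4 : ℝ) • latticePt j)) 1 := by
  classical
  choose t ht0 ht1 using fun i => exists_finset_partitionBump (x i)
  have hcoord : ∀ j : ι → ℤ, window ι (x - (1 / 4 : ℝ) • latticePt j) =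
      ∏ i, (partitionBump (x i - (j i : ℝ) / 4) : ℂ) := fun j => by
    simp [window_apply, div_eq_inv_mul]
  have hfin : ∑ j ∈ Fintype.piFinset t, window ι (x - (1 / 4 : ℝ) • latticePt j) = 1 := by
    simp only [hcoord]
    rw [← Finset.prod_univ_sum t fun i (j : ℤ) => (partitionBump (x i - (j : ℝ) / 4) : ℂ)]
    simp only [← Complex.ofReal_sum, ht1, Complex.ofReal_one, Finset.prod_const_one]
  rw [← hfin]
  refine hasSum_sum_of_ne_finset_zero fun j hj => ?_
  rw [Fintype.mem_piFinset, not_forall] at hj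
  obtain ⟨i, hi⟩ := hj
  rw [hcoord, Finset.prod_eq_zero (Finset.mem_univ i)]
  rw [ht0 i _ hi, Complex.ofReal_zero]

/-- The points `(j/4, m)` of the phase space lattice, recorded as `(j, m)`. -/
abbrev PhaseLattice (ι : Type*) : Type _ := (ι → ℤ) × (ι → ℤ)

/-- The synthesis atom: the synthesis window, modulated by `m` and translated by `j/4`. -/
def gaborAtom (p : PhaseLattice ι) : 𝓢(EuclideanSpace ℝ ι, ℂ) :=
  SchwartzMap.compSubConstCLM ℂ ((1 / 4 : ℝ) • latticePt p.1)
    (modulate (latticePt p.2) (dualWindow ι))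

theorem gaborAtom_apply_eq_mul_dualWindow (p : PhaseLattice ι) (x : EuclideanSpace ℝ ι) :
    gaborAtom p x = (∏ i, (Real.fourierChar (p.2 i * (x - (1 / 4 : ℝ) • latticePt p.1) i) : ℂ)) *
      dualWindow ι (x - (1 / 4 : ℝ) • latticePt p.1) := by
  rw [gaborAtom, SchwartzMap.compSubConstCLM_apply, modulate_apply, prod_fourierChar]
  simp only [PiLp.inner_apply, latticePt_apply, RCLike.inner_apply, conj_trivial, mul_comm]

theorem gaborAtom_apply (p : PhaseLattice ι) (x : EuclideanSpace ℝ ι) :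
    gaborAtom p x = ∏ i, ((Real.fourierChar (p.2 i * (x i - p.1 i / 4)) : ℂ) *
      (plateauBump (x i - p.1 i / 4) : ℂ)) := by
  rw [gaborAtom_apply_eq_mul_dualWindow, dualWindow_apply, Finset.prod_mul_distrib]
  simp [div_eq_inv_mul]

/-- The analysis coefficient: the Fourier coefficient at `m` of `f(· + j/4)` times the analysis
window. -/
def gaborCoeff (p : PhaseLattice ι) : 𝓢(EuclideanSpace ℝ ι, ℂ) →L[ℂ] ℂ :=
  evalAt (latticePt p.2) ∘L FourierTransform.fourierCLM ℂ 𝓢(EuclideanSpace ℝ ι, ℂ) ∘L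
    slice ((1 / 4 : ℝ) • latticePt p.1) ∘L localize (window ι)

theorem gaborCoeff_apply (p : PhaseLattice ι) (f : 𝓢(EuclideanSpace ℝ ι, ℂ)) :
    gaborCoeff p f = FourierTransform.fourier
      (slice ((1 / 4 : ℝ) • latticePt p.1) (localize (window ι) f)) (latticePt p.2) := rfl

theorem gaborCoeff_eq_integral (p : PhaseLattice ι) (f : 𝓢(EuclideanSpace ℝ ι, ℂ)) :
    gaborCoeff p f = ∫ y : ι → ℝ,
      (∏ i, ((Real.fourierChar (-(p.2 i * y i)) : ℂ) * (partitionBump (y i) : ℂ))) *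
        f (WithLp.toLp 2 fun i => y i + p.1 i / 4) := by
  rw [gaborCoeff_apply, fourier_latticePt]
  refine integral_congr_ae (Eventually.of_forall fun y => ?_)
  have hshift : WithLp.toLp 2 y + (1 / 4 : ℝ) • latticePt p.1 =
      WithLp.toLp 2 fun i => y i + p.1 i / 4 := by
    ext i
    simp [div_eq_inv_mul]
  simp only [slice_localize_apply, window_apply, Finset.prod_mul_distrib, mul_assoc, hshift]

/-- The size of a phase space lattice point. -/
def phaseWeight (p : PhaseLattice ι) : ℝ := (1 + ‖latticePt p.1‖) * (1 + ‖latticePt p.2‖)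

theorem one_add_norm_fst_le_phaseWeight (p : PhaseLattice ι) :
    1 + ‖latticePt p.1‖ ≤ phaseWeight p :=
  le_mul_of_one_le_right (by positivity) (by simp)

theorem one_add_norm_snd_le_phaseWeight (p : PhaseLattice ι) :
    1 + ‖latticePt p.2‖ ≤ phaseWeight p :=
  le_mul_of_one_le_left (by positivity) (by simp)

theorem one_le_phaseWeight (p : PhaseLattice ι) : 1 ≤ phaseWeight p :=
  one_le_mul_of_one_le_of_one_le (by simp) (by simp)

variable (ι) in
theorem summable_phaseWeight_pow_inv :
    ∃ K : ℕ, Summable fun p : PhaseLattice ι => (phaseWeight p ^ K)⁻¹ := by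
  obtain ⟨K, hK⟩ := summable_one_add_norm_latticePt_pow_inv ι
  refine ⟨K, (hK.mul_of_nonneg hK (fun _ => ?_) fun _ => ?_).congr fun p => ?_⟩
  · exact inv_nonneg.2 (by positivity)
  · exact inv_nonneg.2 (by positivity)
  · rw [phaseWeight, mul_pow, mul_inv]

/-- Polynomial growth of a function on the phase space lattice. -/
def HasPolyGrowth (b : PhaseLattice ι → ℝ) : Prop :=
  ∃ (M : ℕ) (C : ℝ), 0 ≤ C ∧ ∀ p, |b p| ≤ C * phaseWeight p ^ M

theorem HasPolyGrowth.mul {a b : PhaseLattice ι → ℝ} (ha : HasPolyGrowth a)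
    (hb : HasPolyGrowth b) : HasPolyGrowth fun p => a p * b p := by
  obtain ⟨M, C, hC, h⟩ := ha
  obtain ⟨M', C', hC', h'⟩ := hb
  refine ⟨M + M', C * C', by positivity, fun p => ?_⟩
  calc |a p * b p| = |a p| * |b p| := abs_mul _ _
    _ ≤ (C * phaseWeight p ^ M) * (C' * phaseWeight p ^ M') :=
        mul_le_mul (h p) (h' p) (abs_nonneg _) ((abs_nonneg _).trans (h p))
    _ = _ := by ring

theorem hasPolyGrowth_gaborAtom {q : Seminorm ℂ 𝓢(EuclideanSpace ℝ ι, ℂ)} (hq : Continuous q) :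
    HasPolyGrowth fun p => q (gaborAtom p) := by
  obtain ⟨N, A, hA, hqN⟩ := exists_le_supSeminorm_of_continuous hq
  obtain ⟨M, C, hC, hM⟩ := exists_supSeminorm_modulate_le (dualWindow ι) N
  refine ⟨N + M, A * (2 ^ N * C), by positivity, fun p => ?_⟩
  have hfst : 1 + ‖(1 / 4 : ℝ) • latticePt p.1‖ ≤ phaseWeight p := by
    refine le_trans ?_ (one_add_norm_fst_le_phaseWeight p)
    rw [norm_smul]
    norm_num
    linarith [norm_nonneg (latticePt p.1)]
  rw [abs_of_nonneg (apply_nonneg _ _)]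
  calc q (gaborAtom p)
      ≤ A * ((1 + ‖(1 / 4 : ℝ) • latticePt p.1‖) ^ N *
          (2 ^ N * supSeminorm _ N (modulate (latticePt p.2) (dualWindow ι)))) :=
        (hqN _).trans (mul_le_mul_of_nonneg_left (supSeminorm_compSubConst_le N _ _) hA)
    _ ≤ A * ((1 + ‖(1 / 4 : ℝ) • latticePt p.1‖) ^ N *
          (2 ^ N * (C * (1 + ‖latticePt p.2‖) ^ M))) := by gcongr; exact hM _
    _ ≤ A * (phaseWeight p ^ N * (2 ^ N * (C * phaseWeight p ^ M))) := by
        have := one_le_phaseWeight p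
        gcongr
        exact one_add_norm_snd_le_phaseWeight p
    _ = _ := by ring

theorem exists_phaseWeight_pow_mul_norm_gaborCoeff_le (N : ℕ) : ∃ (M : ℕ) (C : ℝ), 0 ≤ C ∧
    ∀ (p : PhaseLattice ι) (f : 𝓢(EuclideanSpace ℝ ι, ℂ)),
      phaseWeight p ^ N * ‖gaborCoeff p f‖ ≤ C * supSeminorm _ M f := by
  obtain ⟨M₁, C₁, hC₁, h₁⟩ := exists_pow_mul_norm_fourier_slice_le
    (V := EuclideanSpace ℝ ι) (W := EuclideanSpace ℝ ι) N
  obtain ⟨M, C, hC, h⟩ := exists_supSeminorm_map_le (localize (window ι)) M₁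
  refine ⟨M, 4 ^ N * C₁ * C, by positivity, fun p f => ?_⟩
  set z := (1 / 4 : ℝ) • latticePt p.1 with hz
  have hfst : 1 + ‖latticePt p.1‖ ≤ 4 * (1 + ‖z‖) := by
    rw [hz, norm_smul]
    norm_num
    linarith [norm_nonneg (latticePt p.1)]
  calc phaseWeight p ^ N * ‖gaborCoeff p f‖
      = (1 + ‖latticePt p.1‖) ^ N * ((1 + ‖latticePt p.2‖) ^ N * ‖gaborCoeff p f‖) := by
        rw [phaseWeight, mul_pow, mul_assoc]
    _ ≤ (4 * (1 + ‖z‖)) ^ N * ((1 + ‖latticePt p.2‖) ^ N * ‖gaborCoeff p f‖) := by gcongr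
    _ = 4 ^ N * ((1 + ‖z‖) ^ N * ((1 + ‖latticePt p.2‖) ^ N * ‖gaborCoeff p f‖)) := by
        rw [mul_pow, mul_assoc]
    _ ≤ 4 ^ N * (C₁ * (C * supSeminorm _ M f)) := by
        gcongr 4 ^ N * ?_
        exact (h₁ _ z _).trans (mul_le_mul_of_nonneg_left (h f) hC₁)
    _ = _ := by ring

theorem exists_norm_gaborCoeff_mul_le {b : PhaseLattice ι → ℝ} (hb : HasPolyGrowth b) :
    ∃ (a : PhaseLattice ι → ℝ) (M : ℕ), Summable a ∧
      ∀ p f, ‖gaborCoeff p f‖ * |b p| ≤ a p * supSeminorm (EuclideanSpace ℝ ι) M f := by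
  obtain ⟨K, hK⟩ := summable_phaseWeight_pow_inv ι
  obtain ⟨N, A, hA, hN⟩ := hb
  obtain ⟨M, C, -, hM⟩ := exists_phaseWeight_pow_mul_norm_gaborCoeff_le (ι := ι) (N + K)
  refine ⟨fun p => A * C * (phaseWeight p ^ K)⁻¹, M, hK.mul_left _, fun p f => ?_⟩
  have hpos : 0 < phaseWeight p := zero_lt_one.trans_le (one_le_phaseWeight p)
  calc ‖gaborCoeff p f‖ * |b p| ≤ ‖gaborCoeff p f‖ * (A * phaseWeight p ^ N) := by
        gcongr; exact hN p
    _ = A * (phaseWeight p ^ K)⁻¹ * (phaseWeight p ^ (N + K) * ‖gaborCoeff p f‖) := by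
        field_simp
        ring
    _ ≤ A * (phaseWeight p ^ K)⁻¹ * (C * supSeminorm _ M f) := by
        gcongr _ * ?_
        exact hM p f
    _ = _ := by ring

theorem absSummable_gabor (f : 𝓢(EuclideanSpace ℝ ι, ℂ)) :
    AbsSummable ℂ fun p => gaborCoeff p f • gaborAtom p := fun q hq => by
  obtain ⟨a, M, ha, h⟩ := exists_norm_gaborCoeff_mul_le (hasPolyGrowth_gaborAtom hq)
  refine (ha.mul_right (supSeminorm _ M f)).of_nonneg_of_le (fun _ => apply_nonneg _ _) fun p => ?_
  rw [map_smul_eq_mul, ← abs_of_nonneg (apply_nonneg q (gaborAtom p))]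
  exact h p f

/-- On the support of the synthesis window the Fourier series of the localized function converges
to it; off that support both sides vanish. -/
theorem hasSum_gaborCoeff_mul_gaborAtom (f : 𝓢(EuclideanSpace ℝ ι, ℂ)) (j : ι → ℤ)
    (x : EuclideanSpace ℝ ι) :
    HasSum (fun m => gaborCoeff (j, m) f * gaborAtom (j, m) x)
      (window ι (x - (1 / 4 : ℝ) • latticePt j) * f x) := by
  set z := (1 / 4 : ℝ) • latticePt j
  set g := slice z (localize (window ι) f) with hg
  have hvalue : window ι (x - z) * f x = g (x - z) * dualWindow ι (x - z) := by
    rw [hg, slice_localize_apply, sub_add_cancel, mul_right_comm, window_mul_dualWindow]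
  have hterm : ∀ m, gaborCoeff (j, m) f * gaborAtom (j, m) x =
      FourierTransform.fourier g (latticePt m) *
        (∏ i, (Real.fourierChar (m i * (x - z) i) : ℂ)) * dualWindow ι (x - z) := fun m => by
    rw [gaborAtom_apply_eq_mul_dualWindow, gaborCoeff_apply, ← mul_assoc]
  rw [hvalue, funext hterm]
  by_cases hx : ∀ i, |(x - z) i| ≤ 1 / 2
  · refine (hasSum_fourier_latticePt (fun y hy => ?_) hx).mul_right _
    rw [hg, slice_localize_apply, window_eq_zero (hy.imp fun _ h => by linarith), zero_mul]
  · push Not at hx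
    simp only [dualWindow_eq_zero (hx.imp fun _ h => h.le), mul_zero]
    exact hasSum_zero

theorem hasSum_gabor_apply (f : 𝓢(EuclideanSpace ℝ ι, ℂ)) (x : EuclideanSpace ℝ ι) :
    HasSum (fun p => gaborCoeff p f * gaborAtom p x) (f x) := by
  have hsummable : Summable fun p => gaborCoeff p f * gaborAtom p x :=
    (absSummable_gabor f).summable_schwartz.mapL (evalAt x)
  have hfiber := hsummable.hasSum.prod_fiberwise fun j => hasSum_gaborCoeff_mul_gaborAtom f j x
  have htotal := (hasSum_window x).mul_right (f x)
  rw [one_mul] at htotal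
  exact htotal.unique hfiber ▸ hsummable.hasSum

theorem hasSum_gabor (f : 𝓢(EuclideanSpace ℝ ι, ℂ)) :
    HasSum (fun p => gaborCoeff p f • gaborAtom p) f := by
  obtain ⟨g, hg⟩ := (absSummable_gabor f).summable_schwartz
  have hfg : f = g := by
    ext x
    exact (hasSum_gabor_apply f x).unique (hg.mapL (evalAt x))
  exact hfg ▸ hg

end Gabor

/-! ### The kernel theorem -/

section Coordinates

variable {ι κ : Type*}

variable (ι κ) in
/-- The identification `ℝ^ι × ℝ^κ ≃ ℝ^(ι ⊕ κ)`. -/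
def euclideanSum :
    (EuclideanSpace ℝ ι × EuclideanSpace ℝ κ) ≃L[ℝ] EuclideanSpace ℝ (ι ⊕ κ) :=
  ((EuclideanSpace.equiv ι ℝ).prodCongr (EuclideanSpace.equiv κ ℝ)).trans
    ((ContinuousLinearEquiv.sumPiEquivProdPi ℝ ι κ fun _ => ℝ).symm.trans
      (EuclideanSpace.equiv (ι ⊕ κ) ℝ).symm)

variable (ι κ) in
/-- The splitting of the phase space lattice of `ℝ^(ι ⊕ κ)`. -/
def splitIndex : PhaseLattice (ι ⊕ κ) ≃ PhaseLattice ι × PhaseLattice κ :=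
  ((Equiv.sumArrowEquivProdArrow ι κ ℤ).prodCongr (Equiv.sumArrowEquivProdArrow ι κ ℤ)).trans
    (Equiv.prodProdProdComm _ _ _ _)

variable [Fintype ι] [Fintype κ]

theorem gaborAtom_sum (p : PhaseLattice (ι ⊕ κ)) :
    SchwartzMap.compCLMOfContinuousLinearEquiv ℂ (euclideanSum ι κ) (gaborAtom p) =
      tensor (gaborAtom (splitIndex ι κ p).1) (gaborAtom (splitIndex ι κ p).2) := by
  ext x
  rw [SchwartzMap.compCLMOfContinuousLinearEquiv_apply, Function.comp_apply, tensor_apply,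
    gaborAtom_apply, gaborAtom_apply, gaborAtom_apply, Fintype.prod_sum_type]
  rfl

theorem gaborCoeff_sum (p : PhaseLattice (ι ⊕ κ)) (f : 𝓢(EuclideanSpace ℝ ι, ℂ))
    (g : 𝓢(EuclideanSpace ℝ κ, ℂ)) :
    gaborCoeff p (SchwartzMap.compCLMOfContinuousLinearEquiv ℂ (euclideanSum ι κ).symm
        (tensor f g)) =
      gaborCoeff (splitIndex ι κ p).1 f * gaborCoeff (splitIndex ι κ p).2 g := by
  simp only [gaborCoeff_eq_integral]
  rw [← integral_prod_mul, ← Measure.volume_eq_prod,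
    ← (volume_measurePreserving_sumPiEquivProdPi fun _ : ι ⊕ κ => ℝ).integral_comp
      (MeasurableEquiv.measurableEmbedding _)]
  refine integral_congr_ae (Eventually.of_forall fun y => ?_)
  simp only [SchwartzMap.compCLMOfContinuousLinearEquiv_apply, Function.comp_apply, tensor_apply,
    Fintype.prod_sum_type]
  rw [mul_mul_mul_comm]
  rfl

theorem norm_latticePt_comp_inl_le (m : ι ⊕ κ → ℤ) :
    ‖latticePt (m ∘ Sum.inl)‖ ≤ ‖latticePt m‖ := by
  rw [EuclideanSpace.norm_eq, EuclideanSpace.norm_eq, Fintype.sum_sum_type]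
  exact Real.sqrt_le_sqrt (le_add_of_nonneg_right (Finset.sum_nonneg fun _ _ => by positivity))

theorem norm_latticePt_comp_inr_le (m : ι ⊕ κ → ℤ) :
    ‖latticePt (m ∘ Sum.inr)‖ ≤ ‖latticePt m‖ := by
  rw [EuclideanSpace.norm_eq, EuclideanSpace.norm_eq, Fintype.sum_sum_type]
  exact Real.sqrt_le_sqrt (le_add_of_nonneg_left (Finset.sum_nonneg fun _ _ => by positivity))

theorem HasPolyGrowth.comp {b : PhaseLattice ι → ℝ} (hb : HasPolyGrowth b)
    {u : PhaseLattice κ → PhaseLattice ι} (hu : ∀ p, phaseWeight (u p) ≤ phaseWeight p) :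
    HasPolyGrowth (b ∘ u) := by
  obtain ⟨M, C, hC, h⟩ := hb
  refine ⟨M, C, hC, fun p => (h (u p)).trans ?_⟩
  have := one_le_phaseWeight (u p)
  gcongr
  exact hu p

theorem HasPolyGrowth.comp_splitIndex_fst {b : PhaseLattice ι → ℝ} (hb : HasPolyGrowth b) :
    HasPolyGrowth fun p => b (splitIndex ι κ p).1 :=
  hb.comp fun p => mul_le_mul (add_le_add le_rfl (norm_latticePt_comp_inl_le p.1))
    (add_le_add le_rfl (norm_latticePt_comp_inl_le p.2)) (by positivity) (by positivity)

theorem HasPolyGrowth.comp_splitIndex_snd {b : PhaseLattice κ → ℝ} (hb : HasPolyGrowth b) :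
    HasPolyGrowth fun p => b (splitIndex ι κ p).2 :=
  hb.comp fun p => mul_le_mul (add_le_add le_rfl (norm_latticePt_comp_inr_le p.1))
    (add_le_add le_rfl (norm_latticePt_comp_inr_le p.2)) (by positivity) (by positivity)

end Coordinates

section Kernel

variable {E F : Type*} [NormedAddCommGroup E] [NormedSpace ℝ E] [FiniteDimensional ℝ E]
  [NormedAddCommGroup F] [NormedSpace ℝ F] [FiniteDimensional ℝ F]

/-- Phase space lattice points of a finite-dimensional space. -/
abbrev PhaseIndex (E : Type*) [AddCommGroup E] [Module ℝ E] : Type :=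
  PhaseLattice (Fin (Module.finrank ℝ E))

variable (E) in
/-- The synthesis atoms transported to a finite-dimensional space. -/
def atom (p : PhaseIndex E) : 𝓢(E, ℂ) :=
  SchwartzMap.compCLMOfContinuousLinearEquiv ℂ toEuclidean (gaborAtom p)

variable (E) in
/-- The analysis coefficients transported to a finite-dimensional space. -/
def coeff (p : PhaseIndex E) : 𝓢(E, ℂ) →L[ℂ] ℂ :=
  gaborCoeff p ∘L SchwartzMap.compCLMOfContinuousLinearEquiv ℂ toEuclidean.symm

theorem hasSum_atom (f : 𝓢(E, ℂ)) : HasSum (fun p => coeff E p f • atom E p) f := by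
  set f' := SchwartzMap.compCLMOfContinuousLinearEquiv ℂ (toEuclidean (E := E)).symm f
  have h := (hasSum_gabor f').mapL
    (SchwartzMap.compCLMOfContinuousLinearEquiv ℂ (toEuclidean (E := E)))
  have hf' : SchwartzMap.compCLMOfContinuousLinearEquiv ℂ toEuclidean f' = f := by
    ext x; simp [f']
  rw [hf'] at h
  exact h.congr_fun fun p => by rw [map_smul]; rfl

theorem hasPolyGrowth_atom {q : Seminorm ℂ 𝓢(E, ℂ)} (hq : Continuous q) :
    HasPolyGrowth fun p => q (atom E p) :=
  hasPolyGrowth_gaborAtom (q := q.comp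
    (SchwartzMap.compCLMOfContinuousLinearEquiv ℂ (toEuclidean (E := E))).toLinearMap)
    (hq.comp (ContinuousLinearMap.continuous _))

variable (E F) in
/-- Joint coordinates on a product. -/
def prodCoord : (E × F) ≃L[ℝ]
    EuclideanSpace ℝ (Fin (Module.finrank ℝ E) ⊕ Fin (Module.finrank ℝ F)) :=
  (toEuclidean.prodCongr toEuclidean).trans (euclideanSum _ _)

variable (E F) in
/-- The coefficients of a function on a product in terms of tensor products of atoms. -/
def prodCoeff (p : PhaseIndex E × PhaseIndex F) : 𝓢(E × F, ℂ) →L[ℂ] ℂ :=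
  gaborCoeff ((splitIndex _ _).symm p) ∘L
    SchwartzMap.compCLMOfContinuousLinearEquiv ℂ (prodCoord E F).symm

theorem prodCoeff_tensor (p : PhaseIndex E × PhaseIndex F) (f : 𝓢(E, ℂ)) (g : 𝓢(F, ℂ)) :
    prodCoeff E F p (tensor f g) = coeff E p.1 f * coeff F p.2 g := by
  have h := gaborCoeff_sum ((splitIndex _ _).symm p)
    (SchwartzMap.compCLMOfContinuousLinearEquiv ℂ toEuclidean.symm f)
    (SchwartzMap.compCLMOfContinuousLinearEquiv ℂ toEuclidean.symm g)
  rwa [Equiv.apply_symm_apply] at h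

theorem compCLM_prodCoord_gaborAtom (p : PhaseIndex E × PhaseIndex F) :
    SchwartzMap.compCLMOfContinuousLinearEquiv ℂ (prodCoord E F)
      (gaborAtom ((splitIndex _ _).symm p)) = tensor (atom E p.1) (atom F p.2) := by
  have h := congrArg (SchwartzMap.compCLMOfContinuousLinearEquiv ℂ
    ((toEuclidean (E := E)).prodCongr (toEuclidean (E := F))))
    (gaborAtom_sum ((splitIndex _ _).symm p))
  rwa [Equiv.apply_symm_apply] at h

theorem hasSum_prod_atom (T : 𝓢(E × F, ℂ)) :
    HasSum (fun p : PhaseIndex E × PhaseIndex F =>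
      prodCoeff E F p T • tensor (atom E p.1) (atom F p.2)) T := by
  set T' := SchwartzMap.compCLMOfContinuousLinearEquiv ℂ (prodCoord E F).symm T
  have h := (hasSum_gabor T').mapL (SchwartzMap.compCLMOfContinuousLinearEquiv ℂ (prodCoord E F))
  have hT' : SchwartzMap.compCLMOfContinuousLinearEquiv ℂ (prodCoord E F) T' = T := by
    ext x; simp [T']
  rw [hT', ← (splitIndex _ _).symm.hasSum_iff] at h
  refine h.congr_fun fun p => ?_
  rw [Function.comp_apply, map_smul, compCLM_prodCoord_gaborAtom]
  rfl

variable {Y : Type*} [AddCommGroup Y] [Module ℂ Y] [TopologicalSpace Y]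

theorem clm_ext_tensor [T2Space Y]
    {K K' : 𝓢(E × F, ℂ) →L[ℂ] Y} (h : ∀ f g, K (tensor f g) = K' (tensor f g)) : K = K' := by
  ext T
  have hK := (hasSum_prod_atom T).mapL K
  have hK' := (hasSum_prod_atom T).mapL K'
  simp only [map_smul, h] at hK hK'
  exact hK.unique hK'

variable {B : 𝓢(E, ℂ) →ₗ[ℂ] 𝓢(F, ℂ) →ₗ[ℂ] Y}

theorem exists_summable_bound_prodCoeff_smul
    (hB : Continuous fun p : 𝓢(E, ℂ) × 𝓢(F, ℂ) => B p.1 p.2) {q : Seminorm ℂ Y}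
    (hq : Continuous q) :
    ∃ (a : PhaseIndex E × PhaseIndex F → ℝ) (M : ℕ), Summable a ∧ ∀ p T,
      q (prodCoeff E F p T • B (atom E p.1) (atom F p.2)) ≤
        a p * supSeminorm _ M
          (SchwartzMap.compCLMOfContinuousLinearEquiv ℂ (prodCoord E F).symm T) := by
  obtain ⟨r, s, hr, hs, hrs⟩ := exists_seminorm_bilinear_le hB hq
  obtain ⟨a, M, ha, h⟩ := exists_norm_gaborCoeff_mul_le
    ((hasPolyGrowth_atom hr).comp_splitIndex_fst.mul (hasPolyGrowth_atom hs).comp_splitIndex_snd)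
  refine ⟨a ∘ (splitIndex _ _).symm, M, (splitIndex _ _).symm.summable_iff.2 ha, fun p T => ?_⟩
  have hp := h ((splitIndex _ _).symm p)
    (SchwartzMap.compCLMOfContinuousLinearEquiv ℂ (prodCoord E F).symm T)
  rw [Equiv.apply_symm_apply, abs_of_nonneg (by positivity)] at hp
  rw [map_smul_eq_mul]
  exact (mul_le_mul_of_nonneg_left (hrs _ _) (norm_nonneg _)).trans hp

theorem absSummable_prodCoeff_smul (hB : Continuous fun p : 𝓢(E, ℂ) × 𝓢(F, ℂ) => B p.1 p.2)
    (T : 𝓢(E × F, ℂ)) :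
    AbsSummable ℂ fun p => prodCoeff E F p T • B (atom E p.1) (atom F p.2) := fun q hq => by
  obtain ⟨a, M, ha, h⟩ := exists_summable_bound_prodCoeff_smul hB hq
  exact (ha.mul_right _).of_nonneg_of_le (fun _ => apply_nonneg _ _) fun p => h p T

theorem eq_of_hasSum_prodCoeff_tensor_smul [T2Space Y] [IsTopologicalAddGroup Y]
    [ContinuousConstSMul ℂ Y]
    (hB : Continuous fun p : 𝓢(E, ℂ) × 𝓢(F, ℂ) => B p.1 p.2) {f : 𝓢(E, ℂ)} {g : 𝓢(F, ℂ)} {y : Y}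
    (h : HasSum (fun p => prodCoeff E F p (tensor f g) • B (atom E p.1) (atom F p.2)) y) :
    y = B f g := by
  simp only [prodCoeff_tensor] at h
  let Bright (u : 𝓢(E, ℂ)) : 𝓢(F, ℂ) →L[ℂ] Y :=
    ⟨B u, hB.comp (continuous_const.prodMk continuous_id)⟩
  let Bleft : 𝓢(E, ℂ) →L[ℂ] Y := ⟨B.flip g, hB.comp (continuous_id.prodMk continuous_const)⟩
  have hinner : ∀ p : PhaseIndex E, HasSum (fun q : PhaseIndex F =>
      (coeff E p f * coeff F q g) • B (atom E p) (atom F q)) (coeff E p f • B (atom E p) g) :=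
    fun p => (((hasSum_atom g).mapL (Bright (atom E p))).const_smul (coeff E p f)).congr_fun
      fun q => by rw [map_smul, smul_smul]; rfl
  have houter := (hasSum_atom f).mapL Bleft
  exact (h.prod_fiberwise hinner).unique (houter.congr_fun fun p => by rw [map_smul]; rfl)

theorem exists_seminorm_le_of_hasSum_prodCoeff_smul
    (hB : Continuous fun p : 𝓢(E, ℂ) × 𝓢(F, ℂ) => B p.1 p.2) {q : Seminorm ℂ Y}
    (hq : Continuous q) :
    ∃ p : Seminorm ℂ 𝓢(E × F, ℂ), Continuous p ∧ ∀ T y,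
      HasSum (fun i => prodCoeff E F i T • B (atom E i.1) (atom F i.2)) y → q y ≤ p T := by
  obtain ⟨a, M, ha, h⟩ := exists_summable_bound_prodCoeff_smul hB hq
  let pull := SchwartzMap.compCLMOfContinuousLinearEquiv ℂ (F := ℂ) (prodCoord E F).symm
  refine ⟨(∑' i, a i).toNNReal • (supSeminorm _ M).comp pull.toLinearMap,
    ((continuous_supSeminorm M).comp pull.continuous).const_smul _, fun T y hy => ?_⟩
  have hsum := absSummable_prodCoeff_smul hB T q hq
  calc q y ≤ ∑' i, q (prodCoeff E F i T • B (atom E i.1) (atom F i.2)) :=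
        seminorm_le_tsum_of_hasSum hy hq hsum
    _ ≤ ∑' i, a i * supSeminorm _ M (pull T) :=
        hsum.tsum_le_tsum (fun i => h i T) (ha.mul_right _)
    _ = (∑' i, a i) * supSeminorm _ M (pull T) := tsum_mul_right
    _ ≤ _ := mul_le_mul_of_nonneg_right (Real.le_coe_toNNReal _) (apply_nonneg _ _)

theorem exists_tensor_lift [PolynormableSpace ℂ Y] [T2Space Y]
    (hY : ∀ {κ : Type} {f : κ → Y}, AbsSummable ℂ f → Summable f)
    (hB : Continuous fun p : 𝓢(E, ℂ) × 𝓢(F, ℂ) => B p.1 p.2) :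
    ∃ K : 𝓢(E × F, ℂ) →L[ℂ] Y, ∀ f g, K (tensor f g) = B f g := by
  have := (PolynormableSpace.withSeminorms ℂ Y).topologicalAddGroup
  have := (PolynormableSpace.withSeminorms ℂ Y).continuousSMul
  choose K hK using fun T => hY (absSummable_prodCoeff_smul hB T)
  let KL : 𝓢(E × F, ℂ) →ₗ[ℂ] Y :=
    { toFun := K
      map_add' := fun T T' => (hK (T + T')).unique <| ((hK T).add (hK T')).congr_fun fun p => by
        rw [map_add, add_smul]
      map_smul' := fun c T => (hK (c • T)).unique <| ((hK T).const_smul c).congr_fun fun p => by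
        rw [map_smul, smul_smul]; rfl }
  have hKL : Continuous KL := continuous_of_seminorm_le KL fun q hq => by
    obtain ⟨p, hp, hpq⟩ := exists_seminorm_le_of_hasSum_prodCoeff_smul hB hq
    exact ⟨p, hp, fun T => hpq T _ (hK T)⟩
  exact ⟨⟨KL, hKL⟩, fun f g => eq_of_hasSum_prodCoeff_tensor_smul hB (hK _)⟩

end Kernel

/-! ### Bastiani calculus -/

section Bastiani

universe u

section HasGateauxDeriv

variable {X Y Y₁ Y₂ : Type*} [AddCommGroup X] [Module ℝ X]
  [AddCommGroup Y] [Module ℝ Y] [TopologicalSpace Y]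
  [AddCommGroup Y₁] [Module ℝ Y₁] [TopologicalSpace Y₁]
  [AddCommGroup Y₂] [Module ℝ Y₂] [TopologicalSpace Y₂]

theorem HasGateauxDeriv.unique [T2Space Y] {f : X → Y} {x v : X} {y y' : Y}
    (h : HasGateauxDeriv f x v y) (h' : HasGateauxDeriv f x v y') : y = y' :=
  tendsto_nhds_unique h h'

theorem hasGateauxDeriv_const (c : Y) (x v : X) : HasGateauxDeriv (fun _ : X => c) x v 0 := by
  simpa [HasGateauxDeriv] using tendsto_const_nhds

theorem hasGateauxDeriv_linearMap (L : X →ₗ[ℝ] Y) (x v : X) :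
    HasGateauxDeriv L x v (L v) := by
  refine tendsto_const_nhds.congr' ?_
  filter_upwards [self_mem_nhdsWithin] with t ht
  simp [show t ≠ 0 from ht]

theorem HasGateauxDeriv.add [ContinuousAdd Y] {f g : X → Y} {x v : X} {a b : Y}
    (hf : HasGateauxDeriv f x v a) (hg : HasGateauxDeriv g x v b) :
    HasGateauxDeriv (fun x => f x + g x) x v (a + b) := by
  refine (Tendsto.add hf hg).congr fun t => ?_
  rw [← smul_add, add_sub_add_comm]

theorem HasGateauxDeriv.sum {ι : Type*} [ContinuousAdd Y] (s : Finset ι) {f : ι → X → Y} {x v : X}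
    {a : ι → Y} (h : ∀ i ∈ s, HasGateauxDeriv (f i) x v (a i)) :
    HasGateauxDeriv (fun x => ∑ i ∈ s, f i x) x v (∑ i ∈ s, a i) := by
  refine (tendsto_finsetSum s h).congr fun t => ?_
  rw [← Finset.smul_sum, Finset.sum_sub_distrib]

theorem HasGateauxDeriv.clm_comp {f : X → Y₁} {x v : X} {a : Y₁} (hf : HasGateauxDeriv f x v a)
    (L : Y₁ →L[ℝ] Y) : HasGateauxDeriv (fun x => L (f x)) x v (L a) := by
  refine ((L.continuous.tendsto a).comp hf).congr fun t => ?_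
  simp

theorem HasGateauxDeriv.bilinear [TopologicalSpace X] [ContinuousAdd X] [ContinuousSMul ℝ X]
    [ContinuousAdd Y]
    (B : Y₁ →ₗ[ℝ] Y₂ →ₗ[ℝ] Y) (hB : Continuous fun p : Y₁ × Y₂ => B p.1 p.2) {f : X → Y₁}
    {g : X → Y₂} {x v : X} {a : Y₁} {b : Y₂} (hf : HasGateauxDeriv f x v a)
    (hg : HasGateauxDeriv g x v b) (hgc : Continuous g) :
    HasGateauxDeriv (fun x => B (f x) (g x)) x v (B a (g x) + B (f x) b) := by
  have hline : Tendsto (fun t : ℝ => g (x + t • v)) (𝓝[≠] 0) (𝓝 (g x)) := by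
    have hc : Continuous fun t : ℝ => g (x + t • v) :=
      hgc.comp (continuous_const.add (continuous_id.smul continuous_const))
    simpa using (hc.tendsto 0).mono_left (nhdsWithin_le_nhds (s := {0}ᶜ))
  have hleft := (hB.tendsto (a, g x)).comp (hf.prodMk_nhds hline)
  have hright := (hB.tendsto (f x, b)).comp ((tendsto_const_nhds (x := f x)).prodMk_nhds hg)
  refine (hleft.add hright).congr fun t => ?_
  simp only [Function.comp_apply, map_smul, map_sub, LinearMap.smul_apply, LinearMap.sub_apply,
    smul_sub]
  abel

end HasGateauxDeriv

/-- `n`-fold Gâteaux differentiability with jointly continuous derivatives. Each derivative is a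
function on the product of base points and directions, so that it is of the same kind as `f`. -/
def IsCk {Y : Type*} [AddCommGroup Y] [Module ℝ Y] [TopologicalSpace Y] :
    (n : ℕ) → {X : Type u} → [AddCommGroup X] → [Module ℝ X] → [TopologicalSpace X] →
      (f : X → Y) → Prop
  | 0, _, _, _, _, f => Continuous f
  | n + 1, X, _, _, _, f => Continuous f ∧ ∃ f' : X × X → Y,
      (∀ x v, HasGateauxDeriv f x v (f' (x, v))) ∧ IsCk n f'

variable {X Z : Type u} [AddCommGroup X] [Module ℝ X] [TopologicalSpace X]
  [AddCommGroup Z] [Module ℝ Z] [TopologicalSpace Z]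
  {Y Y₁ Y₂ : Type*} [AddCommGroup Y] [Module ℝ Y] [TopologicalSpace Y]
  [AddCommGroup Y₁] [Module ℝ Y₁] [TopologicalSpace Y₁]
  [AddCommGroup Y₂] [Module ℝ Y₂] [TopologicalSpace Y₂]

theorem IsCk.continuous {n : ℕ} {f : X → Y} (h : IsCk n f) : Continuous f := by
  cases n with
  | zero => exact h
  | succ n => exact h.1

theorem IsCk.of_succ {n : ℕ} {f : X → Y} (h : IsCk (n + 1) f) : IsCk n f := by
  induction n generalizing X with
  | zero => exact h.1
  | succ n ih =>
    obtain ⟨hc, f', hf', h'⟩ := h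
    exact ⟨hc, f', hf', ih h'⟩

theorem isCk_const (n : ℕ) (c : Y) : IsCk n fun _ : X => c := by
  induction n generalizing X c with
  | zero => exact continuous_const
  | succ n ih => exact ⟨continuous_const, fun _ => 0, hasGateauxDeriv_const c, ih 0⟩

theorem isCk_clm (n : ℕ) (L : X →L[ℝ] Y) : IsCk n L := by
  induction n generalizing X with
  | zero => exact L.continuous
  | succ n ih =>
    exact ⟨L.continuous, L.comp (ContinuousLinearMap.snd ℝ X X),
      hasGateauxDeriv_linearMap (L : X →ₗ[ℝ] Y), ih _⟩

theorem IsCk.comp_clm {n : ℕ} {f : X → Y} (h : IsCk n f) (L : Z →L[ℝ] X) :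
    IsCk n fun z => f (L z) := by
  induction n generalizing X Z with
  | zero => exact Continuous.comp h L.continuous
  | succ n ih =>
    obtain ⟨hc, f', hf', h'⟩ := h
    refine ⟨hc.comp L.continuous, fun p => f' (L.prodMap L p), fun x v => ?_, ih h' _⟩
    simpa [HasGateauxDeriv] using hf' (L x) (L v)

theorem IsCk.add [ContinuousAdd Y] {n : ℕ} {f g : X → Y} (hf : IsCk n f) (hg : IsCk n g) :
    IsCk n fun x => f x + g x := by
  induction n generalizing X with
  | zero => exact Continuous.add hf hg
  | succ n ih =>
    obtain ⟨hfc, f', hf', hfn⟩ := hf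
    obtain ⟨hgc, g', hg', hgn⟩ := hg
    exact ⟨hfc.add hgc, _, fun x v => (hf' x v).add (hg' x v), ih hfn hgn⟩

theorem IsCk.sum {ι : Type*} [ContinuousAdd Y] {n : ℕ} (s : Finset ι) {f : ι → X → Y}
    (h : ∀ i ∈ s, IsCk n (f i)) : IsCk n fun x => ∑ i ∈ s, f i x := by
  classical
  induction s using Finset.induction_on with
  | empty => exact isCk_const n 0
  | insert i s hi ih =>
    simp only [Finset.sum_insert hi]
    exact (h i (Finset.mem_insert_self i s)).add
      (ih fun j hj => h j (Finset.mem_insert_of_mem hj))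

theorem IsCk.clm_comp {n : ℕ} {f : X → Y₁} (hf : IsCk n f) (L : Y₁ →L[ℝ] Y) :
    IsCk n fun x => L (f x) := by
  induction n generalizing X with
  | zero => exact L.continuous.comp hf
  | succ n ih =>
    obtain ⟨hfc, f', hf', hfn⟩ := hf
    exact ⟨L.continuous.comp hfc, _, fun x v => (hf' x v).clm_comp L, ih hfn⟩

theorem IsCk.bilinear [ContinuousAdd X] [ContinuousSMul ℝ X] [ContinuousAdd Y]
    (B : Y₁ →ₗ[ℝ] Y₂ →ₗ[ℝ] Y) (hB : Continuous fun p : Y₁ × Y₂ => B p.1 p.2) {n : ℕ} {f : X → Y₁}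
    {g : X → Y₂} (hf : IsCk n f) (hg : IsCk n g) : IsCk n fun x => B (f x) (g x) := by
  induction n generalizing X with
  | zero => exact hB.comp (Continuous.prodMk hf hg)
  | succ n ih =>
    obtain ⟨hfc, f', hf', hfn⟩ := id hf
    obtain ⟨hgc, g', hg', hgn⟩ := id hg
    refine ⟨hB.comp (hfc.prodMk hgc), fun p => B (f' p) (g p.1) + B (f p.1) (g' p),
      fun x v => (hf' x v).bilinear B hB (hg' x v) hgc, ?_⟩
    exact (ih hfn (hg.of_succ.comp_clm (ContinuousLinearMap.fst ℝ X X))).add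
      (ih (hf.of_succ.comp_clm (ContinuousLinearMap.fst ℝ X X)) hgn)

theorem isCk_pi {ι : Type*} {Y : ι → Type*} [∀ i, AddCommGroup (Y i)] [∀ i, Module ℝ (Y i)]
    [∀ i, TopologicalSpace (Y i)] {n : ℕ} {f : X → ∀ i, Y i} (h : ∀ i, IsCk n fun x => f x i) :
    IsCk n f := by
  induction n generalizing X with
  | zero => exact continuous_pi h
  | succ n ih =>
    choose hc f' hf' hn using h
    exact ⟨continuous_pi hc, fun p i => f' i p, fun x v => tendsto_pi_nhds.2 fun i => hf' i x v,
      ih hn⟩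

theorem IsCk.codRestrict {W : Submodule ℝ Y} (hW : IsClosed (W : Set Y)) {n : ℕ} {f : X → W}
    (h : IsCk n fun x => (f x : Y)) : IsCk n f := by
  induction n generalizing X with
  | zero => exact Continuous.subtype_mk h fun x => (f x).2
  | succ n ih =>
    obtain ⟨hc, f', hf', hn⟩ := h
    have hmem : ∀ p, f' p ∈ W := fun p =>
      hW.mem_of_tendsto (hf' p.1 p.2) (Eventually.of_forall fun t =>
        W.smul_mem _ (W.sub_mem (f _).2 (f _).2))
    refine ⟨hc.subtype_mk fun x => (f x).2, fun p => ⟨f' p, hmem p⟩, fun x v => ?_, ih hn⟩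
    exact tendsto_subtype_rng.2 (hf' x v)

theorem exists_deriv_of_forall_isCk [T2Space Y] {f : X → Y} (h : ∀ n, IsCk n f) :
    ∃ f' : X × X → Y, (∀ x v, HasGateauxDeriv f x v (f' (x, v))) ∧ ∀ n, IsCk n f' := by
  obtain ⟨-, f', hf', -⟩ := h 1
  refine ⟨f', hf', fun n => ?_⟩
  obtain ⟨-, g, hg, hn⟩ := h (n + 1)
  obtain rfl : f' = g := funext fun p => (hf' p.1 p.2).unique (hg p.1 p.2)
  exact hn

variable (X) in
/-- The rearrangement `(x; v₁, …, v_{r+1}) ↦ ((x; v₁, …, v_r), (v_{r+1}; 0))`: along it, the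
derivative of an `r`-th directional derivative on `X × X^r`, in a direction that moves the base
point only, becomes the `(r + 1)`-st directional derivative. -/
def splitLastDirection (r : ℕ) :
    (X × (Fin (r + 1) → X)) →L[ℝ] (X × (Fin r → X)) × (X × (Fin r → X)) :=
  ((ContinuousLinearMap.fst ℝ X _).prod (ContinuousLinearMap.pi fun i =>
      (ContinuousLinearMap.proj i.castSucc).comp (ContinuousLinearMap.snd ℝ X _))).prod
    (((ContinuousLinearMap.proj (Fin.last r)).comp (ContinuousLinearMap.snd ℝ X _)).prod 0)

theorem splitLastDirection_snoc {r : ℕ} (x : X) (v : Fin r → X) (w : X) :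
    splitLastDirection X r (x, Fin.snoc v w) = ((x, v), (w, 0)) := by
  refine Prod.ext (Prod.ext rfl (funext fun i => ?_)) (Prod.ext ?_ rfl) <;>
    simp [splitLastDirection]

/-- The iterated directional derivatives `(x; v₁, …, v_r) ↦ f^{(r)}(x; v₁, …, v_r)`. -/
def iteratedGateauxDeriv [T2Space Y] {f : X → Y} (h : ∀ n, IsCk n f) :
    (r : ℕ) → {g : X × (Fin r → X) → Y // ∀ n, IsCk n g}
  | 0 => ⟨fun p => f p.1, fun n =>
      (h n).comp_clm (Z := X × (Fin 0 → X)) (ContinuousLinearMap.fst ℝ X (Fin 0 → X))⟩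
  | r + 1 =>
    let hD := exists_deriv_of_forall_isCk (iteratedGateauxDeriv h r).2
    ⟨fun p => hD.choose (splitLastDirection X r p), fun n =>
      (hD.choose_spec.2 n).comp_clm (splitLastDirection X r)⟩

theorem isSmooth_of_forall_isCk [T2Space Y] {f : X → Y} (h : ∀ n, IsCk n f) : IsSmooth f := by
  refine ⟨fun r x v => (iteratedGateauxDeriv h r).1 (x, v), fun _ _ => rfl,
    fun r => ((iteratedGateauxDeriv h r).2 0).continuous, fun r x v w => ?_⟩
  have hD := exists_deriv_of_forall_isCk (iteratedGateauxDeriv h r).2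
  have hsnoc : (iteratedGateauxDeriv h (r + 1)).1 (x, Fin.snoc v w) =
      hD.choose ((x, v), (w, 0)) :=
    congrArg hD.choose (splitLastDirection_snoc x v w)
  simpa [hsnoc, HasGateauxDeriv] using hD.choose_spec.1 (x, v) (w, 0)

end Bastiani

/-! ### Schwartz kernels and partial pairings -/

section Hypocontinuity

variable {𝕜 X Y Z : Type*} [NontriviallyNormedField 𝕜]
  [AddCommGroup X] [Module 𝕜 X] [TopologicalSpace X] [IsTopologicalAddGroup X]
  [AddCommGroup Y] [Module 𝕜 Y] [TopologicalSpace Y] [IsTopologicalAddGroup Y]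
  [ContinuousSMul 𝕜 Y] [AddCommGroup Z] [Module 𝕜 Z] [TopologicalSpace Z]
  [IsTopologicalAddGroup Z] [ContinuousConstSMul 𝕜 Z]

/-- A convergent sequence is bounded, so that convergence in the strong topology is uniform along
it; for sequential spaces this upgrades hypocontinuity to joint continuity. -/
theorem continuous_uncurry_of_clm [SequentialSpace (X × Y)] (A : X →L[𝕜] Y →L[𝕜] Z) :
    Continuous fun p : X × Y => A p.1 p.2 := by
  refine SeqContinuous.continuous fun u p hu => ?_
  have hfst : Tendsto (fun n => A ((u n).1 - p.1)) atTop (𝓝 0) := by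
    simpa [Function.comp_def] using
      (A.continuous.tendsto (p.1 - p.1)).comp (((continuous_fst.tendsto p).comp hu).sub_const p.1)
  have hsnd : Tendsto (fun n => (u n).2) atTop (𝓝 p.2) := (continuous_snd.tendsto p).comp hu
  have hbdd : Bornology.IsVonNBounded 𝕜 (Set.range fun n => (u n).2) := hsnd.isVonNBounded_range 𝕜
  have huniform : Tendsto (fun n => A ((u n).1 - p.1) (u n).2) atTop (𝓝 0) := by
    refine tendsto_def.2 fun V hV => ?_
    filter_upwards [hfst.eventually (ContinuousLinearMap.eventually_nhds_zero_mapsTo hbdd hV)]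
      with n hn
    exact hn ⟨n, rfl⟩
  simpa [Function.comp_def] using huniform.add (((A p.1).continuous.tendsto _).comp hsnd)

end Hypocontinuity

section Kernels

variable {d k : ℕ}

theorem schwartzKernel_tensor (A : DVO d k) (f g : Sch d k) :
    schwartzKernel A (tensor g f) = A f g := by
  have h : ∃ K : Ker d k →L[ℂ] ℂ, ∀ f g : Sch d k, K (tensor g f) = A f g := by
    obtain ⟨K, hK⟩ := exists_tensor_lift (B := A.toLinearMap₁₂.flip)
      AbsSummable.summable_of_completeSpace ((continuous_uncurry_of_clm A).comp continuous_swap)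
    exact ⟨K, fun f g => hK g f⟩
  rw [schwartzKernel, dif_pos h]
  exact h.choose_spec f g

theorem schwartzKernel_add (A B : DVO d k) :
    schwartzKernel (A + B) = schwartzKernel A + schwartzKernel B :=
  clm_ext_tensor fun f g => by simp [schwartzKernel_tensor]

theorem schwartzKernel_smul (c : ℂ) (A : DVO d k) :
    schwartzKernel (c • A) = c • schwartzKernel A :=
  clm_ext_tensor fun f g => by simp [schwartzKernel_tensor]

theorem schwartzKernel_zero : schwartzKernel (0 : DVO d k) = 0 :=
  clm_ext_tensor fun f g => by simp [schwartzKernel_tensor]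

theorem genTrace_tensor (A : DVO d k) (f g : Sch d k) : genTrace A (tensor f g) = A f g := by
  have htranspose : transposeS (tensor f g) = tensor g f := by ext p; exact mul_comm _ _
  rw [genTrace, htranspose, schwartzKernel_tensor]

/-- The transposition of kernels as a continuous linear map. -/
def transposeCLM {E : Type*} [NormedAddCommGroup E] [NormedSpace ℝ E] :
    𝓢(E × E, ℂ) →L[ℂ] 𝓢(E × E, ℂ) :=
  SchwartzMap.compCLMOfContinuousLinearEquiv ℂ (ContinuousLinearEquiv.prodComm ℝ E E)

theorem eq_of_forall_integral_mul_eq {E : Type*} [NormedAddCommGroup E] [NormedSpace ℝ E]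
    [FiniteDimensional ℝ E] [MeasurableSpace E] [BorelSpace E] {μ : Measure E}
    [IsLocallyFiniteMeasure μ] [μ.IsOpenPosMeasure] {u v : 𝓢(E, ℂ)}
    (h : ∀ φ : 𝓢(E, ℂ), ∫ x, u x * φ x ∂μ = ∫ x, v x * φ x ∂μ) : u = v := by
  have hae : ∀ᵐ x ∂μ, u x = v x :=
    ae_eq_of_integral_contDiff_smul_eq u.continuous.locallyIntegrable
      v.continuous.locallyIntegrable fun g hg hsupp => by
        let φ : 𝓢(E, ℂ) := HasCompactSupport.toSchwartzMap (f := fun x => (g x : ℂ))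
          (hsupp.comp_left Complex.ofReal_zero) (Complex.ofRealCLM.contDiff.comp hg)
        have hφ : ∀ (w : 𝓢(E, ℂ)) (x : E), g x • w x = w x * φ x := fun w x => by
          rw [Complex.real_smul, mul_comm]; rfl
        simpa only [hφ] using h φ
  exact DFunLike.coe_injective ((u.continuous.ae_eq_iff_eq μ v.continuous).1 hae)

theorem partialKernel_eq {B : DVO d k} {β : Fin k} {f g : Sch d k}
    {Ψ : 𝓢(Pt d × Pt d, ℂ)} (h : ∀ (φ : 𝓢(Pt d, ℂ)) (x' : Pt d),
      B f (slot β φ g x') = ∫ x, Ψ (x, x') * φ x) : partialKernel B β f g = Ψ := by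
  have hex : ∃ Ψ : 𝓢(Pt d × Pt d, ℂ), ∀ (φ : 𝓢(Pt d, ℂ)) (x' : Pt d),
      B f (slot β φ g x') = ∫ x, Ψ (x, x') * φ x := ⟨Ψ, h⟩
  rw [partialKernel, dif_pos hex]
  ext ⟨x, x'⟩
  have hslice : slice x' hex.choose = slice x' Ψ :=
    eq_of_forall_integral_mul_eq (μ := volume) fun φ => by
      simp only [slice_apply]
      rw [← hex.choose_spec φ x', ← h φ x']
  exact DFunLike.congr_fun hslice x

end Kernels

/-! ### The contraction -/

section PullBack

variable {E F V W : Type*} [NormedAddCommGroup E] [NormedSpace ℝ E] [NormedAddCommGroup F]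
  [NormedSpace ℝ F] [NormedAddCommGroup V] [NormedSpace ℝ V] [NormedAddCommGroup W]
  [NormedSpace ℝ W]

/-- Pull-back of Schwartz functions along an injective linear map from a finite-dimensional space:
injectivity makes the map bounded below. -/
def pullInjective [FiniteDimensional ℝ V] (L : V →L[ℝ] W) (hL : Function.Injective L) :
    𝓢(W, ℂ) →L[ℂ] 𝓢(V, ℂ) :=
  SchwartzMap.compCLMOfAntilipschitz ℂ L.hasTemperateGrowth
    ((L : V →ₗ[ℝ] W).exists_antilipschitzWith (LinearMap.ker_eq_bot.2 hL)).choose_spec.2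

@[simp] theorem pullInjective_apply [FiniteDimensional ℝ V] (L : V →L[ℝ] W)
    (hL : Function.Injective L) (f : 𝓢(W, ℂ)) (v : V) : pullInjective L hL f v = f (L v) := rfl

/-- The slice `f(z, ·)` of a Schwartz function on a product. -/
def leftSlice (z : E) : 𝓢(E × F, ℂ) →L[ℂ] 𝓢(F, ℂ) :=
  (slice z).comp
    (SchwartzMap.compCLMOfContinuousLinearEquiv ℂ (ContinuousLinearEquiv.prodComm ℝ F E))

@[simp] theorem leftSlice_apply (z : E) (f : 𝓢(E × F, ℂ)) (y : F) :
    leftSlice z f y = f (z, y) := rfl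

theorem leftSlice_tensor (z : E) (f : 𝓢(E, ℂ)) (g : 𝓢(F, ℂ)) :
    leftSlice z (tensor f g) = f z • g := rfl

theorem exists_map_leftSlice [FiniteDimensional ℝ E] [FiniteDimensional ℝ F]
    (L : 𝓢(F, ℂ) →L[ℂ] 𝓢(V, ℂ)) :
    ∃ M : 𝓢(E × F, ℂ) →L[ℂ] 𝓢(E × V, ℂ), ∀ f z v, M f (z, v) = L (leftSlice z f) v := by
  obtain ⟨M, hM⟩ := exists_tensor_lift
    (B := (tensorLM E V).compl₂ (L : 𝓢(F, ℂ) →ₗ[ℂ] 𝓢(V, ℂ))) AbsSummable.summable_schwartz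
    ((continuous_tensor E V).comp (continuous_fst.prodMk (L.continuous.comp continuous_snd)))
  refine ⟨M, fun f z v => ?_⟩
  have heval : (evalAt (z, v)).comp M = (evalAt v).comp (L.comp (leftSlice z)) :=
    clm_ext_tensor fun f g => by
      simp only [ContinuousLinearMap.comp_apply, leftSlice_tensor, map_smul, hM]
      rfl
  exact DFunLike.congr_fun heval f

end PullBack

section Contraction

variable {d a b n : ℕ}

/-- The separation `x ↦ ((x_j)_{j ≠ α}, x_α)` of the coordinate `α`. -/
def splitAt (α : Fin (a + 1)) : Conf d (a + 1) →L[ℝ] Conf d a × Pt d :=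
  (ContinuousLinearMap.pi fun j => ContinuousLinearMap.proj (α.succAbove j)).prod
    (ContinuousLinearMap.proj α)

theorem injective_splitAt (α : Fin (a + 1)) : Function.Injective (splitAt (d := d) α) := by
  refine fun x y hxy => funext fun i => ?_
  rcases Fin.eq_self_or_eq_succAbove α i with rfl | ⟨j, rfl⟩
  · exact congrArg Prod.snd hxy
  · exact congrFun (congrArg Prod.fst hxy) j

/-- The joint configuration `glue h α β x y`, which does not depend on `x_α`, as a linear function
of `((x_j)_{j ≠ α}, y)`. -/
def glueCLM (h : a + b = n) (α : Fin (a + 1)) (β : Fin (b + 1)) :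
    Conf d a × Conf d (b + 1) →L[ℝ] Conf d (n + 1) :=
  ContinuousLinearMap.pi fun i =>
    if hi : (i : ℕ) < a + 1 then
      α.insertNth (α := fun _ => Conf d a × Conf d (b + 1) →L[ℝ] Pt d)
        ((ContinuousLinearMap.proj β).comp (ContinuousLinearMap.snd ℝ _ _))
        (fun j => (ContinuousLinearMap.proj j).comp (ContinuousLinearMap.fst ℝ _ _)) ⟨i, hi⟩
    else (ContinuousLinearMap.proj (β.succAbove ⟨(i : ℕ) - (a + 1), by omega⟩)).comp
      (ContinuousLinearMap.snd ℝ _ _)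

theorem glueCLM_splitAt (h : a + b = n) (α : Fin (a + 1)) (β : Fin (b + 1))
    (x : Conf d (a + 1)) (y : Conf d (b + 1)) :
    glueCLM h α β ((splitAt α x).1, y) = glue h α β x y := by
  funext i
  simp only [glueCLM, glue, ContinuousLinearMap.coe_pi']
  split_ifs with hi hα
  · simp [hα]
  · obtain ⟨j, hj⟩ := Fin.exists_succAbove_eq hα
    simp [← hj, splitAt]
  · rfl

theorem injective_glueCLM (h : a + b = n) (α : Fin (a + 1)) (β : Fin (b + 1)) :
    Function.Injective (glueCLM (d := d) h α β) := by
  rintro ⟨u, y⟩ ⟨v, z⟩ huv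
  have happly (i : Fin (n + 1)) := congrFun huv i
  refine Prod.ext (funext fun j => ?_) (funext fun j => ?_)
  · simpa [glueCLM, Nat.lt_succ_iff.1 (α.succAbove j).2] using happly ⟨α.succAbove j, by omega⟩
  · rcases Fin.eq_self_or_eq_succAbove β j with rfl | ⟨m, rfl⟩
    · simpa [glueCLM, Nat.lt_succ_iff.1 α.2] using happly ⟨α, by omega⟩
    · simpa [glueCLM, show ¬ a + 1 + (m : ℕ) ≤ a by omega] using happly ⟨a + 1 + m, by omega⟩

theorem exists_glued_tensor (h : a + b = n) (α : Fin (a + 1)) (β : Fin (b + 1)) :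
    ∃ P : Ker d (n + 1) →L[ℂ] 𝓢((Conf d a × Conf d a) × (Conf d (b + 1) × Conf d (b + 1)), ℂ),
      ∀ f g x x', leftSlice ((splitAt α x).1, (splitAt α x').1) (P (tensor f g)) =
        tensor (freeze h α β x f) (freeze h α β x' g) := by
  let G := ((glueCLM (d := d) h α β).prodMap (glueCLM h α β)).comp
    (ContinuousLinearEquiv.prodProdProdComm ℝ (Conf d a) (Conf d a) (Conf d (b + 1))
      (Conf d (b + 1))).toContinuousLinearMap
  have hG : Function.Injective G :=
    ((injective_glueCLM h α β).prodMap (injective_glueCLM h α β)).comp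
      (ContinuousLinearEquiv.injective _)
  refine ⟨pullInjective G hG, fun f g x x' => ?_⟩
  ext ⟨y, y'⟩
  rw [tensor_apply, freeze_apply, freeze_apply, ← glueCLM_splitAt, ← glueCLM_splitAt]
  rfl

theorem exists_contrKernel (h : a + b = n) {B : DVO d (b + 1)} (hB : HasGMP B)
    (α : Fin (a + 1)) (β : Fin (b + 1)) :
    ∃ Θ : Ker d (n + 1) →L[ℂ] Ker d (a + 1), ∀ f g x x', Θ (tensor f g) (x, x') =
      partialKernel B β (freeze h α β x f) (freeze h α β x' g) (x α, x' α) := by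
  obtain ⟨Φ, hΦcont, hΦ⟩ := hB β
  obtain ⟨Φ', hΦ'⟩ := exists_tensor_lift (B := Φ) AbsSummable.summable_schwartz hΦcont
  obtain ⟨M, hM⟩ := exists_map_leftSlice (E := Conf d a × Conf d a) Φ'
  obtain ⟨P, hP⟩ := exists_glued_tensor (d := d) h α β
  let e := ContinuousLinearEquiv.prodProdProdComm ℝ (Conf d a) (Pt d) (Conf d a) (Pt d)
  let S := e.toContinuousLinearMap.comp ((splitAt α).prodMap (splitAt α))
  have hS : Function.Injective S := e.injective.comp
    ((injective_splitAt α).prodMap (injective_splitAt α))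
  refine ⟨(pullInjective S hS).comp (M.comp P), fun f g x x' => ?_⟩
  calc M (P (tensor f g)) (((splitAt α x).1, (splitAt α x').1), (x α, x' α))
      = Φ' (tensor (freeze h α β x f) (freeze h α β x' g)) (x α, x' α) := by rw [hM, hP]
    _ = partialKernel B β (freeze h α β x f) (freeze h α β x' g) (x α, x' α) := by
      rw [hΦ', partialKernel_eq (hΦ _ _)]

theorem contrKernel_eq (h : a + b = n) {B : DVO d (b + 1)} {α : Fin (a + 1)} {β : Fin (b + 1)}
    {f g : Sch d (n + 1)} {T : Ker d (a + 1)} (hT : ∀ x x', T (x, x') =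
      partialKernel B β (freeze h α β x f) (freeze h α β x' g) (x α, x' α)) :
    contrKernel h B α β f g = T := by
  have hex : ∃ T : Ker d (a + 1), ∀ x x', T (x, x') =
      partialKernel B β (freeze h α β x f) (freeze h α β x' g) (x α, x' α) := ⟨T, hT⟩
  rw [contrKernel, dif_pos hex]
  ext ⟨x, x'⟩
  rw [hex.choose_spec, hT]

theorem contraction_apply (h : a + b = n) (A : DVO d (a + 1)) {B : DVO d (b + 1)}
    (hB : HasGMP B) (α : Fin (a + 1)) (β : Fin (b + 1)) (f g : Sch d (n + 1)) :
    contraction h A B α β f g = schwartzKernel A (transposeS (contrKernel h B α β f g)) := by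
  have hex : ∃ C : DVO d (n + 1), ∀ f g : Sch d (n + 1),
      C f g = schwartzKernel A (transposeS (contrKernel h B α β f g)) := by
    obtain ⟨Θ, hΘ⟩ := exists_contrKernel h hB α β
    let S := (schwartzKernel A).comp (transposeCLM.comp Θ)
    let C : Sch d (n + 1) →ₗ[ℂ] Sch d (n + 1) →L[ℂ] ℂ :=
      { toFun f := S.comp (tensorCLM _ f)
        map_add' f f' := by
          ext g
          exact (congrArg S (LinearMap.map_add₂ (tensorLM _ _) f f' g)).trans (map_add S _ _)
        map_smul' c f := by
          ext g
          exact (congrArg S (LinearMap.map_smul₂ (tensorLM _ _) c f g)).trans (map_smul S c _) }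
    refine ⟨⟨C, ContinuousLinearMap.continuous_of_continuous_uncurry C
      (S.continuous.comp (continuous_tensor _ _))⟩, fun f g => ?_⟩
    rw [contrKernel_eq h (hΘ f g)]
    rfl
  rw [contraction, dif_pos hex]
  exact hex.choose_spec f g

end Contraction

/-! ### Product states -/

section Products

variable {d k : ℕ}

/-- `(ψ ⊗ g)(x₀, …, x_k) = ψ(x₀) g(x₁, …, x_k)`, the product in the recursion for `tensorPow`. -/
def consTensor : 𝓢(Pt d, ℂ) →ₗ[ℂ] Sch d k →ₗ[ℂ] Sch d (k + 1) :=
  (tensorLM (Pt d) (Conf d k)).compr₂ (SchwartzMap.compCLMOfContinuousLinearEquiv (F := ℂ) ℂ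
    (Fin.consEquivL ℝ fun _ : Fin (k + 1) => Pt d).symm).toLinearMap

theorem consTensor_apply (ψ : 𝓢(Pt d, ℂ)) (g : Sch d k) (x : Conf d (k + 1)) :
    consTensor ψ g x = ψ (x 0) * g fun i => x i.succ := rfl

theorem continuous_consTensor :
    Continuous fun p : 𝓢(Pt d, ℂ) × Sch d k => consTensor p.1 p.2 :=
  (SchwartzMap.compCLMOfContinuousLinearEquiv (F := ℂ) ℂ
    (Fin.consEquivL ℝ fun _ : Fin (k + 1) => Pt d).symm).continuous.comp (continuous_tensor _ _)

/-- The tensor product `ψ₁ ⊗ ⋯ ⊗ ψ_k` of one-particle functions. -/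
def tensorFamily : (k : ℕ) → (Fin k → 𝓢(Pt d, ℂ)) → Sch d k
  | 0, _ => oneS
  | k + 1, ψ => consTensor (ψ 0) (tensorFamily k fun i => ψ i.succ)

theorem tensorFamily_apply (ψ : Fin k → 𝓢(Pt d, ℂ)) (x : Conf d k) :
    tensorFamily k ψ x = ∏ i, ψ i (x i) := by
  induction k with
  | zero => simp [tensorFamily, oneS]
  | succ k ih => rw [tensorFamily, consTensor_apply, ih, Fin.prod_univ_succ]

/-- `φ ⊗ ⋯ ⊗ δ ⊗ ⋯ ⊗ φ` with `δ` at the place `α`: the partial derivatives of `φ ↦ φ^{⊗k}`. -/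
def insertPow (φ : 𝓢(Pt d, ℂ)) (α : Fin k) (δ : 𝓢(Pt d, ℂ)) : Sch d k :=
  tensorFamily k (Function.update (fun _ => φ) α δ)

theorem insertPow_apply (φ : 𝓢(Pt d, ℂ)) (α : Fin (k + 1)) (δ : 𝓢(Pt d, ℂ))
    (x : Conf d (k + 1)) :
    insertPow φ α δ x = δ (x α) * ∏ j, φ (x (α.succAbove j)) := by
  rw [insertPow, tensorFamily_apply, Fin.prod_univ_succAbove _ α]
  simp

theorem insertPow_zero (φ : 𝓢(Pt d, ℂ)) (δ : 𝓢(Pt d, ℂ)) :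
    insertPow φ (0 : Fin (k + 1)) δ = consTensor δ (tensorPow φ k) := by
  ext x
  simp [insertPow_apply, consTensor_apply, tensorPow_apply]

theorem consTensor_insertPow (φ : 𝓢(Pt d, ℂ)) (α : Fin k) (δ : 𝓢(Pt d, ℂ)) :
    consTensor φ (insertPow φ α δ) = insertPow φ α.succ δ := by
  have htail : (fun i : Fin k => Function.update (fun _ => φ) α.succ δ i.succ) =
      Function.update (fun _ => φ) α δ := by
    funext i
    simp only [Function.update_apply, Fin.succ_inj]
  rw [insertPow, insertPow, tensorFamily, htail, Function.update_of_ne (Fin.succ_ne_zero α).symm]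

theorem conjS_tensorPow (φ : 𝓢(Pt d, ℂ)) : conjS (tensorPow φ k) = tensorPow (conjS φ) k := by
  ext x
  simp [tensorPow_apply]

theorem conjS_insertPow (φ : 𝓢(Pt d, ℂ)) (α : Fin (k + 1)) (δ : 𝓢(Pt d, ℂ)) :
    conjS (insertPow φ α δ) = insertPow (conjS φ) α (conjS δ) := by
  ext x
  simp [insertPow_apply]

theorem permS_tensorPow (φ : 𝓢(Pt d, ℂ)) (π : Equiv.Perm (Fin k)) :
    permS π (tensorPow φ k) = tensorPow φ k := by
  ext x
  rw [permS_apply, tensorPow_apply, tensorPow_apply, Equiv.prod_comp π fun i => φ (x i)]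

theorem permS_insertPow (φ : 𝓢(Pt d, ℂ)) (α : Fin k) (δ : 𝓢(Pt d, ℂ)) (π : Equiv.Perm (Fin k)) :
    permS π (insertPow φ α δ) = insertPow φ (π α) δ := by
  ext x
  rw [permS_apply, insertPow, insertPow, tensorFamily_apply, tensorFamily_apply,
    ← Equiv.prod_comp π fun i => (Function.update (fun _ => φ) (π α) δ : _ → 𝓢(Pt d, ℂ)) i (x i)]
  simp only [Function.update_apply, EmbeddingLike.apply_eq_iff_eq]

theorem inv_factorial_smul_sum_perm_const {M : Type*} [AddCommGroup M] [Module ℂ M] (m : M) :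
    (k.factorial : ℂ)⁻¹ • ∑ _π : Equiv.Perm (Fin k), m = m := by
  rw [Finset.sum_const, Finset.card_univ, Fintype.card_perm, Fintype.card_fin,
    ← Nat.cast_smul_eq_nsmul ℂ, inv_smul_smul₀ (Nat.cast_ne_zero.2 k.factorial_ne_zero)]

theorem symS_tensorPow (φ : 𝓢(Pt d, ℂ)) : symS k (tensorPow φ k) = tensorPow φ k := by
  simp only [symS, smul_apply, sum_apply, permS_tensorPow, inv_factorial_smul_sum_perm_const]

theorem symOp_tensorPow (A : DVO d k) (φ ψ : 𝓢(Pt d, ℂ)) :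
    symOp A (tensorPow φ k) (tensorPow ψ k) = A (tensorPow φ k) (tensorPow ψ k) := by
  simp only [symOp, ContinuousLinearMap.comp_apply, symS_tensorPow, smul_apply, sum_apply,
    permOp_apply, permS_tensorPow, inv_factorial_smul_sum_perm_const]

theorem slot_tensorPow (φ ψ : 𝓢(Pt d, ℂ)) (α : Fin (k + 1)) (x' : Pt d) :
    slot α ψ (tensorPow φ (k + 1)) x' = φ x' • insertPow φ α ψ := by
  ext y
  rw [slot_apply, tensorPow_apply, Fin.prod_univ_succAbove _ α, smul_apply, insertPow_apply]
  simp [mul_left_comm]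

theorem slot_zero_consTensor (θ ψ : 𝓢(Pt d, ℂ)) (g : Sch d k) (x' : Pt d) :
    slot 0 ψ (consTensor θ g) x' = θ x' • consTensor ψ g := by
  ext y
  rw [slot_apply, smul_apply, consTensor_apply, consTensor_apply]
  simp [mul_left_comm]

theorem exists_schwartz_apply_eq_one {E : Type*} [NormedAddCommGroup E] [NormedSpace ℝ E]
    [FiniteDimensional ℝ E] (x : E) : ∃ θ : 𝓢(E, ℂ), θ x = 1 := by
  let b : ContDiffBump x := default
  refine ⟨HasCompactSupport.toSchwartzMap (f := fun y => (b y : ℂ))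
    (b.hasCompactSupport.comp_left Complex.ofReal_zero)
    (Complex.ofRealCLM.contDiff.comp b.contDiff), ?_⟩
  exact congrArg Complex.ofReal <| b.one_of_mem_closedBall (Metric.mem_closedBall_self b.rIn_pos.le)

end Products

/-! ### Smoothness of the embedding -/

section Smooth

variable {d : ℕ}

/-- Complex conjugation of Schwartz functions as a real continuous linear map. -/
def conjCLM (E : Type*) [NormedAddCommGroup E] [NormedSpace ℝ E] : 𝓢(E, ℂ) →L[ℝ] 𝓢(E, ℂ) :=
  SchwartzMap.postcompCLM (𝕜 := ℝ) (Complex.conjCLE : ℂ →L[ℝ] ℂ)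

theorem isCk_tensorPow (k n : ℕ) : IsCk n fun φ : 𝓢(Pt d, ℂ) => tensorPow φ k := by
  induction k with
  | zero => exact isCk_const n oneS
  | succ k ih =>
    exact IsCk.bilinear (LinearMap.restrictScalars₁₂ ℝ ℝ consTensor) continuous_consTensor
      (isCk_clm n (ContinuousLinearMap.id ℝ _)) ih

theorem isCk_conj_tensorPow (k n : ℕ) : IsCk n fun φ : 𝓢(Pt d, ℂ) => conjS (tensorPow φ k) :=
  (isCk_tensorPow k n).clm_comp (conjCLM _)

theorem hasGateauxDeriv_tensorPow (k : ℕ) (φ δ : 𝓢(Pt d, ℂ)) :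
    HasGateauxDeriv (fun φ : 𝓢(Pt d, ℂ) => tensorPow φ k) φ δ (∑ α, insertPow φ α δ) := by
  induction k with
  | zero => exact hasGateauxDeriv_const (X := 𝓢(Pt d, ℂ)) (oneS : Sch d 0) φ δ
  | succ k ih =>
    have hcons := (hasGateauxDeriv_linearMap LinearMap.id φ δ).bilinear
      (LinearMap.restrictScalars₁₂ ℝ ℝ consTensor) continuous_consTensor ih
      (isCk_tensorPow k 0).continuous
    rw [map_sum] at hcons
    rw [Fin.sum_univ_succ, insertPow_zero]
    simp only [← consTensor_insertPow]
    exact hcons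

theorem hasGateauxDeriv_conj_tensorPow (k : ℕ) (φ δ : 𝓢(Pt d, ℂ)) :
    HasGateauxDeriv (fun φ : 𝓢(Pt d, ℂ) => conjS (tensorPow φ k)) φ δ
      (∑ α, conjS (insertPow φ α δ)) := by
  have hconj := (hasGateauxDeriv_tensorPow k φ δ).clm_comp (conjCLM _)
  rwa [map_sum] at hconj

variable (d) in
theorem isClosed_GInfStar : IsClosed (GInfStar d : Set (∀ n, Ker d (n + 1))) := by
  have hcont (n : ℕ) (p : Conf d (n + 1) × Conf d (n + 1)) :
      Continuous fun Γ : ∀ n, Ker d (n + 1) => Γ n p :=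
    (evalAt p).continuous.comp (continuous_apply n)
  simp only [GInfStar, Submodule.coe_set_mk, AddSubmonoid.coe_set_mk, AddSubsemigroup.coe_set_mk,
    Set.ofPred_forall, Set.ofPred_and]
  refine isClosed_iInter fun n => isClosed_iInter fun x => isClosed_iInter fun x' => ?_
  refine (isClosed_iInter fun π => ?_).inter
    (isClosed_eq (hcont n _) (Complex.continuous_conj.comp (hcont n _)))
  exact (isClosed_eq (hcont n _) (hcont n _)).inter (isClosed_eq (hcont n _) (hcont n _))

theorem isCk_iota (n : ℕ) : IsCk n (iota (d := d)) :=
  IsCk.codRestrict (isClosed_GInfStar d) (isCk_pi fun m =>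
    IsCk.bilinear (LinearMap.restrictScalars₁₂ ℝ ℝ (tensorLM _ _)) (continuous_tensor _ _)
      (isCk_tensorPow (m + 1) n) (isCk_conj_tensorPow (m + 1) n))

end Smooth

/-! ### The symplectic form -/

section Symplectic

theorem conjS_conjS {E : Type*} [NormedAddCommGroup E] [NormedSpace ℝ E] (f : 𝓢(E, ℂ)) :
    conjS (conjS f) = f := by
  ext x
  simp only [conjS_apply, Complex.conj_conj]

variable {E : Type*} [NormedAddCommGroup E] [NormedSpace ℝ E] [SecondCountableTopology E]
  [MeasureSpace E] [BorelSpace E] [(volume : Measure E).HasTemperateGrowth]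

/-- The bilinear pairing `⟨f, g⟩ = ∫ f g`. -/
def integralPairing : 𝓢(E, ℂ) →ₗ[ℂ] 𝓢(E, ℂ) →ₗ[ℂ] ℂ :=
  (ContinuousLinearMap.coeLM ℂ ∘ₗ SchwartzMap.pairing (ContinuousLinearMap.mul ℂ ℂ)).compr₂
    (SchwartzMap.integralCLM ℂ volume).toLinearMap

theorem integralPairing_apply (f g : 𝓢(E, ℂ)) : integralPairing f g = ∫ x, f x * g x := by
  simp [integralPairing]

theorem integralPairing_comm (f g : 𝓢(E, ℂ)) : integralPairing f g = integralPairing g f := by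
  simp only [integralPairing_apply, mul_comm]

theorem integralPairing_conjS_conjS (f g : 𝓢(E, ℂ)) :
    integralPairing (conjS f) (conjS g) = (starRingEnd ℂ) (integralPairing f g) := by
  simp only [integralPairing_apply, conjS_apply, ← map_mul, integral_conj]

variable {d : ℕ}

/-- The symplectic form as a real bilinear map. -/
def omegaLM (d : ℕ) : 𝓢(Pt d, ℂ) →ₗ[ℝ] 𝓢(Pt d, ℂ) →ₗ[ℝ] ℝ :=
  (((LinearMap.restrictScalars₁₂ ℝ ℝ integralPairing).comp (conjCLM (Pt d)).toLinearMap).compr₂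
    ((2 : ℝ) • Complex.imLm))

theorem omegaL2_eq (f g : 𝓢(Pt d, ℂ)) : omegaL2 f g = 2 * (integralPairing (conjS f) g).im := by
  simp only [omegaL2, integralPairing_apply, conjS_apply]

theorem omegaLM_apply (f g : 𝓢(Pt d, ℂ)) : omegaLM d f g = omegaL2 f g :=
  (omegaL2_eq f g).symm

theorem ofReal_omegaL2 (f g : 𝓢(Pt d, ℂ)) : (omegaL2 f g : ℂ) =
    Complex.I * (integralPairing f (conjS g) - integralPairing (conjS f) g) := by
  have hconj : integralPairing f (conjS g) = (starRingEnd ℂ) (integralPairing (conjS f) g) := by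
    rw [← integralPairing_conjS_conjS, conjS_conjS]
  rw [hconj, ← neg_sub, Complex.sub_conj, omegaL2_eq]
  push_cast
  linear_combination (2 * ((integralPairing (conjS f) g).im : ℂ)) * Complex.I_mul_I

theorem eq_of_forall_omegaL2_eq {f g : 𝓢(Pt d, ℂ)} (h : ∀ δ, omegaL2 f δ = omegaL2 g δ) :
    f = g := by
  have him (δ : 𝓢(Pt d, ℂ)) :
      (integralPairing (conjS f) δ).im = (integralPairing (conjS g) δ).im := by
    simpa [omegaL2_eq] using h δ
  have hpair (δ : 𝓢(Pt d, ℂ)) : integralPairing (conjS f) δ = integralPairing (conjS g) δ :=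
    Complex.ext (by simpa using him (Complex.I • δ)) (him δ)
  have hconj : conjS f = conjS g := eq_of_forall_integral_mul_eq (μ := volume) fun δ => by
    rw [← integralPairing_apply, ← integralPairing_apply, hpair]
  rw [← conjS_conjS f, hconj, conjS_conjS]

end Symplectic

/-! ### One-body functions of observables -/

section OneBody

variable {d k n : ℕ}

open scoped Classical in
/-- The one-body function of `A` at `φ`: the Schwartz function `u` with
`⟨A φ^{⊗(n+1)}, ψ ⊗ conj(φ)^{⊗n}⟩ = ∫ u ψ`. For observables, `(n+1) u` is the symplectic gradient of
`i ⟨A φ^{⊗(n+1)}, conj(φ)^{⊗(n+1)}⟩`. -/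
def oneBody (A : DVO d (n + 1)) (φ : 𝓢(Pt d, ℂ)) : 𝓢(Pt d, ℂ) :=
  if h : ∃ u, ∀ ψ, A (tensorPow φ (n + 1)) (insertPow (conjS φ) 0 ψ) = integralPairing u ψ
  then h.choose else 0

theorem oneBody_eq {A : DVO d (n + 1)} {φ u : 𝓢(Pt d, ℂ)}
    (h : ∀ ψ, A (tensorPow φ (n + 1)) (insertPow (conjS φ) 0 ψ) = integralPairing u ψ) :
    oneBody A φ = u := by
  have hex : ∃ u, ∀ ψ,
      A (tensorPow φ (n + 1)) (insertPow (conjS φ) 0 ψ) = integralPairing u ψ := ⟨u, h⟩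
  rw [oneBody, dif_pos hex]
  refine eq_of_forall_integral_mul_eq (μ := volume) fun ψ => ?_
  rw [← integralPairing_apply, ← integralPairing_apply, ← hex.choose_spec ψ, h ψ]

theorem HasGMP.exists_oneBody {A : DVO d (n + 1)} (hA : HasGMP A) :
    ∃ X : 𝓢(Pt d, ℂ) → 𝓢(Pt d, ℂ), (∀ m, IsCk m X) ∧ ∀ φ ψ,
      A (tensorPow φ (n + 1)) (insertPow (conjS φ) 0 ψ) = integralPairing (X φ) ψ := by
  obtain ⟨Φ, hΦcont, hΦ⟩ := hA 0
  obtain ⟨θ, hθ⟩ := exists_schwartz_apply_eq_one (0 : Pt d)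
  refine ⟨fun φ => slice 0 (Φ (tensorPow φ (n + 1)) (consTensor θ (conjS (tensorPow φ n)))),
    fun m => ?_, fun φ ψ => ?_⟩
  · have hcons : IsCk m fun φ : 𝓢(Pt d, ℂ) => consTensor θ (conjS (tensorPow φ n)) :=
      IsCk.bilinear (LinearMap.restrictScalars₁₂ ℝ ℝ consTensor) continuous_consTensor
        (isCk_const m θ) (isCk_conj_tensorPow n m)
    exact (IsCk.bilinear (LinearMap.restrictScalars₁₂ ℝ ℝ Φ) hΦcont (isCk_tensorPow _ m)
      hcons).clm_comp ((slice (0 : Pt d)).restrictScalars ℝ)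
  · simp only [integralPairing_apply, slice_apply]
    rw [← hΦ, slot_zero_consTensor, hθ, one_smul, insertPow_zero, conjS_tensorPow]

theorem HasGMP.apply_tensorPow_insertPow_zero {A : DVO d (n + 1)} (hA : HasGMP A)
    (φ ψ : 𝓢(Pt d, ℂ)) :
    A (tensorPow φ (n + 1)) (insertPow (conjS φ) 0 ψ) = integralPairing (oneBody A φ) ψ := by
  obtain ⟨X, -, hX⟩ := hA.exists_oneBody
  rw [oneBody_eq (hX φ), hX]

theorem HasGMP.isCk_oneBody {A : DVO d (n + 1)} (hA : HasGMP A) (m : ℕ) : IsCk m (oneBody A) := by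
  obtain ⟨X, hXsmooth, hX⟩ := hA.exists_oneBody
  rw [show oneBody A = X from funext fun φ => oneBody_eq (hX φ)]
  exact hXsmooth m

theorem oneBody_zero (φ : 𝓢(Pt d, ℂ)) : oneBody (0 : DVO d (n + 1)) φ = 0 :=
  oneBody_eq fun ψ => by simp

theorem oneBody_add {A B : DVO d (n + 1)} (hA : HasGMP A) (hB : HasGMP B) (φ : 𝓢(Pt d, ℂ)) :
    oneBody (A + B) φ = oneBody A φ + oneBody B φ :=
  oneBody_eq fun ψ => by
    simp only [add_apply, hA.apply_tensorPow_insertPow_zero, hB.apply_tensorPow_insertPow_zero,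
      map_add, LinearMap.add_apply]

theorem oneBody_smul {A : DVO d (n + 1)} (hA : HasGMP A) (c : ℂ) (φ : 𝓢(Pt d, ℂ)) :
    oneBody (c • A) φ = c • oneBody A φ :=
  oneBody_eq fun ψ => by
    simp only [smul_apply, hA.apply_tensorPow_insertPow_zero, map_smul, LinearMap.smul_apply]

theorem IsObservable.apply_tensorPow_insertPow {A : DVO d (n + 1)} (hA : IsObservable A)
    (φ ψ : 𝓢(Pt d, ℂ)) (α : Fin (n + 1)) :
    A (tensorPow φ (n + 1)) (insertPow (conjS φ) α ψ) = integralPairing (oneBody A φ) ψ := by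
  rw [← hA.gmp.apply_tensorPow_insertPow_zero,
    ← hA.symm_left (Equiv.swap 0 α) _ (insertPow _ 0 ψ), permS_insertPow, Equiv.swap_apply_left]

theorem IsObservable.apply_insertPow_tensorPow {A : DVO d (n + 1)} (hA : IsObservable A)
    (φ ψ : 𝓢(Pt d, ℂ)) (α : Fin (n + 1)) :
    A (insertPow φ α ψ) (conjS (tensorPow φ (n + 1))) =
      -integralPairing (conjS (oneBody A φ)) ψ := by
  rw [hA.skew, conjS_insertPow, hA.apply_tensorPow_insertPow, ← integralPairing_conjS_conjS,
    conjS_conjS]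

theorem isCk_expectation (A : DVO d k) (m : ℕ) :
    IsCk m fun φ : 𝓢(Pt d, ℂ) => A (tensorPow φ k) (conjS (tensorPow φ k)) :=
  IsCk.bilinear (LinearMap.restrictScalars₁₂ ℝ ℝ A.toLinearMap₁₂) (continuous_uncurry_of_clm A)
    (isCk_tensorPow k m) (isCk_conj_tensorPow k m)

theorem IsObservable.hasGateauxDeriv_expectation {A : DVO d (n + 1)} (hA : IsObservable A)
    (φ δ : 𝓢(Pt d, ℂ)) :
    HasGateauxDeriv
      (fun φ => Complex.I * A (tensorPow φ (n + 1)) (conjS (tensorPow φ (n + 1)))) φ δ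
      (omegaL2 (((n : ℝ) + 1) • oneBody A φ) δ : ℂ) := by
  have hderiv := ((hasGateauxDeriv_tensorPow (n + 1) φ δ).bilinear
    (LinearMap.restrictScalars₁₂ ℝ ℝ A.toLinearMap₁₂) (continuous_uncurry_of_clm A)
    (hasGateauxDeriv_conj_tensorPow (n + 1) φ δ)
    (isCk_conj_tensorPow (n + 1) 0).continuous).clm_comp (ContinuousLinearMap.mul ℝ ℂ Complex.I)
  refine (congrArg (HasGateauxDeriv _ φ δ) ?_).mpr hderiv
  rw [← omegaLM_apply, map_smul, LinearMap.smul_apply, omegaLM_apply, smul_eq_mul,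
    Complex.ofReal_mul, ofReal_omegaL2]
  simp [hA.apply_insertPow_tensorPow, conjS_insertPow, hA.apply_tensorPow_insertPow]
  ring

end OneBody

/-! ### Observable hierarchies -/

section Hierarchies

variable {d k : ℕ}

theorem HasGMP.add {A B : DVO d k} (hA : HasGMP A) (hB : HasGMP B) : HasGMP (A + B) := by
  intro α
  obtain ⟨Φ, hΦcont, hΦ⟩ := hA α
  obtain ⟨Ψ, hΨcont, hΨ⟩ := hB α
  refine ⟨Φ + Ψ, hΦcont.add hΨcont, fun f g φ x' => ?_⟩
  have hadd := LinearMap.map_add₂ integralPairing (slice x' (Φ f g)) (slice x' (Ψ f g)) φ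
  simp only [integralPairing_apply] at hadd
  rw [add_apply, add_apply, hΦ, hΨ]
  exact hadd.symm

theorem HasGMP.smul {A : DVO d k} (hA : HasGMP A) (c : ℂ) : HasGMP (c • A) := by
  intro α
  obtain ⟨Φ, hΦcont, hΦ⟩ := hA α
  refine ⟨c • Φ, hΦcont.const_smul c, fun f g φ x' => ?_⟩
  have hsmul := LinearMap.map_smul₂ integralPairing c (slice x' (Φ f g)) φ
  simp only [integralPairing_apply] at hsmul
  rw [smul_apply, smul_apply, hΦ]
  exact hsmul.symm

theorem IsObservable.add {A B : DVO d k} (hA : IsObservable A) (hB : IsObservable B) :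
    IsObservable (A + B) where
  gmp := hA.gmp.add hB.gmp
  symm_right π f g := by simp [hA.symm_right, hB.symm_right]
  symm_left π f g := by simp [hA.symm_left, hB.symm_left]
  skew f g := by simp only [add_apply, map_add, hA.skew f g, hB.skew f g, neg_add]

theorem IsObservable.smul {A : DVO d k} (hA : IsObservable A) (c : ℝ) :
    IsObservable ((c : ℂ) • A) where
  gmp := hA.gmp.smul c
  symm_right π f g := by simp [hA.symm_right]
  symm_left π f g := by simp [hA.symm_left]
  skew f g := by
    simp only [smul_apply, smul_eq_mul, map_mul, Complex.conj_ofReal, hA.skew f g, mul_neg]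

theorem isObservable_zero : IsObservable (0 : DVO d k) where
  gmp _ := ⟨0, continuous_const, fun f g φ x' => by simp⟩
  symm_right π f g := by simp
  symm_left π f g := by simp
  skew f g := by simp

variable {A B : ∀ n, DVO d (n + 1)}

theorem zero_mem_GInf : (0 : ∀ n, DVO d (n + 1)) ∈ GInf d :=
  ⟨fun _ => isObservable_zero, by simp⟩

theorem add_mem_GInf (hA : A ∈ GInf d) (hB : B ∈ GInf d) : A + B ∈ GInf d :=
  ⟨fun n => (hA.1 n).add (hB.1 n), (hA.2.union hB.2).subset fun n hn => by
    by_contra hzero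
    simp only [Set.mem_union, Set.mem_ofPred_eq, not_or, not_not] at hzero
    exact hn (by
      ext f g
      rw [Pi.add_apply, add_apply, add_apply, hzero.1, hzero.2]
      exact add_zero (0 : ℂ))⟩

theorem smul_mem_GInf (c : ℝ) (hA : A ∈ GInf d) : (c : ℂ) • A ∈ GInf d :=
  ⟨fun n => (hA.1 n).smul c, hA.2.subset fun n hn h => hn (by
    ext f g
    simp only [Pi.smul_apply, smul_apply, h, zero_apply, smul_zero])⟩

section FiniteSupport

variable {M : Type*} [AddCommMonoid M] {F : ∀ n, DVO d (n + 1) → M}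

theorem hasFiniteSupport_of_mem_GInf (hA : A ∈ GInf d) (hF : ∀ n, F n 0 = 0) :
    (fun n => F n (A n)).HasFiniteSupport :=
  hA.2.subset fun n hn h => hn (by simp only [h, hF])

theorem finsum_eq_sum_of_mem_GInf (hA : A ∈ GInf d) (hF : ∀ n, F n 0 = 0) :
    ∑ᶠ n, F n (A n) = ∑ n ∈ hA.2.toFinset, F n (A n) :=
  finsum_eq_sum_of_support_subset _ fun n hn => by
    simpa using fun h : A n = 0 => hn (by simp only [h, hF])

end FiniteSupport

theorem genTrace_zero (γ : Ker d k) : genTrace 0 γ = 0 := by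
  rw [genTrace, schwartzKernel_zero, zero_apply]

theorem genTrace_iota {n : ℕ} (A : DVO d (n + 1)) (φ : 𝓢(Pt d, ℂ)) :
    genTrace A ((iota φ).1 n) = A (tensorPow φ (n + 1)) (conjS (tensorPow φ (n + 1))) :=
  genTrace_tensor A _ _

theorem traceHier_zero (Γ : GInfStar d) : traceHier 0 Γ = 0 := by
  simp [traceHier, genTrace_zero]

theorem traceHier_add (hA : A ∈ GInf d) (hB : B ∈ GInf d) (Γ : GInfStar d) :
    traceHier (A + B) Γ = traceHier A Γ + traceHier B Γ := by
  let F (n : ℕ) (C : DVO d (n + 1)) : ℂ := genTrace C (Γ.1 n)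
  have hF (n : ℕ) : F n 0 = 0 := genTrace_zero (Γ.1 n)
  simp only [traceHier, Pi.add_apply, genTrace, schwartzKernel_add, add_apply]
  exact finsum_add_distrib
    (hasFiniteSupport_of_mem_GInf (F := F) hA hF) (hasFiniteSupport_of_mem_GInf (F := F) hB hF)

theorem traceHier_smul (c : ℂ) (A : ∀ n, DVO d (n + 1)) (Γ : GInfStar d) :
    traceHier (c • A) Γ = c * traceHier A Γ := by
  simp only [traceHier, Pi.smul_apply, genTrace, schwartzKernel_smul, smul_apply]
  rw [← smul_finsum, smul_eq_mul]

theorem hasGateauxDeriv_trace (hA : A ∈ GInf d) (Γ v : GInfStar d) :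
    HasGateauxDeriv (fun Γ => Complex.I * traceHier A Γ) Γ v (Complex.I * traceHier A v) := by
  let L (n : ℕ) : GInfStar d →ₗ[ℝ] ℂ :=
    (((schwartzKernel (A n)).comp transposeCLM).toLinearMap.restrictScalars ℝ) ∘ₗ
      LinearMap.proj n ∘ₗ (GInfStar d).subtype
  have hL (Γ : GInfStar d) : traceHier A Γ = (∑ n ∈ hA.2.toFinset, L n) Γ := by
    rw [LinearMap.sum_apply]
    exact finsum_eq_sum_of_mem_GInf (F := fun n C => genTrace C (Γ.1 n)) hA
      fun n => genTrace_zero (Γ.1 n)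
  simp only [hL]
  exact (hasGateauxDeriv_linearMap _ Γ v).clm_comp (ContinuousLinearMap.mul ℝ ℂ Complex.I)

/-- The symplectic gradient at `φ` of `φ ↦ i Tr(A · ι(φ))`. -/
def gradField (A : ∀ n, DVO d (n + 1)) (φ : 𝓢(Pt d, ℂ)) : 𝓢(Pt d, ℂ) :=
  ∑ᶠ n : ℕ, ((n : ℝ) + 1) • oneBody (A n) φ

theorem hasFiniteSupport_smul_oneBody (hA : A ∈ GInf d) (φ : 𝓢(Pt d, ℂ)) :
    (fun n : ℕ => ((n : ℝ) + 1) • oneBody (A n) φ).HasFiniteSupport :=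
  hasFiniteSupport_of_mem_GInf (F := fun n C => ((n : ℝ) + 1) • oneBody C φ) hA fun n => by
    rw [oneBody_zero, smul_zero]

theorem gradField_zero (φ : 𝓢(Pt d, ℂ)) : gradField 0 φ = 0 := by
  simp [gradField, oneBody_zero]

theorem gradField_add (hA : A ∈ GInf d) (hB : B ∈ GInf d) (φ : 𝓢(Pt d, ℂ)) :
    gradField (A + B) φ = gradField A φ + gradField B φ := by
  simp only [gradField, Pi.add_apply, oneBody_add (hA.1 _).gmp (hB.1 _).gmp, smul_add]
  exact finsum_add_distrib (hasFiniteSupport_smul_oneBody hA φ) (hasFiniteSupport_smul_oneBody hB φ)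

theorem gradField_smul (hA : A ∈ GInf d) (c : ℂ) (φ : 𝓢(Pt d, ℂ)) :
    gradField (c • A) φ = c • gradField A φ := by
  simp only [gradField, Pi.smul_apply, oneBody_smul (hA.1 _).gmp, smul_comm _ c, smul_finsum]

theorem gradField_eq_sum (hA : A ∈ GInf d) (φ : 𝓢(Pt d, ℂ)) :
    gradField A φ = ∑ n ∈ hA.2.toFinset, ((n : ℝ) + 1) • oneBody (A n) φ :=
  finsum_eq_sum_of_mem_GInf (F := fun n A => ((n : ℝ) + 1) • oneBody A φ) hA fun n => by
    rw [oneBody_zero, smul_zero]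

theorem isCk_gradField (hA : A ∈ GInf d) (m : ℕ) : IsCk m (gradField A) := by
  rw [funext (gradField_eq_sum hA)]
  exact IsCk.sum _ fun n _ => ((hA.1 n).gmp.isCk_oneBody m).clm_comp
    (((n : ℝ) + 1) • ContinuousLinearMap.id ℝ 𝓢(Pt d, ℂ))

theorem trace_iota_eq_sum (hA : A ∈ GInf d) (φ : 𝓢(Pt d, ℂ)) :
    Complex.I * traceHier A (iota φ) = ∑ n ∈ hA.2.toFinset,
      Complex.I * A n (tensorPow φ (n + 1)) (conjS (tensorPow φ (n + 1))) := by
  have hsum : traceHier A (iota φ) = ∑ n ∈ hA.2.toFinset, genTrace (A n) ((iota φ).1 n) :=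
    finsum_eq_sum_of_mem_GInf (F := fun n C => genTrace C ((iota φ).1 n)) hA
      fun n => genTrace_zero _
  simp only [hsum, Finset.mul_sum, genTrace_iota]

theorem isCk_trace_iota (hA : A ∈ GInf d) (m : ℕ) :
    IsCk m fun φ : 𝓢(Pt d, ℂ) => Complex.I * traceHier A (iota φ) := by
  simp only [trace_iota_eq_sum hA]
  exact IsCk.sum _ fun n _ =>
    (isCk_expectation (A n) m).clm_comp (ContinuousLinearMap.mul ℝ ℂ Complex.I)

theorem hasGateauxDeriv_trace_iota (hA : A ∈ GInf d) (φ δ : 𝓢(Pt d, ℂ)) :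
    HasGateauxDeriv (fun φ : 𝓢(Pt d, ℂ) => Complex.I * traceHier A (iota φ)) φ δ
      (omegaL2 (gradField A φ) δ : ℂ) := by
  simp only [trace_iota_eq_sum hA]
  rw [gradField_eq_sum hA, ← omegaLM_apply, map_sum, LinearMap.sum_apply, Complex.ofReal_sum]
  simp only [omegaLM_apply]
  exact HasGateauxDeriv.sum _ fun n _ => (hA.1 n).hasGateauxDeriv_expectation φ δ

theorem gradField_congr (hA : A ∈ GInf d) (hB : B ∈ GInf d)
    (h : ∀ Γ, traceHier A Γ = traceHier B Γ) (φ : 𝓢(Pt d, ℂ)) : gradField A φ = gradField B φ := by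
  refine eq_of_forall_omegaL2_eq fun δ => ?_
  have hB' := hasGateauxDeriv_trace_iota hB φ δ
  simp only [← h] at hB'
  exact Complex.ofReal_injective ((hasGateauxDeriv_trace_iota hA φ δ).unique hB')

end Hierarchies

/-! ### Functionals with a symplectic gradient -/

section Gradient

section Product

variable {X : Type*} [AddCommGroup X] [Module ℝ X]

theorem hasGateauxDeriv_iff_hasDerivAt {Y : Type*} [NormedAddCommGroup Y] [NormedSpace ℝ Y]
    {f : X → Y} {x v : X} {y : Y} :
    HasGateauxDeriv f x v y ↔ HasDerivAt (fun t : ℝ => f (x + t • v)) y 0 := by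
  simp [HasGateauxDeriv, hasDerivAt_iff_tendsto_slope_zero]

theorem HasGateauxDeriv.mul {𝔸 : Type*} [NormedRing 𝔸] [NormedAlgebra ℝ 𝔸] {f g : X → 𝔸}
    {x v : X} {a b : 𝔸} (hf : HasGateauxDeriv f x v a) (hg : HasGateauxDeriv g x v b) :
    HasGateauxDeriv (fun x => f x * g x) x v (a * g x + f x * b) := by
  rw [hasGateauxDeriv_iff_hasDerivAt] at hf hg ⊢
  have hmul := hf.mul hg
  rw [zero_smul, add_zero] at hmul
  exact hmul

end Product

variable {d : ℕ} {F G : GInfStar d → ℝ} {X Y : 𝓢(Pt d, ℂ) → 𝓢(Pt d, ℂ)}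

/-- `F ∘ ι` is smooth with the smooth symplectic gradient `X`, and at every `ι(φ)` the derivative of
`F` is represented by a hierarchy whose gradient field takes the value `X φ` at `φ`. -/
structure HasGradient (F : GInfStar d → ℝ) (X : 𝓢(Pt d, ℂ) → 𝓢(Pt d, ℂ)) : Prop where
  isCk_comp_iota : ∀ m, IsCk m (F ∘ iota)
  isCk_gradient : ∀ m, IsCk m X
  hasGateauxDeriv : ∀ φ δ, HasGateauxDeriv (F ∘ iota) φ δ (omegaL2 (X φ) δ)
  exists_hierarchy : ∀ φ, ∃ D ∈ GInf d,
    (∀ v, HasGateauxDeriv (fun Γ => (F Γ : ℂ)) (iota φ) v (Complex.I * traceHier D v)) ∧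
      gradField D φ = X φ

theorem hasGradient_trace {A : ∀ n, DVO d (n + 1)} (hA : A ∈ GInf d)
    (hF : ∀ Γ, (F Γ : ℂ) = Complex.I * traceHier A Γ) : HasGradient F (gradField A) := by
  have hcomp : F ∘ iota = fun φ => Complex.reCLM (Complex.I * traceHier A (iota φ)) := by
    funext φ
    rw [← hF, Complex.reCLM_apply, Complex.ofReal_re, Function.comp_apply]
  refine ⟨fun m => ?_, isCk_gradField hA, fun φ δ => ?_, fun φ => ⟨A, hA, fun v => ?_, rfl⟩⟩
  · exact hcomp ▸ (isCk_trace_iota hA m).clm_comp Complex.reCLM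
  · exact hcomp ▸ (hasGateauxDeriv_trace_iota hA φ δ).clm_comp Complex.reCLM
  · simpa only [hF] using hasGateauxDeriv_trace hA (iota φ) v

theorem hasGradient_const (c : ℝ) : HasGradient (d := d) (fun _ => c) 0 where
  isCk_comp_iota m := isCk_const m c
  isCk_gradient m := isCk_const m 0
  hasGateauxDeriv φ δ := by
    rw [Pi.zero_apply, ← omegaLM_apply, map_zero, LinearMap.zero_apply]
    exact hasGateauxDeriv_const c φ δ
  exists_hierarchy φ := by
    refine ⟨0, zero_mem_GInf, fun v => ?_, gradField_zero φ⟩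
    rw [traceHier_zero, mul_zero]
    exact hasGateauxDeriv_const (c : ℂ) (iota φ) v

theorem HasGradient.add (hF : HasGradient F X) (hG : HasGradient G Y) :
    HasGradient (F + G) (X + Y) where
  isCk_comp_iota m := (hF.isCk_comp_iota m).add (hG.isCk_comp_iota m)
  isCk_gradient m := (hF.isCk_gradient m).add (hG.isCk_gradient m)
  hasGateauxDeriv φ δ := by
    rw [Pi.add_apply, ← omegaLM_apply, map_add, LinearMap.add_apply]
    exact (hF.hasGateauxDeriv φ δ).add (hG.hasGateauxDeriv φ δ)
  exists_hierarchy φ := by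
    obtain ⟨D, hD, hDF, hDX⟩ := hF.exists_hierarchy φ
    obtain ⟨E, hE, hEG, hEY⟩ := hG.exists_hierarchy φ
    refine ⟨D + E, add_mem_GInf hD hE, fun v => ?_, ?_⟩
    · simp only [traceHier_add hD hE, mul_add, Pi.add_apply, Complex.ofReal_add]
      exact (hDF v).add (hEG v)
    · rw [gradField_add hD hE, hDX, hEY, Pi.add_apply]

theorem HasGradient.mul (hF : HasGradient F X) (hG : HasGradient G Y) :
    HasGradient (F * G) fun φ => F (iota φ) • Y φ + G (iota φ) • X φ where
  isCk_comp_iota m := IsCk.bilinear (LinearMap.mul ℝ ℝ) continuous_mul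
    (hF.isCk_comp_iota m) (hG.isCk_comp_iota m)
  isCk_gradient m :=
    (IsCk.bilinear (LinearMap.lsmul ℝ 𝓢(Pt d, ℂ)) continuous_smul
      (hF.isCk_comp_iota m) (hG.isCk_gradient m)).add
    (IsCk.bilinear (LinearMap.lsmul ℝ 𝓢(Pt d, ℂ)) continuous_smul
      (hG.isCk_comp_iota m) (hF.isCk_gradient m))
  hasGateauxDeriv φ δ := by
    refine (congrArg (HasGateauxDeriv _ φ δ) ?_).mpr
      ((hF.hasGateauxDeriv φ δ).mul (hG.hasGateauxDeriv φ δ))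
    simp only [← omegaLM_apply, map_add, map_smul, LinearMap.add_apply, LinearMap.smul_apply,
      smul_eq_mul, Function.comp_apply]
    ring
  exists_hierarchy φ := by
    obtain ⟨D, hD, hDF, hDX⟩ := hF.exists_hierarchy φ
    obtain ⟨E, hE, hEG, hEY⟩ := hG.exists_hierarchy φ
    have hFE := smul_mem_GInf (F (iota φ)) hE
    have hGD := smul_mem_GInf (G (iota φ)) hD
    refine ⟨_, add_mem_GInf hFE hGD, fun v => ?_, ?_⟩
    · simp only [traceHier_add hFE hGD, traceHier_smul, Pi.mul_apply, Complex.ofReal_mul]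
      refine (congrArg (HasGateauxDeriv _ (iota φ) v) ?_).mpr ((hDF v).mul (hEG v))
      ring
    · rw [gradField_add hFE hGD, gradField_smul hE, gradField_smul hD, hDX, hEY]
      rfl

theorem exists_hasGradient (hF : F ∈ AInf d) : ∃ X, HasGradient F X := by
  induction hF using Algebra.adjoin_induction with
  | mem F hF =>
    rcases hF with ⟨-, A, hA, hFA⟩ | ⟨-, c, hFc⟩
    · exact ⟨_, hasGradient_trace hA hFA⟩
    · obtain rfl : F = fun _ => c := funext hFc
      exact ⟨_, hasGradient_const c⟩
  | algebraMap c => exact ⟨_, hasGradient_const c⟩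
  | add F G _ _ hF hG => exact ⟨_, hF.choose_spec.add hG.choose_spec⟩
  | mul F G _ _ hF hG => exact ⟨_, hF.choose_spec.mul hG.choose_spec⟩

theorem HasGradient.comp_iota_mem_AS (h : HasGradient F X) : F ∘ iota ∈ AS d :=
  ⟨isSmooth_of_forall_isCk h.isCk_comp_iota, X, isSmooth_of_forall_isCk h.isCk_gradient,
    h.hasGateauxDeriv⟩

theorem HasGradient.symGrad_comp_iota (h : HasGradient F X) (φ : 𝓢(Pt d, ℂ)) :
    symGrad (F ∘ iota) φ = X φ := by
  have hex : ∃ g : 𝓢(Pt d, ℂ), ∀ δ, HasGateauxDeriv (F ∘ iota) φ δ (omegaL2 g δ) :=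
    ⟨X φ, h.hasGateauxDeriv φ⟩
  rw [symGrad, dif_pos hex]
  exact eq_of_forall_omegaL2_eq fun δ => (hex.choose_spec δ).unique (h.hasGateauxDeriv φ δ)

theorem diffRep_spec {Γ : GInfStar d} (h : ∃ D ∈ GInf d, ∀ v,
      HasGateauxDeriv (fun Γ => (F Γ : ℂ)) Γ v (Complex.I * traceHier D v)) :
    diffRep F Γ ∈ GInf d ∧ ∀ v,
      HasGateauxDeriv (fun Γ => (F Γ : ℂ)) Γ v (Complex.I * traceHier (diffRep F Γ) v) := by
  rw [diffRep, dif_pos h]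
  exact h.choose_spec

theorem HasGradient.diffRep_mem_GInf (h : HasGradient F X) (φ : 𝓢(Pt d, ℂ)) :
    diffRep F (iota φ) ∈ GInf d :=
  let ⟨D, hD, hDF, _⟩ := h.exists_hierarchy φ
  (diffRep_spec ⟨D, hD, hDF⟩).1

theorem HasGradient.gradField_diffRep (h : HasGradient F X) (φ : 𝓢(Pt d, ℂ)) :
    gradField (diffRep F (iota φ)) φ = X φ := by
  obtain ⟨D, hD, hDF, hDX⟩ := h.exists_hierarchy φ
  obtain ⟨hmem, hderiv⟩ := diffRep_spec ⟨D, hD, hDF⟩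
  rw [← hDX]
  exact gradField_congr hmem hD
    (fun v => mul_left_cancel₀ Complex.I_ne_zero ((hderiv v).unique (hDF v))) φ

end Gradient

/-! ### The bracket of hierarchies on product states -/

section Bracket

variable {d a b n : ℕ}

theorem freeze_tensorPow (h : a + b = n) (α : Fin (a + 1)) (β : Fin (b + 1))
    (x : Conf d (a + 1)) (φ : 𝓢(Pt d, ℂ)) :
    freeze h α β x (tensorPow φ (n + 1)) =
      (∏ j, φ (x (α.succAbove j))) • tensorPow φ (b + 1) := by
  subst h
  ext y
  let g (i : Fin (a + b + 1)) : ℂ := φ (glue rfl α β x y i)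
  have hsplit : ∏ i, g i =
      (∏ i : Fin (a + 1), g (Fin.cast (by omega) (Fin.castAdd b i))) *
        ∏ j : Fin b, g (Fin.cast (by omega) (Fin.natAdd (a + 1) j)) := by
    rw [← Fin.prod_univ_add fun i : Fin (a + 1 + b) => g (Fin.cast (by omega) i)]
    exact (Equiv.prod_comp (finCongr (by omega : a + 1 + b = a + b + 1)) g).symm
  have hshared : g (Fin.cast (by omega) (Fin.castAdd b α)) = φ (y β) := by
    simp [g, glue, Nat.lt_succ_iff.1 α.2]
  have hfrozen (j : Fin a) :
      g (Fin.cast (by omega) (Fin.castAdd b (α.succAbove j))) = φ (x (α.succAbove j)) := by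
    simp [g, glue, Fin.succAbove_ne, Nat.lt_succ_iff.1 (α.succAbove j).2]
  have hfree (j : Fin b) :
      g (Fin.cast (by omega) (Fin.natAdd (a + 1) j)) = φ (y (β.succAbove j)) := by
    simp [g, glue, show ¬a + 1 + (j : ℕ) ≤ a by omega]
  rw [freeze_apply, tensorPow_apply, smul_apply, tensorPow_apply, smul_eq_mul, hsplit,
    Fin.prod_univ_succAbove _ α, Fin.prod_univ_succAbove (fun j => φ (y j)) β]
  simp only [hshared, hfrozen, hfree]
  ring

theorem IsObservable.partialKernel_tensorPow {B : DVO d (b + 1)} (hB : IsObservable B)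
    (β : Fin (b + 1)) (φ : 𝓢(Pt d, ℂ)) (c c' : ℂ) :
    partialKernel B β (c • tensorPow φ (b + 1)) (c' • tensorPow (conjS φ) (b + 1)) =
      (c * c') • tensor (oneBody B φ) (conjS φ) := by
  refine partialKernel_eq fun ψ x' => ?_
  have hslot : slot β ψ (c' • tensorPow (conjS φ) (b + 1)) x' =
      (c' * conjS φ x') • insertPow (conjS φ) β ψ := by
    rw [mul_smul, ← slot_tensorPow]
    ext y
    simp only [slot_apply, smul_apply, smul_eq_mul, mul_left_comm]
  rw [hslot, map_smul, map_smul, smul_apply, hB.apply_tensorPow_insertPow, integralPairing_apply,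
    smul_eq_mul, smul_eq_mul, ← integral_const_mul, ← integral_const_mul]
  congr with x
  simp only [smul_apply, tensor_apply, smul_eq_mul]
  ring

theorem IsObservable.contrKernel_tensorPow (h : a + b = n) {B : DVO d (b + 1)}
    (hB : IsObservable B) (α : Fin (a + 1)) (β : Fin (b + 1)) (φ : 𝓢(Pt d, ℂ)) :
    contrKernel h B α β (tensorPow φ (n + 1)) (conjS (tensorPow φ (n + 1))) =
      tensor (insertPow φ α (oneBody B φ)) (conjS (tensorPow φ (a + 1))) := by
  refine contrKernel_eq h fun x x' => ?_
  simp only [conjS_tensorPow, freeze_tensorPow]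
  rw [hB.partialKernel_tensorPow,
    tensor_apply, insertPow_apply, tensorPow_apply,
    Fin.prod_univ_succAbove (fun i => conjS φ (x' i)) α, smul_apply, tensor_apply, smul_eq_mul]
  ring

theorem IsObservable.contraction_tensorPow (h : a + b = n) {A : DVO d (a + 1)}
    {B : DVO d (b + 1)} (hA : IsObservable A) (hB : IsObservable B) (α : Fin (a + 1))
    (β : Fin (b + 1)) (φ : 𝓢(Pt d, ℂ)) :
    contraction h A B α β (tensorPow φ (n + 1)) (conjS (tensorPow φ (n + 1))) =
      -integralPairing (conjS (oneBody A φ)) (oneBody B φ) := by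
  rw [contraction_apply h A hB.gmp, hB.contrKernel_tensorPow, ← genTrace, genTrace_tensor,
    hA.apply_insertPow_tensorPow]

theorem IsObservable.comm1_tensorPow (h : a + b = n) {A : DVO d (a + 1)} {B : DVO d (b + 1)}
    (hA : IsObservable A) (hB : IsObservable B) (φ : 𝓢(Pt d, ℂ)) :
    Complex.I * comm1 h A B (tensorPow φ (n + 1)) (conjS (tensorPow φ (n + 1))) =
      omegaL2 (((a : ℝ) + 1) • oneBody A φ) (((b : ℝ) + 1) • oneBody B φ) := by
  simp only [comm1, sum_apply, sub_apply, hA.contraction_tensorPow h hB,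
    hB.contraction_tensorPow _ hA, Finset.sum_const, Finset.card_univ, Fintype.card_fin]
  rw [← omegaLM_apply, map_smul, map_smul, LinearMap.smul_apply, omegaLM_apply, smul_eq_mul,
    smul_eq_mul, Complex.ofReal_mul, Complex.ofReal_mul, ofReal_omegaL2,
    integralPairing_comm (oneBody A φ)]
  simp only [nsmul_eq_mul]
  push_cast
  ring

theorem finsum_sum_antidiagonal {ι M : Type*} [AddMonoid ι] [Finset.HasAntidiagonal ι]
    [AddCommMonoid M] {c : ι × ι → M} (hc : c.HasFiniteSupport) :
    ∑ᶠ n, ∑ p ∈ Finset.HasAntidiagonal.antidiagonal n, c p = ∑ᶠ p, c p := by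
  classical
  have hmem (p : ι × ι) : p ∈ hc.toFinset ↔ c p ≠ 0 := Set.Finite.mem_toFinset hc
  have hfiber (n : ι) : ∑ p ∈ Finset.HasAntidiagonal.antidiagonal n, c p =
      ∑ p ∈ hc.toFinset, if n = p.1 + p.2 then c p else 0 := by
    rw [← Finset.sum_filter, ← Finset.sum_filter_ne_zero]
    congr 1
    ext p
    simp +contextual [hmem, and_comm, eq_comm (a := n)]
  have hsupp (p : ι × ι) : (fun n => if n = p.1 + p.2 then c p else 0).HasFiniteSupport :=
    (Set.finite_singleton (p.1 + p.2)).subset fun n hn => by_contra fun h => hn (if_neg h)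
  simp only [hfiber]
  rw [finsum_sum_comm _ _ fun p _ => hsupp p, finsum_eq_sum _ hc]
  refine Finset.sum_congr rfl fun p _ => ?_
  rw [finsum_eq_single _ (p.1 + p.2) fun n hn => if_neg hn, if_pos rfl]

section Bilinear

variable {ι κ R M N P : Type*} [CommSemiring R] [AddCommMonoid M] [AddCommMonoid N]
  [AddCommMonoid P] [Module R M] [Module R N] [Module R P] {x : ι → M} {y : κ → N}

theorem hasFiniteSupport_bilinear (L : M →ₗ[R] N →ₗ[R] P) (hx : x.HasFiniteSupport)
    (hy : y.HasFiniteSupport) : (fun p : ι × κ => L (x p.1) (y p.2)).HasFiniteSupport :=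
  (Set.Finite.prod hx hy).subset fun p hp =>
    ⟨fun h => hp (by simp only [h, map_zero, LinearMap.zero_apply]),
      fun h => hp (by simp only [h, map_zero])⟩

theorem bilinear_finsum_finsum (L : M →ₗ[R] N →ₗ[R] P) (hx : x.HasFiniteSupport)
    (hy : y.HasFiniteSupport) :
    L (∑ᶠ i, x i) (∑ᶠ j, y j) = ∑ᶠ p : ι × κ, L (x p.1) (y p.2) := by
  rw [finsum_curry _ (hasFiniteSupport_bilinear L hx hy)]
  simp only [← map_finsum (L _) hy]
  exact map_finsum (L.flip _) hx

end Bilinear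

theorem genTrace_hierBracket_iota {A B : ∀ n, DVO d (n + 1)} (hA : A ∈ GInf d)
    (hB : B ∈ GInf d) (φ : 𝓢(Pt d, ℂ)) (n : ℕ) :
    Complex.I * genTrace (hierBracket A B n) ((iota φ).1 n) =
      ∑ p ∈ Finset.HasAntidiagonal.antidiagonal n,
        (omegaL2 (((p.1 : ℝ) + 1) • oneBody (A p.1) φ)
          (((p.2 : ℝ) + 1) • oneBody (B p.2) φ) : ℂ) := by
  rw [genTrace_iota, hierBracket, conjS_tensorPow, symOp_tensorPow, ← conjS_tensorPow, sum_apply,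
    sum_apply, Finset.mul_sum, ← Finset.sum_attach (Finset.HasAntidiagonal.antidiagonal n)]
  exact Finset.sum_congr rfl fun p _ => (hA.1 _).comm1_tensorPow _ (hB.1 _) φ

theorem trace_hierBracket_iota {A B : ∀ n, DVO d (n + 1)} (hA : A ∈ GInf d) (hB : B ∈ GInf d)
    (φ : 𝓢(Pt d, ℂ)) :
    Complex.I * traceHier (hierBracket A B) (iota φ) = omegaL2 (gradField A φ) (gradField B φ) := by
  let ω : 𝓢(Pt d, ℂ) →ₗ[ℝ] 𝓢(Pt d, ℂ) →ₗ[ℝ] ℂ := (omegaLM d).compr₂ Complex.ofRealCLM.toLinearMap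
  have hω (f g : 𝓢(Pt d, ℂ)) : ω f g = omegaL2 f g := congrArg Complex.ofReal (omegaLM_apply f g)
  let x (n : ℕ) := ((n : ℝ) + 1) • oneBody (A n) φ
  let y (n : ℕ) := ((n : ℝ) + 1) • oneBody (B n) φ
  have hx : x.HasFiniteSupport := hasFiniteSupport_smul_oneBody hA φ
  have hy : y.HasFiniteSupport := hasFiniteSupport_smul_oneBody hB φ
  calc Complex.I * traceHier (hierBracket A B) (iota φ)
      = ∑ᶠ n, ∑ p ∈ Finset.HasAntidiagonal.antidiagonal n, ω (x p.1) (y p.2) := by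
        rw [traceHier, ← smul_eq_mul, smul_finsum]
        simp only [smul_eq_mul, genTrace_hierBracket_iota hA hB, hω, x, y]
    _ = ∑ᶠ p : ℕ × ℕ, ω (x p.1) (y p.2) :=
        finsum_sum_antidiagonal (hasFiniteSupport_bilinear ω hx hy)
    _ = ω (gradField A φ) (gradField B φ) := (bilinear_finsum_finsum ω hx hy).symm
    _ = omegaL2 (gradField A φ) (gradField B φ) := hω _ _

end Bracket

end GPPoisson

end

theorem theorem2p3 (d : ℕ) :
    GPPoisson.IsSmooth (GPPoisson.iota (d := d)) ∧
    (∀ F ∈ GPPoisson.AInf d, F ∘ GPPoisson.iota ∈ GPPoisson.AS d) ∧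
    ∀ F ∈ GPPoisson.AInf d, ∀ G ∈ GPPoisson.AInf d, ∀ φ : SchwartzMap (GPPoisson.Pt d) ℂ,
      ((GPPoisson.poissonL2 (F ∘ GPPoisson.iota) (G ∘ GPPoisson.iota) φ : ℝ) : ℂ) =
        GPPoisson.poissonInf F G (GPPoisson.iota φ) := by
  refine ⟨GPPoisson.isSmooth_of_forall_isCk GPPoisson.isCk_iota, fun F hF => ?_,
    fun F hF G hG φ => ?_⟩
  · obtain ⟨X, hX⟩ := GPPoisson.exists_hasGradient hF
    exact hX.comp_iota_mem_AS
  · obtain ⟨X, hX⟩ := GPPoisson.exists_hasGradient hF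
    obtain ⟨Y, hY⟩ := GPPoisson.exists_hasGradient hG
    rw [GPPoisson.poissonL2, hX.symGrad_comp_iota, hY.symGrad_comp_iota, GPPoisson.poissonInf,
      GPPoisson.trace_hierBracket_iota (hX.diffRep_mem_GInf φ) (hY.diffRep_mem_GInf φ),
      hX.gradField_diffRep, hY.gradField_diffRep]
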